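/- \textbf{Setting.} A \emph{model} $(\mathcal X,\mathcal P)$ is a finite universe with a prior $\mathcal P$ over distributions on $\mathcal X$. In the Bayesian adaptive data analysis game a distribution $\vec p\sim\mathcal P$ is drawn; the curator receives $n$ independent samples from $\vec p$, and the analyst (who knows $\mathcal P$) adaptively asks $q$ queries $f:\mathcal X\to[0,1]$; an answer $a$ is \emph{$\varepsilon$-accurate} if $|\mathbb E_{x\sim\vec p}f(x)-a|<\varepsilon$. Write $f(\mathcal P)$ for the law of $\mathbb E_{x\sim\vec p}f(x)$ under the prior and $\mathbb E[f(\mathcal P')]$ for its mean under the posterior given the samples. An \emph{obfuscated posterior mean} curator answers every query $f$ by a possibly randomized function $g(f(\mathcal P),\mathbb E[f(\mathcal P')])$, with fresh randomness for each query. The \emph{Bayesian private multiplicative weights} (PMW) curator with learning rate $\eta>0$, threshold $T\in\mathbb R$, comparison noise $\xi$ (drawn afresh for each query, of any law, possibly dependent on the randomness of $g$ for that query) and fallback $g$ maintains a proxy distribution $D$ on $\mathcal X$, initially the prior mean. On a query $f$, if $|\mathbb E[f(\mathcal P')]+\xi-\mathbb E_D f|\le T$ he releases $a=\mathbb E_D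 f$; otherwise he releases $a=g(f(\mathcal P),\mathbb E[f(\mathcal P')])$. He then replaces $D(x)$ by a quantity proportional to $D(x)\exp(\eta\,\mathrm{sign}(a-\mathbb E_Df)\,f(x))$ (so $D$ is unchanged when its own answer is released). \emph{Models.} For a linear code $C\subseteq\mathbb F_2^m$, $\mathcal M_C$ is the model on $[m]\times\mathbb F_2$ in which a uniformly random $c\in C$ gives the uniform distribution on $\{(i,c_i):i\in[m]\}$. $U_2$ is a coin with bias uniform on $[0,1]$. $\mathcal M\otimes\mathcal N$ and $\mathcal M^{\otimes k}$ denote tuples of independent samples from independently drawn hypotheses, while $\mathcal M^{r}$ denotes $r$ independent samples from one and the same hypothesis. Call $C$ \emph{good} if its dimension is at least $m/4$ and its distance at least $m/10$, and put $\mathcal H_{C,q}=\bigl(\mathcal M_C\otimes(U_2^{8})^{\otimes(q-1)}\bigr)^{\otimes m}$. \textbf{Statement.} There are absolute constants $\varepsilon,\delta,K>0$ and $N_0$ such that the following two assertions hold. (1) For every $n\ge N_0$ there are $m$ with $m/4\le n\le 20m$, a good code $C$ of length $m$, and $q\le K n^4\log n$ such that, under the model $\mathcal H_{C,q}$ with $n$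 samples, there is a single adaptive analyst strategy asking $q$ queries which causes, with probability at least $\delta$, some answer that is not $\varepsilon$-accurate, both against the obfuscated posterior mean curator with any $g$ and against the Bayesian PMW curator with any fallback $g$, any learning rate, any threshold and any comparison noise. (2) For every $m\ge N_0$ and every good code $C$ of length $m$ there are $n$ with $m/4\le n\le 20m$ and $q\le Kn^4\log n$ such that the same conclusion holds under $\mathcal H_{C,q}$ with $n$ samples. -/

import Mathlib

open MeasureTheory

noncomputable section

namespace BayesADA

/-- A model: a finite universe `X` together with a prior over probability distributions on `X`.
The prior is given by a probability space of hypotheses `Θ`, the hypothesis `θ` being the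
distribution with point masses `pmf θ x`. -/
structure Model where
  X : Type
  [fintypeX : Fintype X]
  Θ : Type
  [measurableSpaceΘ : MeasurableSpace Θ]
  prior : Measure Θ
  [isProbPrior : IsProbabilityMeasure prior]
  pmf : Θ → X → ℝ
  pmf_nonneg : ∀ θ x, 0 ≤ pmf θ x
  sum_pmf : ∀ θ, ∑ x, pmf θ x = 1
  measurable_pmf : ∀ x, Measurable fun θ => pmf θ x

attribute [instance] Model.fintypeX Model.measurableSpaceΘ Model.isProbPrior

namespace Model

/-- The universe is finite and carries the discrete σ-algebra. -/
instance (M : Model) : MeasurableSpace M.X := ⊤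

/-! ### Operations on models -/

/-- The tensor product: independent hypotheses, independent samples, recorded as a pair. -/
def tensor (M N : Model) : Model where
  X := M.X × N.X
  Θ := M.Θ × N.Θ
  prior := M.prior.prod N.prior
  pmf θ x := M.pmf θ.1 x.1 * N.pmf θ.2 x.2
  pmf_nonneg θ x := mul_nonneg (M.pmf_nonneg _ _) (N.pmf_nonneg _ _)
  sum_pmf θ := by
    rw [Fintype.sum_prod_type, ← Fintype.sum_mul_sum, M.sum_pmf, N.sum_pmf, one_mul]
  measurable_pmf x :=
    ((M.measurable_pmf x.1).comp measurable_fst).mul ((N.measurable_pmf x.2).comp measurable_snd)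

/-- The tensor power: `k` independent hypotheses from the prior, one sample from each. -/
def tensorPow (M : Model) (k : ℕ) : Model where
  X := Fin k → M.X
  Θ := Fin k → M.Θ
  prior := Measure.pi fun _ => M.prior
  pmf θ x := ∏ i, M.pmf (θ i) (x i)
  pmf_nonneg θ x := Finset.prod_nonneg fun i _ => M.pmf_nonneg _ _
  sum_pmf θ := by
    classical
    rw [← Fintype.prod_sum fun i y => M.pmf (θ i) y]
    simp [M.sum_pmf]
  measurable_pmf x :=
    Finset.measurable_prod _ fun i _ => (M.measurable_pmf (x i)).comp (measurable_pi_apply i)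

/-- The power: one hypothesis from the prior, `r` independent samples from it. -/
def power (M : Model) (r : ℕ) : Model where
  X := Fin r → M.X
  Θ := M.Θ
  prior := M.prior
  pmf θ x := ∏ i, M.pmf θ (x i)
  pmf_nonneg θ x := Finset.prod_nonneg fun i _ => M.pmf_nonneg _ _
  sum_pmf θ := by
    classical
    rw [← Fintype.prod_sum fun (_ : Fin r) y => M.pmf θ y]
    simp [M.sum_pmf]
  measurable_pmf x := Finset.measurable_prod _ fun i _ => M.measurable_pmf (x i)

/-! ### The two building blocks -/

/-- The uniform model `U₂`: a coin whose bias is uniform on `[0,1]`. -/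
def uniformCoin : Model where
  X := Fin 2
  Θ := unitInterval
  prior := volume
  pmf p x := if x = 1 then (p : ℝ) else 1 - p
  pmf_nonneg p x := by
    split_ifs
    · exact p.2.1
    · exact sub_nonneg.2 p.2.2
  sum_pmf p := by simp
  measurable_pmf x := by
    split_ifs
    · exact measurable_subtype_coe
    · exact measurable_const.sub measurable_subtype_coe

/-- The model of a binary linear code `C` of length `m`, over the universe `[m] × 𝔽₂`: a uniformly
random codeword `c` is the hypothesis that puts mass `1/m` on each point `(i, c i)`. -/
def ofCode {m : ℕ} [NeZero m] (C : Submodule (ZMod 2) (Fin m → ZMod 2)) : Model where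
  X := Fin m × ZMod 2
  Θ := C
  measurableSpaceΘ := ⊤
  prior := @PMF.toMeasure C ⊤ (PMF.uniformOfFinset
    (@Finset.univ C (Fintype.ofFinite C)) ⟨0, by simp⟩)
  isProbPrior := by
    let _ : MeasurableSpace C := ⊤
    infer_instance
  pmf c x := if x.2 = (c : Fin m → ZMod 2) x.1 then 1 / (m : ℝ) else 0
  pmf_nonneg c x := by split_ifs <;> positivity
  sum_pmf c := by
    rw [Fintype.sum_prod_type]
    simp
  measurable_pmf x := @measurable_from_top _ _ _ _

/-! ### Prior and posterior answers -/

variable (M : Model)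

/-- The true answer `E_{x ∼ p_θ} f(x)`. -/
def trueAnswer (θ : M.Θ) (f : M.X → ℝ) : ℝ := ∑ x, M.pmf θ x * f x

/-- The distribution `f(𝒫)` of the true answer to `f` under the prior. -/
def priorLaw (f : M.X → ℝ) : Measure ℝ := M.prior.map fun θ => M.trueAnswer θ f

/-- The prior mean, a distribution on the universe. -/
def priorMean (x : M.X) : ℝ := ∫ θ, M.pmf θ x ∂M.prior

/-- The likelihood of the samples `x₁, …, xₙ` under the hypothesis `θ`. -/
def likelihood {n : ℕ} (x : Fin n → M.X) (θ : M.Θ) : ℝ := ∏ i, M.pmf θ (x i)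

/-- The mean `E[f(𝒫')]` of the true answer to `f` under the posterior `𝒫'` given the samples. -/
def posteriorMean {n : ℕ} (x : Fin n → M.X) (f : M.X → ℝ) : ℝ :=
  (∫ θ, M.likelihood x θ * M.trueAnswer θ f ∂M.prior) / ∫ θ, M.likelihood x θ ∂M.prior

/-- The joint law of the hypothesis, drawn from the prior, and of `n` independent samples from it:
its density with respect to (prior) × (counting measure) is the likelihood. -/
def dataLaw (n : ℕ) : Measure (M.Θ × (Fin n → M.X)) :=
  (M.prior.prod Measure.count).withDensity fun p => ENNReal.ofReal (M.likelihood p.2 p.1)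

theorem measurable_likelihood {n : ℕ} (x : Fin n → M.X) : Measurable (M.likelihood x) :=
  Finset.measurable_prod _ fun i _ => M.measurable_pmf (x i)

theorem sum_likelihood (n : ℕ) (θ : M.Θ) : ∑ x : Fin n → M.X, M.likelihood x θ = 1 :=
  (M.power n).sum_pmf θ

instance (n : ℕ) : IsProbabilityMeasure (M.dataLaw n) := by
  have hm : Measurable fun p : M.Θ × (Fin n → M.X) =>
      ENNReal.ofReal (M.likelihood p.2 p.1) :=
    measurable_from_prod_countable_left fun x => (M.measurable_likelihood x).ennreal_ofReal
  constructor
  rw [dataLaw, withDensity_apply _ MeasurableSet.univ, Measure.restrict_univ,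
    lintegral_prod _ hm.aemeasurable]
  have h : ∀ θ : M.Θ, ∫⁻ x : Fin n → M.X, ENNReal.ofReal (M.likelihood x θ) ∂Measure.count
      = 1 := fun θ => by
    have h0 : ∀ x : Fin n → M.X, 0 ≤ M.likelihood x θ :=
      fun x => Finset.prod_nonneg fun i _ => M.pmf_nonneg _ _
    rw [lintegral_count, tsum_fintype, ← ENNReal.ofReal_sum_of_nonneg fun x _ => h0 x,
      M.sum_likelihood, ENNReal.ofReal_one]
  simp [h]

end Model

/-! ### The game -/

/-- A transcript: the past queries with the answers given to them, latest first. -/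
abbrev Transcript (X : Type) := List ((X → ℝ) × ℝ)

/-- A (deterministic) adaptive analyst strategy: the next query, a function to `[0,1]`, is a
measurable function of the answers received so far (latest first). -/
structure Analyst (X : Type) where
  query : List ℝ → X → ℝ
  query_mem : ∀ l x, query l x ∈ Set.Icc (0 : ℝ) 1
  measurable_query : ∀ t : ℕ, Measurable fun a : Fin t → ℝ => query (List.ofFn a)

/-- A curator who receives `n` samples: the answer to a query depends on the samples, the
transcript so far, the query, and a fresh random seed drawn for every query. -/
structure Curator (M : Model) (n : ℕ) where
  Seed : Type
  [measurableSpaceSeed : MeasurableSpace Seed]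
  seedLaw : Measure Seed
  [isProbSeed : IsProbabilityMeasure seedLaw]
  answer : (Fin n → M.X) → Transcript M.X → (M.X → ℝ) → Seed → ℝ
  measurable_answer : ∀ x h f, Measurable (answer x h f)

attribute [instance] Curator.measurableSpaceSeed Curator.isProbSeed

/-- The transcript of the first `q` rounds, given the samples and the seeds of those rounds. -/
def play {M : Model} {n : ℕ} (A : Analyst M.X) (K : Curator M n) (x : Fin n → M.X) :
    (q : ℕ) → (Fin q → K.Seed) → Transcript M.X
  | 0, _ => []
  | q + 1, u =>
    let h := play A K x q (Fin.init u)
    let f := A.query (h.map Prod.snd)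
    (f, K.answer x h f (u (Fin.last q))) :: h

/-- The probability that all of the first `q` answers are `ε`-accurate: over the hypothesis, the
samples and the randomness of the curator. -/
def accurateProb {M : Model} {n : ℕ} (A : Analyst M.X) (K : Curator M n) (q : ℕ) (ε : ℝ) : ℝ :=
  ((M.dataLaw n).prod (Measure.pi fun _ : Fin q => K.seedLaw)).real
    {ω | ∀ e ∈ play A K ω.1.2 q ω.2, |M.trueAnswer ω.1.1 e.1 - e.2| < ε}

/-! ### Curators -/

/-- A possibly randomized function `g(f(𝒫), E[f(𝒫')])` of the prior law of a query and of its
posterior mean. -/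
structure Obfuscation where
  Seed : Type
  [measurableSpaceSeed : MeasurableSpace Seed]
  seedLaw : Measure Seed
  [isProbSeed : IsProbabilityMeasure seedLaw]
  g : Measure ℝ → ℝ → Seed → ℝ
  measurable_g : ∀ ν a, Measurable (g ν a)

attribute [instance] Obfuscation.measurableSpaceSeed Obfuscation.isProbSeed

/-- The curator who always answers `g(f(𝒫), E[f(𝒫')])`, with fresh randomness for every query. -/
def obfuscatedCurator (M : Model) (n : ℕ) (G : Obfuscation) : Curator M n where
  Seed := G.Seed
  seedLaw := G.seedLaw
  answer x _ f u := G.g (M.priorLaw f) (M.posteriorMean x f) u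
  measurable_answer _ _ _ := G.measurable_g _ _

/-- The multiplicative weights update with learning rate `η` of a distribution `D` on the universe,
after the query `f` was answered by `a`: points on which `f` is large gain weight if `a` exceeds the
answer of `D` itself and lose weight if it falls below; nothing changes if the two agree. -/
def mwUpdate {X : Type} [Fintype X] (η : ℝ) (D : X → ℝ) (f : X → ℝ) (a : ℝ) (x : X) : ℝ :=
  let w : X → ℝ := fun y => D y * Real.exp (η * Real.sign (a - ∑ z, D z * f z) * f y)
  w x / ∑ y, w y

/-- The proxy distribution of private multiplicative weights after a transcript: it starts as the
prior mean and is updated after every answer (the update is void if the proxy's own answer was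
released). -/
def proxy (M : Model) (η : ℝ) : Transcript M.X → M.X → ℝ
  | [] => M.priorMean
  | e :: h => mwUpdate η (proxy M η h) e.1 e.2

/-- The answer of the proxy distribution to a query. -/
def proxyAnswer (M : Model) (η : ℝ) (h : Transcript M.X) (f : M.X → ℝ) : ℝ :=
  ∑ x, proxy M η h x * f x

/-- The Bayesian private multiplicative weights curator with learning rate `η`, threshold `T` and
fallback `G`: if the posterior mean, with noise added, is within `T` of the proxy's answer, the
proxy's answer is released; otherwise the fallback answers, and the proxy is updated towards that
answer. The noise of the comparison is a function of the same seed as the fallback, so the two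
may be independent, or equal as for the noisy posterior mean `E[f(𝒫')] + noise`. -/
def pmwCurator (M : Model) (n : ℕ) (η T : ℝ) (G : Obfuscation) (noise : G.Seed → ℝ)
    (hnoise : Measurable noise) : Curator M n where
  Seed := G.Seed
  seedLaw := G.seedLaw
  answer x h f u :=
    if |M.posteriorMean x f + noise u - proxyAnswer M η h f| ≤ T then proxyAnswer M η h f
    else G.g (M.priorLaw f) (M.posteriorMean x f) u
  measurable_answer x h f := by
    refine Measurable.ite ?_ measurable_const (G.measurable_g _ _)
    exact measurableSet_le
      (measurable_norm.comp ((measurable_const.add hnoise).sub measurable_const))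
      measurable_const

/-! ### The hard model -/

/-- A binary linear code of length `m`, dimension at least `m/4` and distance at least `m/10`. -/
def IsGoodCode {m : ℕ} (C : Submodule (ZMod 2) (Fin m → ZMod 2)) : Prop :=
  m ≤ 4 * Module.finrank (ZMod 2) C ∧
    ∀ c ∈ C, ∀ c' ∈ C, c ≠ c' → m ≤ 10 * hammingDist c c'

/-- The model `(J ⊗ (U₂⁸)^{⊗(q-1)})^{⊗m}`, where `J` is the model of the code `C`. -/
def hardModel {m : ℕ} [NeZero m] (C : Submodule (ZMod 2) (Fin m → ZMod 2)) (q : ℕ) : Model :=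
  ((Model.ofCode C).tensor ((Model.uniformCoin.power 8).tensorPow (q - 1))).tensorPow m

/-- There is one analyst strategy which, with `q` queries, makes an answer `ε`-inaccurate with
probability at least `δ`, both against every obfuscation of the posterior mean and against private
multiplicative weights with that obfuscation as its fallback, whatever the learning rate, the
threshold and the noise of the comparison. -/
def OneStrategyDefeats (M : Model) (n q : ℕ) (ε δ : ℝ) : Prop :=
  ∃ A : Analyst M.X, ∀ G : Obfuscation,
    accurateProb A (obfuscatedCurator M n G) q ε ≤ 1 - δ ∧
    ∀ (η T : ℝ) (noise : G.Seed → ℝ) (hnoise : Measurable noise), 0 < η →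
      accurateProb A (pmwCurator M n η T G noise hnoise) q ε ≤ 1 - δ

end BayesADA

end

/-! ### Laws of the data, posteriors and answers for products of models -/

open MeasureTheory ProbabilityTheory

noncomputable section

namespace BayesADA

namespace Model

variable (M N : Model)

/-! Answers to well-chosen queries leak which code symbols the samples determine. Once these are
known, the analyst can ask a query whose true answer is, given the samples, equally likely to be
either of two values at distance at least 1/10. No curator can answer it accurately with conditional
probability above 1/2.

The leak comes from a `probe`. Its true answer is `1/2 + (p' - 1/2) * ((1 - 1/m) * p + γ/m * e)`,
where `p` and `p'` are the biases of two coins used in no other probe and `e` indicates that symbol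
`j` of a codeword equals `s`. Its posterior mean has the same form, with Laplace's estimates for the
biases and the posterior probability of the symbol, which is 0, 1 or 1/2 (`posteriorMean_probe`).
Three features of this form matter. (a) All probes of live positions have the same prior law
(`priorLaw_probe_eq`), so an obfuscation answers every one by the same random function of its
posterior mean. (b) Reversing the second coin sends a probe to one minus itself and fixes the prior
mean and all other probes. Hence the PMW proxy always answers a probe by 1/2 (`proxyAnswer_probe`),
and PMW too responds by one random function of the posterior mean, whatever its parameters. (c) For
`γ = weight m n`, the change from `e = 0` to `e = 1` moves the posterior mean exactly as one more
head of the first coin does (`probeMean_shift`), and the number of heads is uniform on `0, ..., 8n`.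
The probabilities of an answer far from 1/2, given `e = 1` and given `e = 0`, are therefore averages
of one sequence over two windows shifted by one. Their difference telescopes to the two ends
(`farProb_one_sub_zero`). With no heads, an accurate answer must be near 1/2. With only heads, it
must usually be far from 1/2, because `p'` is usually away from 1/2.

So there is a dichotomy (`farProb_gap_or_errorProb`). Either the two probabilities differ by order
`1/n`, or a single probe is answered inaccurately with probability of order `1/n`. In the second
case, repeated probes of one symbol seen in the samples already produce an error
(`accurate_probes_le`). In the first case, order `n² log n` probes of each symbol reveal, by
Hoeffding, all symbols that the samples determine (`estimate_unreliable_le`). The strategy is the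
same in both cases. The dichotomy concerns only the curator.

Suppose the symbols are revealed and in some factor the samples leave exactly two codewords
(`Ambiguous`). The final query measures agreement with one of them. Translation by their difference
preserves prior and likelihood but changes the true answer by at least 1/10 (`exists_swap`), so the
final answer fails with conditional probability at least 1/2 (`accurate_real_le_half`). Among `m`
independent factors, an ambiguous one exists with constant probability as soon as each is ambiguous
with probability of order `1/m`.

Such a sample size or code is found by a discrete continuity argument on the fraction of degenerate
position tuples, those at which some nonzero codeword vanishes. For a fixed good code this fraction
falls from at least 3/4 to below 1/4 as the length of the tuple grows to `20 m`, and each step loses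
at most the ambiguous fraction (`mul_degenerateCount_le`). For fixed `n` and length `2n`, a greedy
chain of codes is extended one dimension at a time. The fraction rises from at most 1/2 to 1, and
again each step is paid for by ambiguous tuples (`degenerateCount_extension_le`). -/

instance : MeasurableSingletonClass M.X := ⟨fun _ => trivial⟩

theorem likelihood_nonneg {n : ℕ} (x : Fin n → M.X) (θ : M.Θ) : 0 ≤ M.likelihood x θ :=
  Finset.prod_nonneg fun _ _ => M.pmf_nonneg _ _

theorem pmf_le_one (θ : M.Θ) (x : M.X) : M.pmf θ x ≤ 1 :=
  (Finset.single_le_sum (fun y _ => M.pmf_nonneg θ y) (Finset.mem_univ x)).trans (M.sum_pmf θ).le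

theorem likelihood_le_one {n : ℕ} (x : Fin n → M.X) (θ : M.Θ) : M.likelihood x θ ≤ 1 :=
  Finset.prod_le_one (fun _ _ => M.pmf_nonneg _ _) fun _ _ => M.pmf_le_one _ _

theorem lintegral_dataLaw (n : ℕ) {F : M.Θ × (Fin n → M.X) → ENNReal} (hF : Measurable F) :
    ∫⁻ p, F p ∂M.dataLaw n
      = ∑ x : Fin n → M.X, ∫⁻ θ, ENNReal.ofReal (M.likelihood x θ) * F (θ, x) ∂M.prior := by
  have hm : Measurable fun p : M.Θ × (Fin n → M.X) =>
      ENNReal.ofReal (M.likelihood p.2 p.1) :=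
    measurable_from_prod_countable_left fun x => (M.measurable_likelihood x).ennreal_ofReal
  rw [dataLaw, lintegral_withDensity_eq_lintegral_mul _ hm hF,
    lintegral_prod_symm _ (hm.mul hF).aemeasurable, lintegral_count, tsum_fintype]
  rfl

theorem likelihood_mul_indicator_nonneg {n : ℕ} (S : Set (M.Θ × (Fin n → M.X)))
    (x : Fin n → M.X) (θ : M.Θ) :
    0 ≤ M.likelihood x θ * S.indicator (fun _ => (1 : ℝ)) (θ, x) :=
  mul_nonneg (M.likelihood_nonneg x θ) (Set.indicator_nonneg (fun _ _ => zero_le_one) _)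

theorem dataLaw_apply (n : ℕ) {S : Set (M.Θ × (Fin n → M.X))} (hS : MeasurableSet S) :
    M.dataLaw n S = ∑ x : Fin n → M.X, ENNReal.ofReal
      (∫ θ, M.likelihood x θ * S.indicator (fun _ => (1 : ℝ)) (θ, x) ∂M.prior) := by
  rw [← lintegral_indicator_one hS, M.lintegral_dataLaw n (measurable_one.indicator hS)]
  refine Finset.sum_congr rfl fun x _ => ?_
  have hmS : Measurable fun θ => S.indicator (fun _ => (1 : ℝ)) (θ, x) :=
    (measurable_const.indicator hS).comp measurable_prodMk_right
  rw [ofReal_integral_eq_lintegral_ofReal _ (Filter.Eventually.of_forall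
    (M.likelihood_mul_indicator_nonneg S x))]
  · refine lintegral_congr fun θ => ?_
    rw [ENNReal.ofReal_mul (M.likelihood_nonneg x θ)]
    by_cases h : (θ, x) ∈ S <;> simp [h]
  · refine Integrable.of_bound ((M.measurable_likelihood x).mul hmS).aestronglyMeasurable 1 ?_
    refine Filter.Eventually.of_forall fun θ => ?_
    rw [Real.norm_of_nonneg (M.likelihood_mul_indicator_nonneg S x θ)]
    by_cases h : (θ, x) ∈ S <;> simp [h, M.likelihood_le_one]

theorem dataLaw_real_apply (n : ℕ) {S : Set (M.Θ × (Fin n → M.X))} (hS : MeasurableSet S) :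
    (M.dataLaw n).real S = ∑ x : Fin n → M.X,
      ∫ θ, M.likelihood x θ * S.indicator (fun _ => (1 : ℝ)) (θ, x) ∂M.prior := by
  have h0 : ∀ x, 0 ≤ ∫ θ, M.likelihood x θ * S.indicator (fun _ => (1 : ℝ)) (θ, x) ∂M.prior :=
    fun x => integral_nonneg (M.likelihood_mul_indicator_nonneg S x)
  rw [Measure.real, M.dataLaw_apply n hS, ← ENNReal.ofReal_sum_of_nonneg fun x _ => h0 x,
    ENNReal.toReal_ofReal (Finset.sum_nonneg fun x _ => h0 x)]

/-- Data of a tensor product are a pair of data. -/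
def tensorSplit (n : ℕ) (p : (M.tensor N).Θ × (Fin n → (M.tensor N).X)) :
    (M.Θ × (Fin n → M.X)) × (N.Θ × (Fin n → N.X)) :=
  ((p.1.1, fun l => (p.2 l).1), (p.1.2, fun l => (p.2 l).2))

/-- Data of a tensor power are a tuple of data. -/
def tensorPowSplit (k n : ℕ) (p : (M.tensorPow k).Θ × (Fin n → (M.tensorPow k).X)) :
    Fin k → M.Θ × (Fin n → M.X) :=
  fun i => (p.1 i, fun l => p.2 l i)

theorem measurable_tensorSplit (n : ℕ) : Measurable (M.tensorSplit N n) := by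
  refine measurable_from_prod_countable_left fun x => ?_
  change Measurable fun θ : M.Θ × N.Θ => ((θ.1, fun l => (x l).1), (θ.2, fun l => (x l).2))
  exact (measurable_fst.prodMk measurable_const).prodMk (measurable_snd.prodMk measurable_const)

theorem measurable_tensorPowSplit (k n : ℕ) : Measurable (M.tensorPowSplit k n) := by
  refine measurable_from_prod_countable_left fun x => ?_
  change Measurable fun (θ : Fin k → M.Θ) (i : Fin k) => (θ i, fun l => x l i)
  exact measurable_pi_lambda _ fun i => (measurable_pi_apply i).prodMk measurable_const

theorem likelihood_tensor {n : ℕ} (x : Fin n → (M.tensor N).X) (θ : (M.tensor N).Θ) :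
    (M.tensor N).likelihood x θ
      = M.likelihood (fun l => (x l).1) θ.1 * N.likelihood (fun l => (x l).2) θ.2 :=
  Finset.prod_mul_distrib

theorem likelihood_tensorPow {k n : ℕ} (x : Fin n → (M.tensorPow k).X)
    (θ : (M.tensorPow k).Θ) :
    (M.tensorPow k).likelihood x θ = ∏ i, M.likelihood (fun l => x l i) (θ i) := by
  change ∏ l, ∏ i, M.pmf (θ i) (x l i) = ∏ i, ∏ l, M.pmf (θ i) (x l i)
  exact Finset.prod_comm

theorem integral_tensorSplit_preimage {n : ℕ} (s : Set (M.Θ × (Fin n → M.X)))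
    (t : Set (N.Θ × (Fin n → N.X))) (x : Fin n → (M.tensor N).X) :
    ∫ θ, (M.tensor N).likelihood x θ
        * (M.tensorSplit N n ⁻¹' s ×ˢ t).indicator (fun _ => (1 : ℝ)) (θ, x) ∂(M.tensor N).prior
      = (∫ θ, M.likelihood (fun l => (x l).1) θ
          * s.indicator (fun _ => (1 : ℝ)) (θ, fun l => (x l).1) ∂M.prior)
        * ∫ θ, N.likelihood (fun l => (x l).2) θ
          * t.indicator (fun _ => (1 : ℝ)) (θ, fun l => (x l).2) ∂N.prior := by
  rw [← integral_prod_mul]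
  refine integral_congr_ae (Filter.Eventually.of_forall fun θ => ?_)
  dsimp only
  rw [likelihood_tensor]
  have h : (M.tensorSplit N n ⁻¹' s ×ˢ t).indicator (fun _ => (1 : ℝ)) (θ, x)
      = s.indicator (fun _ => (1 : ℝ)) (θ.1, fun l => (x l).1)
        * t.indicator (fun _ => (1 : ℝ)) (θ.2, fun l => (x l).2) := by
    classical
    simp only [Set.indicator_apply, Set.mem_preimage, Set.mem_prod, tensorSplit,
      ite_mul, one_mul, zero_mul, ite_and]
  rw [h]
  ring

theorem integral_tensorPowSplit_preimage {k n : ℕ} (s : Fin k → Set (M.Θ × (Fin n → M.X)))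
    (x : Fin n → (M.tensorPow k).X) :
    ∫ θ, (M.tensorPow k).likelihood x θ * (M.tensorPowSplit k n ⁻¹' Set.pi Set.univ s).indicator
        (fun _ => (1 : ℝ)) (θ, x) ∂(M.tensorPow k).prior
      = ∏ i, ∫ θ, M.likelihood (fun l => x l i) θ
          * (s i).indicator (fun _ => (1 : ℝ)) (θ, fun l => x l i) ∂M.prior := by
  classical
  refine Eq.trans ?_ (integral_fintype_prod_eq_prod (μ := fun _ : Fin k => M.prior)
    fun i (θ : M.Θ) => M.likelihood (fun l => x l i) θ
      * (s i).indicator (fun _ => (1 : ℝ)) (θ, fun l => x l i))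
  refine integral_congr_ae (Filter.Eventually.of_forall fun θ => ?_)
  dsimp only
  rw [likelihood_tensorPow, Finset.prod_mul_distrib]
  congr 1
  simp only [Set.indicator_apply, Finset.prod_ite_zero, Finset.prod_const_one, Set.mem_preimage,
    Set.mem_pi, tensorPowSplit, Set.mem_univ, Finset.mem_univ, forall_const]

/-- Prior and likelihood both factor, so the mass of a box is a product of two sums over samples.
With its analogue for tensor powers, this gives the independence of codes and coins. -/
theorem measurePreserving_tensorSplit (n : ℕ) :
    MeasurePreserving (M.tensorSplit N n) ((M.tensor N).dataLaw n)
      ((M.dataLaw n).prod (N.dataLaw n)) := by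
  refine ⟨M.measurable_tensorSplit N n, (Measure.prod_eq fun s t hs ht => ?_).symm⟩
  rw [Measure.map_apply (M.measurable_tensorSplit N n) (hs.prod ht),
    dataLaw_apply _ _ (M.measurable_tensorSplit N n (hs.prod ht)), M.dataLaw_apply n hs,
    N.dataLaw_apply n ht, Finset.sum_mul_sum, ← Finset.sum_product', Finset.univ_product_univ]
  simp_rw [M.integral_tensorSplit_preimage N s t]
  refine Fintype.sum_equiv (Equiv.arrowProdEquivProdArrow (Fin n) (fun _ => M.X) fun _ => N.X)
    _ _ fun x => ?_
  exact ENNReal.ofReal_mul (integral_nonneg (M.likelihood_mul_indicator_nonneg s _))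

theorem measurePreserving_tensorPowSplit (k n : ℕ) :
    MeasurePreserving (M.tensorPowSplit k n) ((M.tensorPow k).dataLaw n)
      (Measure.pi fun _ => M.dataLaw n) := by
  classical
  refine ⟨M.measurable_tensorPowSplit k n, (Measure.pi_eq fun s hs => ?_).symm⟩
  rw [Measure.map_apply (M.measurable_tensorPowSplit k n) (MeasurableSet.univ_pi hs),
    dataLaw_apply _ _ (M.measurable_tensorPowSplit k n (MeasurableSet.univ_pi hs))]
  simp_rw [M.dataLaw_apply n (hs _), M.integral_tensorPowSplit_preimage s]
  rw [Finset.prod_univ_sum, Fintype.piFinset_univ]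
  refine Fintype.sum_equiv (Equiv.piComm fun (_ : Fin n) (_ : Fin k) => M.X) _ _ fun x => ?_
  exact ENNReal.ofReal_prod_of_nonneg fun i _ =>
    integral_nonneg (M.likelihood_mul_indicator_nonneg (s i) _)

/-! ### Posterior expectations -/

/-- The posterior expectation of a function of the hypothesis. -/
def posteriorExp {n : ℕ} (x : Fin n → M.X) (F : M.Θ → ℝ) : ℝ :=
  (∫ θ, M.likelihood x θ * F θ ∂M.prior) / ∫ θ, M.likelihood x θ ∂M.prior

theorem posteriorMean_eq {n : ℕ} (x : Fin n → M.X) (f : M.X → ℝ) :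
    M.posteriorMean x f = M.posteriorExp x fun θ => M.trueAnswer θ f := rfl

/-- Numerator and normaliser factor separately by Fubini. No positivity is needed, since products of
quotients multiply even when a denominator is zero. -/
theorem posteriorExp_tensor {n : ℕ} (x : Fin n → (M.tensor N).X) (F : M.Θ → ℝ) (G : N.Θ → ℝ) :
    (M.tensor N).posteriorExp x (fun θ => F θ.1 * G θ.2)
      = M.posteriorExp (fun l => (x l).1) F * N.posteriorExp (fun l => (x l).2) G := by
  unfold posteriorExp
  rw [div_mul_div_comm, ← integral_prod_mul, ← integral_prod_mul]
  congr 1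
  · refine integral_congr_ae (Filter.Eventually.of_forall fun θ => ?_)
    dsimp only
    rw [likelihood_tensor]
    ring
  · refine integral_congr_ae (Filter.Eventually.of_forall fun θ => ?_)
    exact M.likelihood_tensor N x θ

theorem posteriorExp_tensorPow {k n : ℕ} (x : Fin n → (M.tensorPow k).X)
    (F : Fin k → M.Θ → ℝ) :
    (M.tensorPow k).posteriorExp x (fun θ => ∏ i, F i (θ i))
      = ∏ i, M.posteriorExp (fun l => x l i) (F i) := by
  unfold posteriorExp
  rw [Finset.prod_div_distrib, ← integral_fintype_prod_eq_prod, ← integral_fintype_prod_eq_prod]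
  congr 1
  · refine integral_congr_ae (Filter.Eventually.of_forall fun θ => ?_)
    dsimp only
    rw [likelihood_tensorPow, Finset.prod_mul_distrib]
  · refine integral_congr_ae (Filter.Eventually.of_forall fun θ => ?_)
    exact M.likelihood_tensorPow x θ

theorem integrable_likelihood_mul {n : ℕ} (x : Fin n → M.X) {F : M.Θ → ℝ} (hF : Measurable F)
    {c : ℝ} (hc : ∀ θ, |F θ| ≤ c) : Integrable (fun θ => M.likelihood x θ * F θ) M.prior := by
  refine Integrable.of_bound ((M.measurable_likelihood x).mul hF).aestronglyMeasurable c ?_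
  refine Filter.Eventually.of_forall fun θ => ?_
  rw [norm_mul, Real.norm_of_nonneg (M.likelihood_nonneg x θ)]
  exact (mul_le_of_le_one_left (norm_nonneg _) (M.likelihood_le_one x θ)).trans (hc θ)

theorem posteriorExp_add {n : ℕ} (x : Fin n → M.X) {F G : M.Θ → ℝ} (hF : Measurable F)
    (hG : Measurable G) {c d : ℝ} (hc : ∀ θ, |F θ| ≤ c) (hd : ∀ θ, |G θ| ≤ d) :
    M.posteriorExp x (fun θ => F θ + G θ) = M.posteriorExp x F + M.posteriorExp x G := by
  unfold posteriorExp
  rw [← add_div, ← integral_add (M.integrable_likelihood_mul x hF hc)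
    (M.integrable_likelihood_mul x hG hd)]
  simp only [mul_add]

theorem posteriorExp_one {n : ℕ} {x : Fin n → M.X} (hx : ∫ θ, M.likelihood x θ ∂M.prior ≠ 0) :
    M.posteriorExp x (fun _ => 1) = 1 := by
  simp [posteriorExp, hx]

/-! ### True answers and prior means -/

theorem trueAnswer_tensor (θ : (M.tensor N).Θ) (F : M.X → ℝ) (G : N.X → ℝ) :
    (M.tensor N).trueAnswer θ (fun x => F x.1 * G x.2)
      = M.trueAnswer θ.1 F * N.trueAnswer θ.2 G := by
  unfold trueAnswer
  rw [Finset.sum_mul_sum, ← Finset.sum_product', Finset.univ_product_univ]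
  refine Finset.sum_congr rfl fun x _ => ?_
  simp only [tensor]
  ring

theorem trueAnswer_tensorPow {k : ℕ} (θ : (M.tensorPow k).Θ) (F : Fin k → M.X → ℝ) :
    (M.tensorPow k).trueAnswer θ (fun x => ∏ i, F i (x i)) = ∏ i, M.trueAnswer (θ i) (F i) := by
  classical
  unfold trueAnswer
  rw [Finset.prod_univ_sum, Fintype.piFinset_univ]
  refine Finset.sum_congr rfl fun x _ => ?_
  rw [Finset.prod_mul_distrib]
  rfl

theorem trueAnswer_add (θ : M.Θ) (f g : M.X → ℝ) :
    M.trueAnswer θ (fun x => f x + g x) = M.trueAnswer θ f + M.trueAnswer θ g := by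
  simp only [trueAnswer, mul_add, Finset.sum_add_distrib]

theorem trueAnswer_const_mul (θ : M.Θ) (c : ℝ) (f : M.X → ℝ) :
    M.trueAnswer θ (fun x => c * f x) = c * M.trueAnswer θ f := by
  simp only [trueAnswer, Finset.mul_sum, mul_left_comm]

theorem trueAnswer_const (θ : M.Θ) (c : ℝ) : M.trueAnswer θ (fun _ => c) = c := by
  simp only [trueAnswer, ← Finset.sum_mul, M.sum_pmf, one_mul]

theorem measurable_trueAnswer (f : M.X → ℝ) : Measurable fun θ => M.trueAnswer θ f :=
  Finset.measurable_sum _ fun x _ => (M.measurable_pmf x).mul_const _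

theorem priorMean_tensor (x : (M.tensor N).X) :
    (M.tensor N).priorMean x = M.priorMean x.1 * N.priorMean x.2 :=
  integral_prod_mul (fun θ => M.pmf θ x.1) fun θ => N.pmf θ x.2

theorem priorMean_tensorPow {k : ℕ} (x : (M.tensorPow k).X) :
    (M.tensorPow k).priorMean x = ∏ i, M.priorMean (x i) :=
  integral_fintype_prod_eq_prod fun i θ => M.pmf θ (x i)

theorem integrable_pmf (x : M.X) : Integrable (fun θ => M.pmf θ x) M.prior := by
  refine Integrable.of_bound (M.measurable_pmf x).aestronglyMeasurable 1 ?_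
  refine Filter.Eventually.of_forall fun θ => ?_
  rw [Real.norm_of_nonneg (M.pmf_nonneg _ _)]
  exact M.pmf_le_one _ _

theorem sum_priorMean : ∑ x, M.priorMean x = 1 := by
  unfold priorMean
  rw [← integral_finsetSum _ fun x _ => M.integrable_pmf x]
  simp [M.sum_pmf]

theorem priorMean_nonneg (x : M.X) : 0 ≤ M.priorMean x :=
  integral_nonneg fun _ => M.pmf_nonneg _ _

end Model

end BayesADA

end

/-! ### The coin of uniform bias: Beta integrals and the number of heads -/

noncomputable section

namespace BayesADA

namespace Model

theorem dataLaw_map_fst (M : Model) (n : ℕ) : (M.dataLaw n).map Prod.fst = M.prior := by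
  refine Measure.ext fun s hs => ?_
  rw [Measure.map_apply measurable_fst hs, M.dataLaw_apply n (measurable_fst hs),
    ← ENNReal.ofReal_sum_of_nonneg fun x _ =>
      integral_nonneg (M.likelihood_mul_indicator_nonneg _ x), ← integral_finsetSum]
  · have h : ∀ θ, ∑ x : Fin n → M.X, M.likelihood x θ
        * (Prod.fst ⁻¹' s).indicator (fun _ => (1 : ℝ)) (θ, x)
        = s.indicator (fun _ => (1 : ℝ)) θ := fun θ => by
      have : ∀ x : Fin n → M.X, (Prod.fst ⁻¹' s).indicator (fun _ => (1 : ℝ)) (θ, x)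
          = s.indicator (fun _ => (1 : ℝ)) θ := fun x => rfl
      simp only [this, ← Finset.sum_mul, M.sum_likelihood, one_mul]
    simp only [h]
    rw [integral_indicator_const _ hs, smul_eq_mul, mul_one, Measure.real,
      ENNReal.ofReal_toReal (measure_ne_top _ _)]
  · intro x _
    refine M.integrable_likelihood_mul x (c := 1)
      (F := fun θ => (Prod.fst ⁻¹' s).indicator (fun _ => (1 : ℝ)) (θ, x))
      (measurable_const.indicator hs) fun θ => ?_
    by_cases h : θ ∈ s <;> simp [h]

/-! ### The coin -/

/-- The coin, flipped eight times. -/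
abbrev coin8 : Model := uniformCoin.power 8

/-- The bias of the coin. -/
def bias : coin8.Θ → ℝ := fun p : unitInterval => (p : ℝ)

theorem bias_nonneg (p : coin8.Θ) : 0 ≤ bias p := Subtype.prop (p := (· ∈ unitInterval)) p |>.1

theorem bias_le_one (p : coin8.Θ) : bias p ≤ 1 := Subtype.prop (p := (· ∈ unitInterval)) p |>.2

theorem measurable_bias : Measurable bias :=
  measurable_subtype_coe (p := fun x : ℝ => x ∈ unitInterval)

/-- A single flip. -/
def flip (y : coin8.X) (r : Fin 8) : Fin 2 := y r

/-- The number of heads among `n` samples of eight flips each. -/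
def heads {n : ℕ} (x : Fin n → coin8.X) : ℕ :=
  (Finset.univ.filter fun lr : Fin n × Fin 8 => flip (x lr.1) lr.2 = 1).card

theorem heads_le {n : ℕ} (x : Fin n → coin8.X) : heads x ≤ 8 * n := by
  refine (Finset.card_le_univ _).trans ?_
  simp [mul_comm]

theorem likelihood_coin8 {n : ℕ} (x : Fin n → coin8.X) (p : coin8.Θ) :
    coin8.likelihood x p = bias p ^ heads x * (1 - bias p) ^ (8 * n - heads x) := by
  have h1 : coin8.likelihood x p
      = ∏ lr : Fin n × Fin 8, if flip (x lr.1) lr.2 = 1 then bias p else 1 - bias p := by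
    rw [Fintype.prod_prod_type]
    rfl
  rw [h1, Finset.prod_ite, Finset.prod_const, Finset.prod_const]
  congr 2
  have := Finset.card_filter_add_card_filter_not (s := (Finset.univ : Finset (Fin n × Fin 8)))
    fun lr => flip (x lr.1) lr.2 = 1
  simp only [Finset.card_univ, Fintype.card_prod, Fintype.card_fin] at this
  unfold heads
  omega

theorem integral_unitInterval (f : ℝ → ℝ) :
    ∫ p : unitInterval, f p = ∫ p in (0 : ℝ)..1, f p := by
  rw [intervalIntegral.integral_of_le zero_le_one, ← integral_Icc_eq_integral_Ioc]
  exact integral_subtype measurableSet_Icc f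

/-- The Beta integral, by induction on `j` for all `k` at once: splitting off one factor `1 - p`
leaves a difference of two integrals with a smaller `j`. -/
theorem integral_pow_mul_one_sub_pow (k j : ℕ) :
    ∫ p, bias p ^ k * (1 - bias p) ^ j ∂coin8.prior
      = (k.factorial * j.factorial : ℝ) / (k + j + 1).factorial := by
  refine (integral_unitInterval fun p => p ^ k * (1 - p) ^ j).symm.symm.trans ?_
  induction j generalizing k with
  | zero =>
    simp only [pow_zero, mul_one, integral_pow, Nat.factorial_zero, Nat.cast_one, Nat.add_zero,
      Nat.factorial_succ]
    have := Nat.factorial_pos k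
    field_simp
    push_cast
    simp
  | succ j ih =>
    have h : ∀ p : ℝ, p ^ k * (1 - p) ^ (j + 1) = p ^ k * (1 - p) ^ j - p ^ (k + 1) * (1 - p) ^ j :=
      fun p => by ring
    simp only [h]
    rw [intervalIntegral.integral_sub (Continuous.intervalIntegrable (by fun_prop) _ _)
      (Continuous.intervalIntegrable (by fun_prop) _ _), ih, ih]
    have e1 : k + (j + 1) + 1 = (k + j + 1) + 1 := by ring
    have e2 : k + 1 + j + 1 = (k + j + 1) + 1 := by ring
    rw [e1, e2, Nat.factorial_succ (k + j + 1), Nat.factorial_succ k, Nat.factorial_succ j]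
    have := Nat.factorial_pos (k + j + 1)
    field_simp
    push_cast
    ring

theorem integral_likelihood_coin8 {n : ℕ} (x : Fin n → coin8.X) :
    ∫ p, coin8.likelihood x p ∂coin8.prior
      = ((heads x).factorial * (8 * n - heads x).factorial : ℝ) / (8 * n + 1).factorial := by
  have h := integral_pow_mul_one_sub_pow (heads x) (8 * n - heads x)
  rw [Nat.add_sub_cancel' (heads_le x)] at h
  rw [← h]
  exact integral_congr_ae (Filter.Eventually.of_forall fun p => likelihood_coin8 x p)

theorem integral_likelihood_coin8_pos {n : ℕ} (x : Fin n → coin8.X) :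
    0 < ∫ p, coin8.likelihood x p ∂coin8.prior := by
  rw [integral_likelihood_coin8]
  positivity

/-- Laplace's rule of succession, a quotient of two consecutive Beta integrals. It is affine in the
number of heads, so one more head always moves it by `1 / (8n + 2)`. A code symbol is later weighted
to imitate this step. -/
theorem posteriorExp_coin8 {n : ℕ} (x : Fin n → coin8.X) :
    coin8.posteriorExp x bias = (heads x + 1 : ℝ) / (8 * n + 2) := by
  unfold posteriorExp
  rw [integral_likelihood_coin8]
  have h := integral_pow_mul_one_sub_pow (heads x + 1) (8 * n - heads x)
  have e : heads x + 1 + (8 * n - heads x) + 1 = (8 * n + 1) + 1 := by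
    have := heads_le x; omega
  rw [e, Nat.factorial_succ (8 * n + 1), Nat.factorial_succ] at h
  have h' : ∫ p, coin8.likelihood x p * bias p ∂coin8.prior
      = ∫ p, bias p ^ (heads x + 1) * (1 - bias p) ^ (8 * n - heads x) ∂coin8.prior := by
    refine integral_congr_ae (Filter.Eventually.of_forall fun p => ?_)
    dsimp only
    rw [likelihood_coin8]
    ring
  rw [h', h]
  have h1 := Nat.factorial_pos (8 * n + 1)
  have h2 := Nat.factorial_pos (heads x)
  have h3 := Nat.factorial_pos (8 * n - heads x)
  push_cast
  field_simp
  ring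

theorem card_heads_eq (n k : ℕ) :
    (Finset.univ.filter fun x : Fin n → coin8.X => heads x = k).card
      = (8 * n).choose k := by
  have h : (8 * n).choose k
      = (Finset.powersetCard k (Finset.univ : Finset (Fin n × Fin 8))).card := by
    rw [Finset.card_powersetCard]; simp [mul_comm]
  rw [h]
  refine Finset.card_nbij' (fun x => Finset.univ.filter fun lr => flip (x lr.1) lr.2 = 1)
    (fun s l r => (if (l, r) ∈ s then 1 else 0 : Fin 2)) ?_ ?_ ?_ ?_
  · intro x hx
    simpa [heads, Finset.mem_powersetCard] using (Finset.mem_filter.1 hx).2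
  · intro s hs
    refine Finset.mem_filter.2 ⟨Finset.mem_univ _, ?_⟩
    simpa [heads, flip, Finset.mem_powersetCard] using (Finset.mem_powersetCard.1 hs).2
  · intro x _
    funext l r
    have h : ∀ b : Fin 2, (if b = 1 then 1 else 0) = b := by decide
    refine Eq.trans ?_ (h (flip (x l) r))
    simp
  · intro s _
    ext lr
    simp [flip]

theorem dataLaw_coin8_heads_inter (n k : ℕ) {S : Set coin8.Θ} (hS : MeasurableSet S) :
    (coin8.dataLaw n).real {z | heads z.2 = k ∧ z.1 ∈ S}
      = (8 * n).choose k * ∫ p in S, bias p ^ k * (1 - bias p) ^ (8 * n - k) ∂coin8.prior := by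
  have hm : MeasurableSet {z : coin8.Θ × (Fin n → coin8.X) | heads z.2 = k ∧ z.1 ∈ S} := by
    have h2 : Measurable fun x : Fin n → coin8.X => heads x := Measurable.of_discrete
    exact (measurableSet_eq_fun (h2.comp measurable_snd) measurable_const).inter
      (measurable_fst hS)
  refine (coin8.dataLaw_real_apply n hm).trans ?_
  have h : ∀ x : Fin n → coin8.X, (∫ p, coin8.likelihood x p
      * {z : coin8.Θ × (Fin n → coin8.X) | heads z.2 = k ∧ z.1 ∈ S}.indicator
        (fun _ => (1 : ℝ)) (p, x) ∂coin8.prior)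
      = if heads x = k then (∫ p in S, bias p ^ k * (1 - bias p) ^ (8 * n - k) ∂coin8.prior) else 0 := fun x => by
    split_ifs with hx
    · rw [← integral_indicator hS]
      refine integral_congr_ae (Filter.Eventually.of_forall fun p => ?_)
      dsimp only
      rw [likelihood_coin8, hx]
      by_cases hp : p ∈ S <;> simp [hp, hx]
    · simp [hx]
  refine (Finset.sum_congr rfl fun x _ => h x).trans ?_
  rw [← Finset.sum_filter, Finset.sum_const, nsmul_eq_mul]
  congr 2
  exact card_heads_eq n k

/-- The binomial coefficient cancels the Beta integral, so the number of heads is uniform. The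
telescoping of response probabilities rests on this. -/
theorem dataLaw_coin8_heads {n k : ℕ} (hk : k ≤ 8 * n) :
    (coin8.dataLaw n).real {z | heads z.2 = k} = 1 / (8 * n + 1) := by
  have h := dataLaw_coin8_heads_inter n k MeasurableSet.univ
  simp only [Set.mem_univ, and_true, Measure.restrict_univ] at h
  refine h.trans ?_
  rw [integral_pow_mul_one_sub_pow, Nat.add_sub_cancel' hk, Nat.factorial_succ,
    ← Nat.choose_mul_factorial_mul_factorial hk]
  have h1 := Nat.choose_pos hk
  have h2 := Nat.factorial_pos k
  have h3 := Nat.factorial_pos (8 * n - k)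
  push_cast
  field_simp

/-- A run without heads has likelihood at most `(1 - a) ^ (8n)` for every bias above `a`. The second
alternative only disposes of the meaningless range of `a`. -/
theorem dataLaw_coin8_no_heads (n : ℕ) (a : ℝ) :
    (coin8.dataLaw n).real {z : coin8.Θ × (Fin n → coin8.X) |
      heads z.2 = 0 ∧ a < bias z.1} ≤ (1 - a) ^ (8 * n) ∨ 1 < a := by
  rcases lt_or_ge 1 a with ha | ha
  · exact .inr ha
  left
  have hS : MeasurableSet {p | a < bias p} :=
    measurableSet_lt measurable_const measurable_bias
  refine (dataLaw_coin8_heads_inter n 0 hS).trans_le ?_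
  simp only [Nat.choose_zero_right, Nat.cast_one, pow_zero, one_mul, Nat.sub_zero]
  have h := norm_setIntegral_le_of_norm_le_const (C := (1 - a) ^ (8 * n))
    (f := fun p => (1 - bias p) ^ (8 * n))
    (measure_lt_top coin8.prior {p | a < bias p})
    fun p (hp : a < bias p) => by
      have : 0 ≤ 1 - bias p := sub_nonneg.2 (bias_le_one p)
      rw [Real.norm_of_nonneg (by positivity)]
      exact pow_le_pow_left₀ this (by linarith) _
  refine (le_abs_self _).trans (h.trans ?_)
  exact mul_le_of_le_one_right (pow_nonneg (by linarith) _) measureReal_le_one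

theorem dataLaw_coin8_all_heads (n : ℕ) {a : ℝ} (ha : 0 ≤ a) :
    (coin8.dataLaw n).real {z : coin8.Θ × (Fin n → coin8.X) |
      heads z.2 = 8 * n ∧ bias z.1 < a} ≤ a ^ (8 * n) := by
  have hS : MeasurableSet {p | bias p < a} :=
    measurableSet_lt measurable_bias measurable_const
  refine (dataLaw_coin8_heads_inter n (8 * n) hS).trans_le ?_
  simp only [Nat.choose_self, Nat.cast_one, pow_zero, one_mul, mul_one, Nat.sub_self]
  have h := norm_setIntegral_le_of_norm_le_const (C := a ^ (8 * n))
    (f := fun p => bias p ^ (8 * n))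
    (measure_lt_top coin8.prior {p | bias p < a})
    fun p (hp : bias p < a) => by
      rw [Real.norm_of_nonneg (pow_nonneg (bias_nonneg p) _)]
      exact pow_le_pow_left₀ (bias_nonneg p) hp.le _
  refine (le_abs_self _).trans (h.trans ?_)
  exact mul_le_of_le_one_right (pow_nonneg ha _) measureReal_le_one

/-- The chance that the second coin of a probe is too nearly fair to carry the value of the probe
away from 1/2. -/
theorem volume_unitInterval_near_half :
    (volume : Measure unitInterval).real {p | |(p : ℝ) - 1 / 2| < 1 / 6} ≤ 1 / 3 := by
  have e : {p : unitInterval | |(p : ℝ) - 1 / 2| < 1 / 6}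
      = Subtype.val ⁻¹' Set.Ioo (1 / 3 : ℝ) (2 / 3) := by
    ext p
    simp only [Set.mem_ofPred_eq, Set.mem_preimage, Set.mem_Ioo, abs_lt]
    constructor <;> rintro ⟨h1, h2⟩ <;> constructor <;> linarith
  rw [e, Measure.real, unitInterval.volume_def,
    (MeasurableEmbedding.subtype_coe measurableSet_Icc).comap_preimage]
  refine ENNReal.toReal_le_of_le_ofReal (by norm_num) ((measure_mono Set.inter_subset_left).trans ?_)
  rw [Real.volume_Ioo]
  norm_num

/-- The substitution `p ↦ 1 - p` preserves the uniform law of the bias. This is the symmetry that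
blinds the proxy. -/
theorem priorMean_coin8_flip (y : Fin 8 → Fin 2) :
    coin8.priorMean (fun r => 1 - y r) = coin8.priorMean y := by
  change ∫ p : unitInterval, ∏ r : Fin 8, (if 1 - y r = 1 then (p : ℝ) else 1 - p)
    = ∫ p : unitInterval, ∏ r : Fin 8, (if y r = 1 then (p : ℝ) else 1 - p)
  rw [← unitInterval.measurePreserving_symm.integral_comp
    unitInterval.symmMeasurableEquiv.measurableEmbedding]
  refine integral_congr_ae (Filter.Eventually.of_forall fun p => Finset.prod_congr rfl fun r _ => ?_)
  have : y r = 0 ∨ y r = 1 := by omega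
  rcases this with h | h <;> simp [h]

end Model

end BayesADA

end

/-! ### The model of a code: consistent codewords and posterior symbols -/

noncomputable section

namespace BayesADA

/-- The positions `p` determine a codeword of `C` up to the addition of one nonzero word. -/
def Ambiguous {m n : ℕ} (C : Submodule (ZMod 2) (Fin m → ZMod 2)) (p : Fin n → Fin m) : Prop :=
  ∃ w ∈ C, w ≠ 0 ∧ (∀ l, w (p l) = 0) ∧ ∀ v ∈ C, (∀ l, v (p l) = 0) → v = 0 ∨ v = w

namespace Model

section Code

variable {m : ℕ} [NeZero m] (C : Submodule (ZMod 2) (Fin m → ZMod 2))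

instance : Finite (ofCode C).Θ := inferInstanceAs (Finite C)

instance : Fintype (ofCode C).Θ := Fintype.ofFinite _

instance : Nonempty (ofCode C).Θ := ⟨(0 : C)⟩

instance : DiscreteMeasurableSpace (ofCode C).Θ := ⟨fun _ => trivial⟩

variable {C}

/-- The codeword of a hypothesis. -/
def word (c : (ofCode C).Θ) : Fin m → ZMod 2 := Subtype.val (p := (· ∈ C)) c

theorem word_mem (c : (ofCode C).Θ) : word c ∈ C := Subtype.prop (p := (· ∈ C)) c

theorem word_injective : Function.Injective (word (C := C)) := Subtype.val_injective

/-- The hypothesis of a codeword. -/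
def ofWord (w : Fin m → ZMod 2) (hw : w ∈ C) : (ofCode C).Θ := (⟨w, hw⟩ : C)

@[simp] theorem word_ofWord (w : Fin m → ZMod 2) (hw : w ∈ C) : word (ofWord w hw) = w := rfl

/-- The position of a sample. -/
def pos (z : (ofCode C).X) : Fin m := Prod.fst (α := Fin m) (β := ZMod 2) z

/-- The symbol of a sample. -/
def bit (z : (ofCode C).X) : ZMod 2 := Prod.snd (α := Fin m) (β := ZMod 2) z

/-- The sample at position `j` of a codeword. -/
def sampleAt (c : (ofCode C).Θ) (j : Fin m) : (ofCode C).X := ((j, word c j) : Fin m × ZMod 2)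

@[simp] theorem pos_sampleAt (c : (ofCode C).Θ) (j : Fin m) : pos (sampleAt c j) = j := rfl

@[simp] theorem bit_sampleAt (c : (ofCode C).Θ) (j : Fin m) : bit (sampleAt c j) = word c j := rfl

/-- The codeword agrees with the samples. -/
def Consistent {n : ℕ} (y : Fin n → (ofCode C).X) (c : (ofCode C).Θ) : Prop :=
  ∀ l, word c (pos (y l)) = bit (y l)

open Classical in
theorem pmf_ofCode (c : (ofCode C).Θ) (z : (ofCode C).X) :
    (ofCode C).pmf c z = if z = sampleAt c (pos z) then 1 / (m : ℝ) else 0 := by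
  change (if bit z = word c (pos z) then _ else _) = _
  have : bit z = word c (pos z) ↔ z = sampleAt c (pos z) :=
    ⟨fun h => Prod.ext rfl h, fun h => congrArg bit h⟩
  exact if_congr this rfl rfl

theorem trueAnswer_ofCode (c : (ofCode C).Θ) (F : (ofCode C).X → ℝ) :
    (ofCode C).trueAnswer c F = (1 / (m : ℝ)) * ∑ j, F (sampleAt c j) := by
  classical
  unfold trueAnswer
  simp only [pmf_ofCode, ite_mul, zero_mul]
  rw [← Finset.sum_filter, Finset.mul_sum]
  refine Finset.sum_nbij' pos (sampleAt c) ?_ ?_ ?_ ?_ ?_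
  · simp
  · simp
  · intro z hz
    exact (Finset.mem_filter.1 hz).2.symm
  · simp
  · intro z hz
    rw [← (Finset.mem_filter.1 hz).2]

open Classical in
-- Since the likelihood is constant on consistent codewords and zero elsewhere, the posterior is
-- uniform on the consistent codewords.
theorem likelihood_ofCode {n : ℕ} (y : Fin n → (ofCode C).X) (c : (ofCode C).Θ) :
    (ofCode C).likelihood y c = if Consistent y c then (1 / (m : ℝ)) ^ n else 0 := by
  have h : ∀ l, (ofCode C).pmf c (y l)
      = if word c (pos (y l)) = bit (y l) then 1 / (m : ℝ) else 0 := fun l =>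
    if_congr eq_comm rfl rfl
  unfold likelihood
  simp only [h, Finset.prod_ite_zero, Finset.mem_univ, forall_const, Finset.prod_const,
    Finset.card_univ, Fintype.card_fin]
  exact if_congr Iff.rfl rfl rfl

theorem prior_ofCode_singleton (c : (ofCode C).Θ) :
    (ofCode C).prior.real {c} = 1 / (Fintype.card (ofCode C).Θ : ℝ) := by
  have h := @PMF.toMeasure_apply_singleton C ⊤ (PMF.uniformOfFinset
    (@Finset.univ C (Fintype.ofFinite C)) ⟨0, by simp⟩) c trivial
  have h2 : (ofCode C).prior {c} = (Fintype.card (ofCode C).Θ : ENNReal)⁻¹ := by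
    refine h.trans ?_
    exact PMF.uniformOfFinset_apply_of_mem _ (@Finset.mem_univ C (Fintype.ofFinite C) c)
  rw [Measure.real, h2]
  simp

theorem integral_prior_ofCode (F : (ofCode C).Θ → ℝ) :
    ∫ c, F c ∂(ofCode C).prior = (1 / (Fintype.card (ofCode C).Θ : ℝ)) * ∑ c, F c := by
  rw [integral_fintype (Integrable.of_finite), Finset.mul_sum]
  simp only [prior_ofCode_singleton, smul_eq_mul]

/-- Translation of the hypothesis by a codeword. -/
def translate (w : Fin m → ZMod 2) (hw : w ∈ C) (c : (ofCode C).Θ) : (ofCode C).Θ :=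
  ofWord (word c + w) (C.add_mem (word_mem c) hw)

@[simp] theorem word_translate (w : Fin m → ZMod 2) (hw : w ∈ C) (c : (ofCode C).Θ) :
    word (translate w hw c) = word c + w := rfl

theorem translate_involutive (w : Fin m → ZMod 2) (hw : w ∈ C) :
    Function.Involutive (translate w hw) := fun c => by
  refine word_injective ?_
  rw [word_translate, word_translate, add_assoc]
  have : w + w = 0 := by
    ext j
    exact CharTwo.add_self_eq_zero (w j)
  rw [this, add_zero]

theorem measurePreserving_translate (w : Fin m → ZMod 2) (hw : w ∈ C) :
    MeasurePreserving (translate w hw) (ofCode C).prior (ofCode C).prior := by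
  refine ⟨Measurable.of_discrete, (Measure.ext_iff_singleton).2 fun c => ?_⟩
  rw [Measure.map_apply Measurable.of_discrete (measurableSet_singleton c)]
  have : translate w hw ⁻¹' {c} = {translate w hw c} := by
    ext d
    simp only [Set.mem_preimage, Set.mem_singleton_iff]
    constructor
    · rintro rfl
      exact (translate_involutive w hw d).symm
    · rintro rfl
      exact translate_involutive w hw c
  rw [this, ← measureReal_eq_measureReal_iff, prior_ofCode_singleton, prior_ofCode_singleton]

open Classical in
/-- Under the law of the data, the positions are uniform and independent of the codeword, and the
symbols are those of the codeword. -/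
theorem dataLaw_ofCode_real (n : ℕ) (S : Set ((ofCode C).Θ × (Fin n → (ofCode C).X))) :
    ((ofCode C).dataLaw n).real S = (1 / (Fintype.card (ofCode C).Θ : ℝ)) * ∑ c,
      (1 / (m : ℝ)) ^ n * ((Finset.univ.filter fun p : Fin n → Fin m =>
        (c, fun l => sampleAt c (p l)) ∈ S).card : ℝ) := by
  rw [dataLaw_real_apply _ _ (MeasurableSet.of_discrete)]
  simp only [integral_prior_ofCode]
  rw [← Finset.mul_sum, Finset.sum_comm]
  congr 1
  refine Finset.sum_congr rfl fun c _ => ?_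
  simp only [likelihood_ofCode, ite_mul, zero_mul]
  rw [← Finset.sum_filter, ← Finset.mul_sum]
  congr 1
  rw [Finset.card_filter, Nat.cast_sum]
  refine Finset.sum_nbij' (fun y l => pos (y l)) (fun p l => sampleAt c (p l)) ?_ ?_ ?_ ?_ ?_
  · simp
  · intro p _
    exact Finset.mem_filter.2 ⟨Finset.mem_univ _, fun l => rfl⟩
  · intro y hy
    funext l
    exact Prod.ext rfl ((Finset.mem_filter.1 hy).2 l)
  · simp
  · intro y hy
    have : (fun l => sampleAt c (pos (y l))) = y := by
      funext l
      exact Prod.ext rfl ((Finset.mem_filter.1 hy).2 l)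
    rw [this]
    simp [Set.indicator_apply]

theorem ae_consistent (n : ℕ) : ∀ᵐ z ∂(ofCode C).dataLaw n, Consistent z.2 z.1 := by
  classical
  rw [ae_iff, ← measureReal_eq_zero_iff, dataLaw_ofCode_real]
  simp [Consistent]

open Classical in
theorem dataLaw_ofCode_pos (n : ℕ) (P : (Fin n → Fin m) → Prop) :
    ((ofCode C).dataLaw n).real {z | P fun l => pos (z.2 l)}
      = (1 / (m : ℝ)) ^ n * ((Finset.univ.filter P).card : ℝ) := by
  rw [dataLaw_ofCode_real]
  have h : ∀ c : (ofCode C).Θ, (Finset.univ.filter fun p : Fin n → Fin m =>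
      (c, fun l => sampleAt c (p l)) ∈ {z : (ofCode C).Θ × (Fin n → (ofCode C).X) |
        P fun l => pos (z.2 l)}) = Finset.univ.filter P := fun c =>
    Finset.filter_congr fun p _ => Iff.rfl
  simp only [h, Finset.sum_const, nsmul_eq_mul, Finset.card_univ]
  have : (Fintype.card (ofCode C).Θ : ℝ) ≠ 0 := by positivity
  field_simp

/-! ### The posterior of a symbol -/

theorem integral_likelihood_ofCode_pos {n : ℕ} {y : Fin n → (ofCode C).X} {c : (ofCode C).Θ}
    (hc : Consistent y c) : 0 < ∫ c, (ofCode C).likelihood y c ∂(ofCode C).prior := by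
  classical
  rw [integral_prior_ofCode]
  have h1 : (0 : ℝ) < Fintype.card (ofCode C).Θ := by positivity
  have h2 : (0 : ℝ) < m := by exact_mod_cast NeZero.pos m
  refine mul_pos (by positivity) (Finset.sum_pos' (fun c _ => likelihood_nonneg _ _ _)
    ⟨c, Finset.mem_univ _, ?_⟩)
  rw [likelihood_ofCode, if_pos hc]
  positivity

/-- The samples see a codeword only at the sampled positions, where `w` vanishes. This is the source
of all posterior symmetries used later. -/
theorem likelihood_translate {n : ℕ} {y : Fin n → (ofCode C).X} {w : Fin m → ZMod 2} (hw : w ∈ C)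
    (h : ∀ l, w (pos (y l)) = 0) (c : (ofCode C).Θ) :
    (ofCode C).likelihood y (translate w hw c) = (ofCode C).likelihood y c := by
  classical
  rw [likelihood_ofCode, likelihood_ofCode]
  simp [Consistent, h]

/-- The posterior probability that the symbol at `j` is `s`. -/
def symbolProb {n : ℕ} (y : Fin n → (ofCode C).X) (j : Fin m) (s : ZMod 2) : ℝ :=
  (ofCode C).posteriorExp y fun c => if word c j = s then 1 else 0

theorem symbolProb_eq_one {n : ℕ} {y : Fin n → (ofCode C).X} {j : Fin m} {s : ZMod 2}
    {c : (ofCode C).Θ} (hc : Consistent y c) (h : ∀ c, Consistent y c → word c j = s) :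
    symbolProb y j s = 1 := by
  classical
  refine Eq.trans ?_ (posteriorExp_one _ (integral_likelihood_ofCode_pos hc).ne')
  unfold symbolProb posteriorExp
  congr 1
  refine integral_congr_ae (Filter.Eventually.of_forall fun c => ?_)
  by_cases h1 : Consistent y c
  · simp [h c h1]
  · simp [likelihood_ofCode, h1]

theorem symbolProb_eq_zero {n : ℕ} {y : Fin n → (ofCode C).X} {j : Fin m} {s : ZMod 2}
    (h : ∀ c, Consistent y c → word c j ≠ s) : symbolProb y j s = 0 := by
  classical
  rw [symbolProb, posteriorExp, div_eq_zero_iff]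
  left
  refine (integral_congr_ae (Filter.Eventually.of_forall fun c => ?_)).trans (integral_zero _ _)
  by_cases h1 : Consistent y c
  · simp [h c h1]
  · simp [likelihood_ofCode, h1]

/-- Translation by the difference of `c` and `d` preserves prior and likelihood and exchanges the
two symbols at `j`, so both have the same posterior probability. -/
theorem symbolProb_eq_half {n : ℕ} {y : Fin n → (ofCode C).X} {j : Fin m} (s : ZMod 2)
    {c d : (ofCode C).Θ} (hc : Consistent y c) (hd : Consistent y d) (hcd : word c j ≠ word d j) :
    symbolProb y j s = 1 / 2 := by
  have hw : word c + word d ∈ C := C.add_mem (word_mem c) (word_mem d)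
  have hwy : ∀ l, (word c + word d) (pos (y l)) = 0 := fun l => by
    rw [Pi.add_apply, hc l, hd l]
    exact CharTwo.add_self_eq_zero _
  have hwj : (word c + word d) j = 1 := by
    rw [Pi.add_apply]
    generalize word c j = a at *
    generalize word d j = b at *
    revert a b
    decide
  have key : symbolProb y j s
      = (ofCode C).posteriorExp y fun c => if word c j = s then 0 else 1 := by
    unfold symbolProb posteriorExp
    congr 1
    rw [← (measurePreserving_translate _ hw).integral_comp
      (MeasurableEmbedding.of_measurable_inverse Measurable.of_discrete MeasurableSet.of_discrete
        Measurable.of_discrete (translate_involutive _ hw).leftInverse)]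
    refine integral_congr_ae (Filter.Eventually.of_forall fun c => ?_)
    dsimp only
    rw [likelihood_translate hw hwy, word_translate, Pi.add_apply, hwj]
    congr 1
    have : ∀ a b : ZMod 2, (a + 1 = b) ↔ ¬ a = b := by decide
    simp only [this, ite_not]
  have hsum : symbolProb y j s
      + (ofCode C).posteriorExp y (fun c => if word c j = s then 0 else 1) = 1 := by
    refine Eq.trans ?_ (posteriorExp_one _ (integral_likelihood_ofCode_pos hc).ne')
    rw [symbolProb, ← posteriorExp_add _ _ (c := 1) (d := 1) Measurable.of_discrete Measurable.of_discrete]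
    · congr 1
      funext c
      split_ifs <;> simp
    · intro c
      split_ifs <;> simp
    · intro c
      split_ifs <;> simp
  linarith

/-! ### Answers to the queries to a code -/

theorem trueAnswer_pos_ne (c : (ofCode C).Θ) (j : Fin m) :
    (ofCode C).trueAnswer c (fun z => if pos z = j then 0 else 1) = 1 - 1 / (m : ℝ) := by
  have h2 : (0 : ℝ) < m := by exact_mod_cast NeZero.pos m
  have h : ∀ k : Fin m, (if k = j then (0 : ℝ) else 1) = 1 - if k = j then 1 else 0 := fun k => by
    split_ifs <;> simp
  rw [trueAnswer_ofCode]
  change (1 / (m : ℝ)) * ∑ k : Fin m, (if k = j then (0 : ℝ) else 1) = _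
  simp only [h, Finset.sum_sub_distrib, Finset.sum_ite_eq', Finset.mem_univ,
    if_true, Finset.sum_const, Finset.card_univ, Fintype.card_fin, nsmul_eq_mul]
  field_simp

theorem trueAnswer_symbol (c : (ofCode C).Θ) (j : Fin m) (s : ZMod 2) :
    (ofCode C).trueAnswer c (fun z => if pos z = j ∧ bit z = s then 1 else 0)
      = (1 / (m : ℝ)) * if word c j = s then 1 else 0 := by
  rw [trueAnswer_ofCode]
  change (1 / (m : ℝ)) * ∑ k : Fin m, (if k = j ∧ word c k = s then (1 : ℝ) else 0) = _
  simp only [ite_and]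
  simp

theorem trueAnswer_agree (c : (ofCode C).Θ) (v : Fin m → ZMod 2) :
    (ofCode C).trueAnswer c (fun z => if bit z = v (pos z) then 1 else 0)
      = 1 - hammingDist (word c) v / (m : ℝ) := by
  have h2 : (0 : ℝ) < m := by exact_mod_cast NeZero.pos m
  have h : ∀ k : Fin m, (if word c k = v k then (1 : ℝ) else 0)
      = 1 - if word c k ≠ v k then 1 else 0 := fun k => by
    split_ifs <;> simp_all
  rw [trueAnswer_ofCode]
  change (1 / (m : ℝ)) * ∑ k : Fin m, (if word c k = v k then (1 : ℝ) else 0) = _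
  simp only [h, Finset.sum_sub_distrib, Finset.sum_const,
    Finset.card_univ, Fintype.card_fin, nsmul_eq_mul, mul_one, Finset.sum_boole]
  rw [mul_sub, one_div_mul_cancel h2.ne']
  simp only [hammingDist]
  ring

end Code

end Model

end BayesADA

end

/-! ### The hard model and the true and posterior answers to probes -/

noncomputable section

namespace BayesADA

namespace Model

section Hard

variable {m : ℕ} [NeZero m] {C : Submodule (ZMod 2) (Fin m → ZMod 2)} {Q : ℕ}

variable (C Q) in
/-- One of the `m` independent factors of the hard model: a code and `Q` coins. -/
def cell : Model := (ofCode C).tensor (coin8.tensorPow Q)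

variable (C Q) in
/-- The hard model, with one query kept in reserve. -/
def hard : Model := (cell C Q).tensorPow m

theorem hardModel_eq : hardModel C (Q + 1) = hard C Q := rfl

/-- The codeword of the `i`-th factor. -/
def hypCode (θ : (hard C Q).Θ) (i : Fin m) : (ofCode C).Θ :=
  Prod.fst (α := (ofCode C).Θ) (β := (coin8.tensorPow Q).Θ) (θ i)

/-- The bias of the `t`-th coin of the `i`-th factor. -/
def hypCoin (θ : (hard C Q).Θ) (i : Fin m) (t : Fin Q) : coin8.Θ :=
  Prod.snd (α := (ofCode C).Θ) (β := (coin8.tensorPow Q).Θ) (θ i) t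

/-- The code part of the `i`-th factor of a sample. -/
def smpCode (x : (hard C Q).X) (i : Fin m) : (ofCode C).X :=
  Prod.fst (α := (ofCode C).X) (β := (coin8.tensorPow Q).X) (x i)

/-- The flips of the `t`-th coin of the `i`-th factor of a sample. -/
def smpCoin (x : (hard C Q).X) (i : Fin m) (t : Fin Q) : coin8.X :=
  Prod.snd (α := (ofCode C).X) (β := (coin8.tensorPow Q).X) (x i) t

theorem trueAnswer_tensorPow_apply (M : Model) {k : ℕ} (θ : (M.tensorPow k).Θ) (t : Fin k)
    (B : M.X → ℝ) :
    (M.tensorPow k).trueAnswer θ (fun x => B (x t)) = M.trueAnswer (θ t) B := by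
  have h := M.trueAnswer_tensorPow θ fun t' y => if t' = t then B y else 1
  have e : (fun x : (M.tensorPow k).X => ∏ i, if i = t then B (x i) else 1)
      = fun x => B (x t) := funext fun x => by simp
  rw [e] at h
  rw [h, Finset.prod_eq_single t]
  · simp
  · intro b _ hb
    simp only [if_neg hb]
    exact M.trueAnswer_const _ _
  · simp

theorem posteriorExp_tensorPow_apply (M : Model) {k n : ℕ} (x : Fin n → (M.tensorPow k).X)
    (hx : ∀ i, ∫ θ, M.likelihood (fun l => x l i) θ ∂M.prior ≠ 0) (t : Fin k) (B : M.Θ → ℝ) :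
    (M.tensorPow k).posteriorExp x (fun θ => B (θ t)) = M.posteriorExp (fun l => x l t) B := by
  have h := M.posteriorExp_tensorPow x fun t' y => if t' = t then B y else 1
  have e : (fun θ : (M.tensorPow k).Θ => ∏ i, if i = t then B (θ i) else 1)
      = fun θ => B (θ t) := funext fun x => by simp
  rw [e] at h
  rw [h, Finset.prod_eq_single t]
  · simp
  · intro b _ hb
    simp only [if_neg hb]
    exact M.posteriorExp_one (hx b)
  · simp

theorem posteriorExp_sum (M : Model) {n : ℕ} (x : Fin n → M.X) {ι : Type} (S : Finset ι)
    (a : ι → ℝ) (F : ι → M.Θ → ℝ) (hF : ∀ k, Measurable (F k)) (hb : ∀ k θ, |F k θ| ≤ 1) :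
    M.posteriorExp x (fun θ => ∑ k ∈ S, a k * F k θ) = ∑ k ∈ S, a k * M.posteriorExp x (F k) := by
  unfold posteriorExp
  simp only [Finset.mul_sum, ← mul_div_assoc]
  rw [integral_finsetSum, ← Finset.sum_div]
  · congr 1
    refine Finset.sum_congr rfl fun k _ => ?_
    rw [← integral_const_mul]
    simp only [mul_left_comm]
  · intro k _
    have := (M.integrable_likelihood_mul x (hF k) (hb k)).const_mul (a k)
    simpa only [mul_left_comm] using this

theorem trueAnswer_cell (θ : (cell C Q).Θ) (t : Fin Q) (A : (ofCode C).X → ℝ) (B : coin8.X → ℝ) :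
    (cell C Q).trueAnswer θ (fun x => A (Prod.fst (β := (coin8.tensorPow Q).X) x)
        * B (Prod.snd (α := (ofCode C).X) (β := (coin8.tensorPow Q).X) x t))
      = (ofCode C).trueAnswer (Prod.fst (β := (coin8.tensorPow Q).Θ) θ) A
        * coin8.trueAnswer (Prod.snd (α := (ofCode C).Θ) (β := (coin8.tensorPow Q).Θ) θ t) B := by
  refine (trueAnswer_tensor _ _ θ A fun y : (coin8.tensorPow Q).X => B (y t)).trans ?_
  rw [trueAnswer_tensorPow_apply]

theorem posteriorExp_cell {n : ℕ} (x : Fin n → (cell C Q).X) (t : Fin Q)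
    (A : (ofCode C).Θ → ℝ) (B : coin8.Θ → ℝ) :
    (cell C Q).posteriorExp x (fun θ => A (Prod.fst (β := (coin8.tensorPow Q).Θ) θ)
        * B (Prod.snd (α := (ofCode C).Θ) (β := (coin8.tensorPow Q).Θ) θ t))
      = (ofCode C).posteriorExp (fun l => Prod.fst (β := (coin8.tensorPow Q).X) (x l)) A
        * coin8.posteriorExp (fun l =>
          Prod.snd (α := (ofCode C).X) (β := (coin8.tensorPow Q).X) (x l) t) B := by
  refine (posteriorExp_tensor _ _ x A fun y : (coin8.tensorPow Q).Θ => B (y t)).trans ?_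
  rw [posteriorExp_tensorPow_apply]
  exact fun i => (integral_likelihood_coin8_pos _).ne'

/-- The answer to a product of a function of one code and functions of two coins. -/
theorem trueAnswer_hard_mul (θ : (hard C Q).Θ) (i : Fin m) {i₀ i₁ : Fin m} (h : i₀ ≠ i₁)
    (t : Fin Q) (A : (ofCode C).X → ℝ) (B B' : coin8.X → ℝ) :
    (hard C Q).trueAnswer θ
        (fun x => A (smpCode x i) * (B (smpCoin x i₀ t) * B' (smpCoin x i₁ t)))
      = (ofCode C).trueAnswer (hypCode θ i) A
        * (coin8.trueAnswer (hypCoin θ i₀ t) B * coin8.trueAnswer (hypCoin θ i₁ t) B') := by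
  have key := (cell C Q).trueAnswer_tensorPow θ fun l z =>
    (if l = i then A (Prod.fst (β := (coin8.tensorPow Q).X) z) else 1)
      * ((if l = i₀ then B (Prod.snd (α := (ofCode C).X) (β := (coin8.tensorPow Q).X) z t) else 1)
      * (if l = i₁ then B' (Prod.snd (α := (ofCode C).X) (β := (coin8.tensorPow Q).X) z t) else 1))
  refine (congrArg _ (funext fun x => ?_)).trans (key.trans ?_)
  · rw [Finset.prod_mul_distrib, Finset.prod_mul_distrib]
    simp only [Finset.prod_ite_eq', Finset.mem_univ, if_true]
    rfl
  · have hl : ∀ l, (cell C Q).trueAnswer (θ l) (fun z =>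
        (if l = i then A (Prod.fst (β := (coin8.tensorPow Q).X) z) else 1)
        * ((if l = i₀ then B (Prod.snd (α := (ofCode C).X) (β := (coin8.tensorPow Q).X) z t) else 1)
        * (if l = i₁ then B' (Prod.snd (α := (ofCode C).X) (β := (coin8.tensorPow Q).X) z t)
          else 1)))
        = (if l = i then (ofCode C).trueAnswer (hypCode θ l) A else 1)
          * ((if l = i₀ then coin8.trueAnswer (hypCoin θ l t) B else 1)
          * (if l = i₁ then coin8.trueAnswer (hypCoin θ l t) B' else 1)) := fun l => by
      refine (trueAnswer_cell (θ l) t (fun z => if l = i then A z else 1)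
        fun y => (if l = i₀ then B y else 1) * (if l = i₁ then B' y else 1)).trans ?_
      congr 1
      · split_ifs
        · rfl
        · exact trueAnswer_const _ _ _
      · by_cases h0 : l = i₀
        · have h1 : l ≠ i₁ := fun h1 => h (h0.symm.trans h1)
          simp only [if_pos h0, if_neg h1, mul_one]
          rfl
        · simp only [if_neg h0, one_mul]
          split_ifs
          · rfl
          · exact trueAnswer_const _ _ _
    simp only [hl]
    rw [Finset.prod_mul_distrib, Finset.prod_mul_distrib]
    simp only [Finset.prod_ite_eq', Finset.mem_univ, if_true]

/-- The samples have positive probability. -/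
def Possible {n : ℕ} (x : Fin n → (hard C Q).X) : Prop :=
  ∀ i, ∃ c, Consistent (fun l => smpCode (x l) i) c

theorem integral_likelihood_cell_pos {n : ℕ} (x : Fin n → (cell C Q).X) {c : (ofCode C).Θ}
    (hc : Consistent (fun l => Prod.fst (β := (coin8.tensorPow Q).X) (x l)) c) :
    0 < ∫ θ, (cell C Q).likelihood x θ ∂(cell C Q).prior := by
  have h1 : ∫ θ, (cell C Q).likelihood x θ ∂(cell C Q).prior
      = (∫ θ, (ofCode C).likelihood (fun l => Prod.fst (β := (coin8.tensorPow Q).X) (x l)) θ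
          ∂(ofCode C).prior)
        * ∫ θ, (coin8.tensorPow Q).likelihood (fun l =>
          Prod.snd (α := (ofCode C).X) (β := (coin8.tensorPow Q).X) (x l)) θ
          ∂(coin8.tensorPow Q).prior := by
    rw [← integral_prod_mul]
    exact integral_congr_ae (Filter.Eventually.of_forall fun θ => likelihood_tensor _ _ x θ)
  have h2 : ∫ θ, (coin8.tensorPow Q).likelihood (fun l =>
          Prod.snd (α := (ofCode C).X) (β := (coin8.tensorPow Q).X) (x l)) θ
          ∂(coin8.tensorPow Q).prior
      = ∏ t, ∫ θ, coin8.likelihood (fun l =>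
          Prod.snd (α := (ofCode C).X) (β := (coin8.tensorPow Q).X) (x l) t) θ ∂coin8.prior := by
    rw [← integral_fintype_prod_eq_prod]
    exact integral_congr_ae (Filter.Eventually.of_forall fun θ => likelihood_tensorPow _ _ θ)
  rw [h1, h2]
  exact mul_pos (integral_likelihood_ofCode_pos hc)
    (Finset.prod_pos fun t _ => integral_likelihood_coin8_pos _)

theorem integral_likelihood_hard_pos {n : ℕ} {x : Fin n → (hard C Q).X} (hx : Possible x) :
    0 < ∫ θ, (hard C Q).likelihood x θ ∂(hard C Q).prior := by
  have h2 : ∫ θ, (hard C Q).likelihood x θ ∂(hard C Q).prior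
      = ∏ i, ∫ θ, (cell C Q).likelihood (fun l => x l i) θ ∂(cell C Q).prior := by
    rw [← integral_fintype_prod_eq_prod]
    exact integral_congr_ae (Filter.Eventually.of_forall fun θ => likelihood_tensorPow _ _ θ)
  rw [h2]
  refine Finset.prod_pos fun i _ => ?_
  obtain ⟨c, hc⟩ := hx i
  exact integral_likelihood_cell_pos _ hc

/-- Only the two coins must lie in different factors. The code may share a factor with one of them,
because code and coins of a factor are independent. The unused factors contribute 1, for which their
normalisers must be nonzero. -/
theorem posteriorExp_hard_mul {n : ℕ} {x : Fin n → (hard C Q).X} (hx : Possible x)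
    (i : Fin m) {i₀ i₁ : Fin m} (h : i₀ ≠ i₁)
    (t : Fin Q) (A : (ofCode C).Θ → ℝ) (B B' : coin8.Θ → ℝ) :
    (hard C Q).posteriorExp x
        (fun θ => A (hypCode θ i) * (B (hypCoin θ i₀ t) * B' (hypCoin θ i₁ t)))
      = (ofCode C).posteriorExp (fun l => smpCode (x l) i) A
        * (coin8.posteriorExp (fun l => smpCoin (x l) i₀ t) B
          * coin8.posteriorExp (fun l => smpCoin (x l) i₁ t) B') := by
  have hone : ∀ l, (ofCode C).posteriorExp (fun k => smpCode (x k) l) (fun _ => 1) = 1 :=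
    fun l => by
      obtain ⟨c, hc⟩ := hx l
      exact posteriorExp_one _ (integral_likelihood_ofCode_pos hc).ne'
  have hone' : ∀ l, coin8.posteriorExp (fun k => smpCoin (x k) l t) (fun _ => 1) = 1 :=
    fun l => posteriorExp_one _ (integral_likelihood_coin8_pos _).ne'
  have key := (cell C Q).posteriorExp_tensorPow x fun l z =>
    (if l = i then A (Prod.fst (β := (coin8.tensorPow Q).Θ) z) else 1)
      * ((if l = i₀ then B (Prod.snd (α := (ofCode C).Θ) (β := (coin8.tensorPow Q).Θ) z t) else 1)
      * (if l = i₁ then B' (Prod.snd (α := (ofCode C).Θ) (β := (coin8.tensorPow Q).Θ) z t) else 1))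
  refine (congrArg _ (funext fun x => ?_)).trans (key.trans ?_)
  · rw [Finset.prod_mul_distrib, Finset.prod_mul_distrib]
    simp only [Finset.prod_ite_eq', Finset.mem_univ, if_true]
    rfl
  · have hl : ∀ l, (cell C Q).posteriorExp (fun k => x k l) (fun z =>
        (if l = i then A (Prod.fst (β := (coin8.tensorPow Q).Θ) z) else 1)
        * ((if l = i₀ then B (Prod.snd (α := (ofCode C).Θ) (β := (coin8.tensorPow Q).Θ) z t) else 1)
        * (if l = i₁ then B' (Prod.snd (α := (ofCode C).Θ) (β := (coin8.tensorPow Q).Θ) z t)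
          else 1)))
        = (if l = i then (ofCode C).posteriorExp (fun k => smpCode (x k) l) A else 1)
          * ((if l = i₀ then coin8.posteriorExp (fun k => smpCoin (x k) l t) B else 1)
          * (if l = i₁ then coin8.posteriorExp (fun k => smpCoin (x k) l t) B' else 1)) :=
      fun l => by
      refine (posteriorExp_cell (fun k => x k l) t (fun z => if l = i then A z else 1)
        fun y => (if l = i₀ then B y else 1) * (if l = i₁ then B' y else 1)).trans ?_
      congr 1
      · split_ifs
        · rfl
        · exact hone l
      · by_cases h0 : l = i₀
        · have h1 : l ≠ i₁ := fun h1 => h (h0.symm.trans h1)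
          simp only [if_pos h0, if_neg h1, mul_one]
          rfl
        · simp only [if_neg h0, one_mul]
          split_ifs
          · rfl
          · exact hone' l
    simp only [hl]
    rw [Finset.prod_mul_distrib, Finset.prod_mul_distrib]
    simp only [Finset.prod_ite_eq', Finset.mem_univ, if_true]

/-! ### The probing queries -/

/-- A flip of a single coin. -/
def coinVal (b : uniformCoin.X) : Fin 2 := b

/-- The first flip of a coin, as a number. -/
def flipVal (y : coin8.X) : ℝ := if flip y 0 = 1 then 1 else 0

theorem trueAnswer_flipVal (p : coin8.Θ) : coin8.trueAnswer p flipVal = bias p := by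
  have h := trueAnswer_tensorPow uniformCoin (k := 8) (fun _ => p)
    fun r (b : uniformCoin.X) => if r = 0 then (if coinVal b = 1 then (1 : ℝ) else 0) else 1
  have hX : ∀ x : coin8.X, flipVal x = ∏ r : Fin 8,
      (if r = 0 then (if flip x r = 1 then (1 : ℝ) else 0) else 1) := fun x => by
    rw [Finset.prod_ite_eq']
    simp [flipVal]
  have e : coin8.trueAnswer p flipVal = ∏ r : Fin 8, uniformCoin.trueAnswer p
      (fun b : uniformCoin.X =>
        if r = 0 then (if coinVal b = 1 then (1 : ℝ) else 0) else 1) := by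
    rw [← h]
    unfold trueAnswer
    refine Finset.sum_congr rfl fun x _ => ?_
    rw [hX]
    rfl
  rw [e, Finset.prod_eq_single 0]
  · change ∑ b : Fin 2, (if b = 1 then bias p else 1 - bias p) * _ = _
    simp [coinVal]
  · intro r _ hr
    simp only [if_neg hr]
    exact trueAnswer_const _ _ _
  · simp

/-- The probe of the symbol at position `j` of the `i`-th codeword, with the `t`-th coins of the
factors `i₀` and `i₁`. -/
def probe (γ : ℝ) (i₀ i₁ i j : Fin m) (s : ZMod 2) (t : Fin Q) (x : (hard C Q).X) : ℝ :=
  -- The sign given by the `i₁` coin makes the query odd about 1/2 under reversal of that coin. The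
  -- `i₀` coin spreads the posterior mean over a grid on which the contribution of the symbol is one
  -- step.
  1 / 2 + (flipVal (smpCoin x i₁ t) - 1 / 2) *
    (if pos (smpCode x i) = j then (if bit (smpCode x i) = s then γ else 0)
      else flipVal (smpCoin x i₀ t))

/-- The value of a probe, as a function of the answers to its parts. -/
def probeVal (m : ℕ) (γ p p' e : ℝ) : ℝ :=
  1 / 2 + (p' - 1 / 2) * ((1 - 1 / (m : ℝ)) * p + γ / m * e)

theorem flipVal_mem (y : coin8.X) : flipVal y = 0 ∨ flipVal y = 1 := by
  unfold flipVal
  split_ifs <;> simp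

theorem probe_mem {γ : ℝ} (h0 : 0 ≤ γ) (h1 : γ ≤ 1) (i₀ i₁ i j : Fin m) (s : ZMod 2) (t : Fin Q)
    (x : (hard C Q).X) : probe γ i₀ i₁ i j s t x ∈ Set.Icc (0 : ℝ) 1 := by
  unfold probe
  rcases flipVal_mem (smpCoin x i₁ t) with h | h <;>
    rcases flipVal_mem (smpCoin x i₀ t) with h' | h' <;> rw [h, h'] <;> split_ifs <;>
    constructor <;> linarith

theorem probe_eq (γ : ℝ) (i₀ i₁ i j : Fin m) (s : ZMod 2) (t : Fin Q) (x : (hard C Q).X) :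
    probe γ i₀ i₁ i j s t x = 1 / 2 +
      ((if pos (smpCode x i) = j then 0 else 1)
          * (flipVal (smpCoin x i₀ t) * (flipVal (smpCoin x i₁ t) + (-1 / 2)))
        + γ * ((if pos (smpCode x i) = j ∧ bit (smpCode x i) = s then 1 else 0)
          * (1 * (flipVal (smpCoin x i₁ t) + (-1 / 2))))) := by
  unfold probe
  by_cases h1 : pos (smpCode x i) = j <;> by_cases h2 : bit (smpCode x i) = s <;>
    simp only [h1, h2, if_true, if_false, and_true, and_false, and_self] <;> ring

theorem trueAnswer_probe (γ : ℝ) {i₀ i₁ : Fin m} (h : i₀ ≠ i₁) (i j : Fin m) (s : ZMod 2)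
    (t : Fin Q) (θ : (hard C Q).Θ) :
    (hard C Q).trueAnswer θ (probe γ i₀ i₁ i j s t)
      = probeVal m γ (bias (hypCoin θ i₀ t)) (bias (hypCoin θ i₁ t))
          (if word (hypCode θ i) j = s then 1 else 0) := by
  have e : (probe γ i₀ i₁ i j s t : (hard C Q).X → ℝ) = _ :=
    funext fun x => probe_eq γ i₀ i₁ i j s t x
  rw [e, trueAnswer_add, trueAnswer_const, trueAnswer_add, trueAnswer_const_mul,
    trueAnswer_hard_mul θ i h t (fun z => if pos z = j then 0 else 1) flipVal
      (fun y => flipVal y + (-1 / 2)),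
    trueAnswer_hard_mul θ i h t (fun z => if pos z = j ∧ bit z = s then 1 else 0) (fun _ => 1)
      (fun y => flipVal y + (-1 / 2)),
    trueAnswer_pos_ne, trueAnswer_symbol, trueAnswer_add, trueAnswer_const, trueAnswer_flipVal,
    trueAnswer_flipVal, trueAnswer_const]
  unfold probeVal
  ring

/-- The value of a probe is affine in each of the two biases and the symbol indicator separately,
and these three are independent under the posterior, so each may be replaced by its posterior mean.
-/
theorem posteriorMean_probe (γ : ℝ) {i₀ i₁ : Fin m} (h : i₀ ≠ i₁) (i j : Fin m) (s : ZMod 2)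
    (t : Fin Q) {n : ℕ} {x : Fin n → (hard C Q).X} (hx : Possible x) :
    (hard C Q).posteriorMean x (probe γ i₀ i₁ i j s t)
      = probeVal m γ ((heads (fun l => smpCoin (x l) i₀ t) + 1 : ℝ) / (8 * n + 2))
          ((heads (fun l => smpCoin (x l) i₁ t) + 1 : ℝ) / (8 * n + 2))
          (symbolProb (fun l => smpCode (x l) i) j s) := by
  have hb : ∀ p, |bias p| ≤ 1 := fun p => abs_le.2 ⟨by linarith [bias_nonneg p], bias_le_one p⟩
  have hmi : Measurable fun θ : (hard C Q).Θ => hypCode θ i :=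
    measurable_fst.comp (measurable_pi_apply i)
  have hmc : ∀ k, Measurable fun θ : (hard C Q).Θ => bias (hypCoin θ k t) := fun k =>
    measurable_bias.comp ((measurable_pi_apply t).comp
      (measurable_snd.comp (measurable_pi_apply k)))
  -- The value is expanded into five monomials, padded with ones to the shape that
  -- `posteriorExp_hard_mul` treats.
  have e : (fun θ => (hard C Q).trueAnswer θ (probe γ i₀ i₁ i j s t)) = fun θ =>
      (1 / 2 : ℝ) * 1 + (1 - 1 / (m : ℝ)) * (1 * (bias (hypCoin θ i₀ t) * bias (hypCoin θ i₁ t)))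
        + (-(1 - 1 / (m : ℝ)) / 2) * (1 * (bias (hypCoin θ i₀ t) * 1))
        + (γ / m) * ((if word (hypCode θ i) j = s then 1 else 0)
            * (1 * bias (hypCoin θ i₁ t)))
        + (-(γ / m) / 2) * ((if word (hypCode θ i) j = s then 1 else 0) * (1 * 1)) := by
    funext θ
    rw [trueAnswer_probe γ h]
    unfold probeVal
    ring
  have hite : Measurable fun θ : (hard C Q).Θ =>
      if word (hypCode θ i) j = s then (1 : ℝ) else 0 :=
    (Measurable.of_discrete (f := fun c : (ofCode C).Θ =>
      if word c j = s then (1 : ℝ) else 0)).comp hmi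
  have hpos := integral_likelihood_hard_pos hx
  have hA : ∀ (θ : (hard C Q).Θ), |(if word (hypCode θ i) j = s then (1 : ℝ) else 0)| ≤ 1 :=
    fun θ => by split_ifs <;> simp
  have m1 : Measurable fun θ : (hard C Q).Θ =>
      1 * (bias (hypCoin θ i₀ t) * bias (hypCoin θ i₁ t)) :=
    ((hmc i₀).mul (hmc i₁)).const_mul 1
  have m2 : Measurable fun θ : (hard C Q).Θ => 1 * (bias (hypCoin θ i₀ t) * 1) :=
    ((hmc i₀).mul_const 1).const_mul 1
  have m3 : Measurable fun θ : (hard C Q).Θ =>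
      (if word (hypCode θ i) j = s then (1 : ℝ) else 0) * (1 * bias (hypCoin θ i₁ t)) :=
    hite.mul ((hmc i₁).const_mul 1)
  have m4 : Measurable fun θ : (hard C Q).Θ =>
      (if word (hypCode θ i) j = s then (1 : ℝ) else 0) * (1 * 1) :=
    hite.mul_const (1 * 1)
  have p1 := posteriorExp_hard_mul hx i h t (fun _ => 1) bias bias
  have p2 := posteriorExp_hard_mul hx i h t (fun _ => 1) bias (fun _ => 1)
  have p3 := posteriorExp_hard_mul hx i h t (fun c => if word c j = s then 1 else 0)
    (fun _ => 1) bias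
  have p4 := posteriorExp_hard_mul hx i h t (fun c => if word c j = s then 1 else 0)
    (fun _ => 1) (fun _ => 1)
  have q0 : ∀ k, coin8.posteriorExp (fun l => smpCoin (x l) k t) (fun _ => 1) = 1 :=
    fun k => posteriorExp_one _ (integral_likelihood_coin8_pos _).ne'
  have q1 : (ofCode C).posteriorExp (fun l => smpCode (x l) i) (fun _ => 1) = 1 := by
    obtain ⟨c, hc⟩ := hx i
    exact posteriorExp_one _ (integral_likelihood_ofCode_pos hc).ne'
  have lin := (hard C Q).posteriorExp_sum x Finset.univ
    ![1 / 2, 1 - 1 / (m : ℝ), -(1 - 1 / (m : ℝ)) / 2, γ / m, -(γ / m) / 2]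
    ![fun _ => (1 : ℝ), fun θ => 1 * (bias (hypCoin θ i₀ t) * bias (hypCoin θ i₁ t)),
      fun θ => 1 * (bias (hypCoin θ i₀ t) * 1),
      fun θ => (if word (hypCode θ i) j = s then (1 : ℝ) else 0) * (1 * bias (hypCoin θ i₁ t)),
      fun θ => (if word (hypCode θ i) j = s then (1 : ℝ) else 0) * (1 * 1)]
    (fun k => by
      fin_cases k
      exacts [measurable_const, m1, m2, m3, m4])
    (fun k θ => by
      fin_cases k <;> simp only [Fin.zero_eta, Fin.mk_one, Fin.reduceFinMk, Matrix.cons_val,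
        abs_mul, abs_one, one_mul, mul_one]
      exacts [le_rfl, mul_le_one₀ (hb _) (abs_nonneg _) (hb _), hb _,
        mul_le_one₀ (hA θ) (abs_nonneg _) (hb _), hA θ])
  simp only [Fin.sum_univ_five, Matrix.cons_val] at lin
  rw [posteriorMean_eq, e]
  refine lin.trans ?_
  rw [posteriorExp_one _ hpos.ne', p1, p2, p3, p4, q0, q0, q1, posteriorExp_coin8,
    posteriorExp_coin8]
  unfold probeVal symbolProb
  ring

end Hard

end Model

end BayesADA

end

noncomputable section

namespace BayesADA

/-! ### Rearrangements of product measures -/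

theorem measurePreserving_pair {ι α : Type*} [Fintype ι] [MeasurableSpace α] (μ : Measure α)
    [IsProbabilityMeasure μ] {i j : ι} (h : i ≠ j) :
    MeasurePreserving (fun w : ι → α => (w i, w j)) (Measure.pi fun _ => μ) (μ.prod μ) := by
  have hi := iIndepFun_pi (μ := fun _ : ι => μ) (X := fun (_ : ι) (a : α) => a)
    fun _ => aemeasurable_id
  have h2 := (indepFun_iff_map_prod_eq_prod_map_map (measurable_pi_apply i).aemeasurable
    (measurable_pi_apply j).aemeasurable).1 (hi.indepFun h)
  refine ⟨(measurable_pi_apply i).prodMk (measurable_pi_apply j), h2.trans ?_⟩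
  congr 1
  · exact (measurePreserving_eval (fun _ : ι => μ) i).map_eq
  · exact (measurePreserving_eval (fun _ : ι => μ) j).map_eq

theorem measurePreserving_init {α : Type*} [MeasurableSpace α] (μ : Measure α)
    [IsProbabilityMeasure μ] (Q : ℕ) :
    MeasurePreserving (fun u : Fin (Q + 1) → α => (Fin.init u : Fin Q → α))
      (Measure.pi fun _ => μ) (Measure.pi fun _ => μ) := by
  have h := measurePreserving_snd.comp
    (measurePreserving_piFinSuccAbove (fun _ : Fin (Q + 1) => μ) (Fin.last Q))
  refine (congrArg (fun f => MeasurePreserving f _ _) (funext fun u => ?_)).mp h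
  funext t
  simp [Fin.init, MeasurableEquiv.piFinSuccAbove]

namespace Model

variable {m : ℕ} [NeZero m] {C : Submodule (ZMod 2) (Fin m → ZMod 2)} {Q n : ℕ}

variable (C n) in
/-- The data of a code: the codeword and its samples. -/
abbrev CodeData : Type := (ofCode C).Θ × (Fin n → (ofCode C).X)

variable (n) in
/-- The data of a coin: the bias and the flips. -/
abbrev CoinData : Type := coin8.Θ × (Fin n → coin8.X)

/-- The code part of the data. -/
def codeData (p : (hard C Q).Θ × (Fin n → (hard C Q).X)) (i : Fin m) : CodeData C n :=
  (hypCode p.1 i, fun l => smpCode (p.2 l) i)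

/-- The data of a coin. -/
def coinData (p : (hard C Q).Θ × (Fin n → (hard C Q).X)) (i : Fin m) (t : Fin Q) : CoinData n :=
  (hypCoin p.1 i t, fun l => smpCoin (p.2 l) i t)

theorem measurePreserving_cellSplit :
    MeasurePreserving (fun p : (cell C Q).Θ × (Fin n → (cell C Q).X) =>
        Prod.map id ((coin8).tensorPowSplit Q n)
          ((ofCode C).tensorSplit (coin8.tensorPow Q) n p))
      ((cell C Q).dataLaw n)
      (((ofCode C).dataLaw n).prod (Measure.pi fun _ => coin8.dataLaw n)) :=
  ((MeasurePreserving.id _).prod (coin8.measurePreserving_tensorPowSplit Q n)).comp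
    ((ofCode C).measurePreserving_tensorSplit (coin8.tensorPow Q) n)

/-- The strategy uses only the coins of the factors `i₀` and `i₁`. All others are projected away,
and the remaining ones are regrouped by rounds, with fresh coins in every round. -/
theorem measurePreserving_hardSplit {i₀ i₁ : Fin m} (h : i₀ ≠ i₁) :
    MeasurePreserving (fun p : (hard C Q).Θ × (Fin n → (hard C Q).X) =>
        ((codeData p, fun t => (coinData p i₀ t, coinData p i₁ t)) :
          (Fin m → CodeData C n) × (Fin Q → CoinData n × CoinData n)))
      ((hard C Q).dataLaw n)
      ((Measure.pi fun _ => (ofCode C).dataLaw n).prod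
        (Measure.pi fun _ => (coin8.dataLaw n).prod (coin8.dataLaw n))) := by
  have h1 := (cell C Q).measurePreserving_tensorPowSplit m n
  have h2 := measurePreserving_pi (fun _ : Fin m => (cell C Q).dataLaw n)
    (fun _ : Fin m => ((ofCode C).dataLaw n).prod
      (Measure.pi fun _ : Fin Q => coin8.dataLaw n)) fun _ => measurePreserving_cellSplit
  have h3 := measurePreserving_arrowProdEquivProdArrow (CodeData C n) (Fin Q → CoinData n) (Fin m)
    (fun _ => (ofCode C).dataLaw n) (fun _ => Measure.pi fun _ : Fin Q => coin8.dataLaw n)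
  have h4 := (MeasurePreserving.id (Measure.pi fun _ : Fin m => (ofCode C).dataLaw n)).prod
    (measurePreserving_pair (Measure.pi fun _ : Fin Q => coin8.dataLaw n) h)
  have h5 := (MeasurePreserving.id (Measure.pi fun _ : Fin m => (ofCode C).dataLaw n)).prod
    (measurePreserving_arrowProdEquivProdArrow (CoinData n) (CoinData n) (Fin Q)
      (fun _ => coin8.dataLaw n) (fun _ => coin8.dataLaw n)).symm
  exact h5.comp (h4.comp (h3.comp (h2.comp h1)))

/-- The data and the seeds of the first `Q` rounds consist of independent parts: the code part,
and for every round its two coins with the seed. -/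
theorem measurePreserving_rounds {S : Type*} [MeasurableSpace S] (μ : Measure S)
    [IsProbabilityMeasure μ] {i₀ i₁ : Fin m} (h : i₀ ≠ i₁) :
    MeasurePreserving
      (fun p : ((hard C Q).Θ × (Fin n → (hard C Q).X)) × (Fin (Q + 1) → S) =>
        ((codeData p.1, fun t => ((coinData p.1 i₀ t, coinData p.1 i₁ t), Fin.init p.2 t)) :
          (Fin m → CodeData C n) × (Fin Q → (CoinData n × CoinData n) × S)))
      (((hard C Q).dataLaw n).prod (Measure.pi fun _ => μ))
      ((Measure.pi fun _ => (ofCode C).dataLaw n).prod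
        (Measure.pi fun _ => ((coin8.dataLaw n).prod (coin8.dataLaw n)).prod μ)) := by
  have h1 := (measurePreserving_hardSplit (C := C) (Q := Q) (n := n) h).prod
    (measurePreserving_init μ Q)
  have h2 := measurePreserving_prodAssoc (Measure.pi fun _ : Fin m => (ofCode C).dataLaw n)
    (Measure.pi fun _ : Fin Q => (coin8.dataLaw n).prod (coin8.dataLaw n))
    (Measure.pi fun _ : Fin Q => μ)
  have h3 := (MeasurePreserving.id (Measure.pi fun _ : Fin m => (ofCode C).dataLaw n)).prod
    (measurePreserving_arrowProdEquivProdArrow (CoinData n × CoinData n) S (Fin Q)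
      (fun _ => (coin8.dataLaw n).prod (coin8.dataLaw n)) (fun _ => μ)).symm
  exact h3.comp (h2.comp h1)

/-! ### The prior law of a probe -/

theorem measurePreserving_hyp (i : Fin m) {i₀ i₁ : Fin m} (h : i₀ ≠ i₁) (t : Fin Q) :
    MeasurePreserving (fun θ : (hard C Q).Θ => (hypCode θ i, (hypCoin θ i₀ t, hypCoin θ i₁ t)))
      (hard C Q).prior ((ofCode C).prior.prod (coin8.prior.prod coin8.prior)) := by
  have h3 := measurePreserving_arrowProdEquivProdArrow (ofCode C).Θ (Fin Q → coin8.Θ) (Fin m)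
    (fun _ => (ofCode C).prior) (fun _ => Measure.pi fun _ : Fin Q => coin8.prior)
  have h4 := (measurePreserving_eval (fun _ : Fin m => (ofCode C).prior) i).prod
    (measurePreserving_pair (Measure.pi fun _ : Fin Q => coin8.prior) h)
  have h5 := (MeasurePreserving.id (ofCode C).prior).prod
    ((measurePreserving_eval (fun _ : Fin Q => coin8.prior) t).prod
      (measurePreserving_eval (fun _ : Fin Q => coin8.prior) t))
  exact h5.comp (h4.comp h3)

variable (C) in
/-- The positions at which not all codewords vanish. -/
def Live (j : Fin m) : Prop := ∃ c ∈ C, c j ≠ 0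

/-- Translation by a codeword that is nonzero at a live position flips the symbol there, so this
symbol is a fair bit. At a position that is not live it is constantly zero and the law would differ,
which is why only live positions are probed. -/
theorem map_symbol_eq {j j' : Fin m} (hj : Live C j) (hj' : Live C j') (s s' : ZMod 2) :
    (ofCode C).prior.map (fun c => if word c j = s then (1 : ℝ) else 0)
      = (ofCode C).prior.map (fun c => if word c j' = s' then (1 : ℝ) else 0) := by
  have half : ∀ {j : Fin m} (_ : Live C j) (s : ZMod 2),
      (ofCode C).prior.real {c | word c j = s} = 1 / 2 := by
    intro j hj s
    obtain ⟨w, hw, hwj⟩ := hj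
    have hwj1 : w j = 1 := by
      generalize w j = a at *
      revert a
      decide
    have h1 : (ofCode C).prior.real {c | word c j = s}ᶜ
        = (ofCode C).prior.real {c | word c j = s} := by
      rw [Measure.real, Measure.real,
        ← (measurePreserving_translate w hw).measure_preimage
          (MeasurableSet.of_discrete (s := {c : (ofCode C).Θ | word c j = s})).nullMeasurableSet]
      congr 2
      ext c
      simp only [Set.mem_compl_iff, Set.mem_ofPred_eq, Set.mem_preimage, word_translate,
        Pi.add_apply, hwj1]
      have : ∀ a b : ZMod 2, (a + 1 = b) ↔ ¬ a = b := by decide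
      exact (this _ _).symm
    rw [probReal_compl_eq_one_sub MeasurableSet.of_discrete] at h1
    linarith
  have key : ∀ {j : Fin m} (_ : Live C j) (s : ZMod 2),
      (ofCode C).prior.map (fun c => if word c j = s then (1 : ℝ) else 0)
        = (ENNReal.ofReal (1 / 2)) • (Measure.dirac 1 + Measure.dirac 0) := by
    intro j hj s
    refine Measure.ext fun T hT => ?_
    rw [Measure.map_apply Measurable.of_discrete hT]
    have hd : (fun c : (ofCode C).Θ => if word c j = s then (1 : ℝ) else 0) ⁻¹' T
        = ({c | word c j = s} ∩ {_c | (1 : ℝ) ∈ T}) ∪ ({c | word c j = s}ᶜ ∩ {_c | (0 : ℝ) ∈ T}) := by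
      ext c
      by_cases hc : word c j = s <;> simp [hc]
    have e1 : (ofCode C).prior {c | word c j = s} = ENNReal.ofReal (1 / 2) := by
      rw [← half hj s, ofReal_measureReal]
    have e2 : (ofCode C).prior {c | word c j = s}ᶜ = ENNReal.ofReal (1 / 2) := by
      rw [← ofReal_measureReal, probReal_compl_eq_one_sub MeasurableSet.of_discrete, half hj s]
      norm_num
    rw [hd, measure_union _ MeasurableSet.of_discrete]
    · by_cases h1 : (1 : ℝ) ∈ T <;> by_cases h0 : (0 : ℝ) ∈ T <;>
        simp [h1, h0, hT, e1, e2, ← two_mul]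
    · exact (disjoint_compl_right).mono Set.inter_subset_left Set.inter_subset_left
  rw [key hj, key hj']

/-- All probes of live positions have the same prior law. -/
theorem priorLaw_probe_eq (γ : ℝ) {i₀ i₁ : Fin m} (h : i₀ ≠ i₁) (i i' : Fin m) {j j' : Fin m}
    (hj : Live C j) (hj' : Live C j') (s s' : ZMod 2) (t t' : Fin Q) :
    (hard C Q).priorLaw (probe γ i₀ i₁ i j s t)
      = (hard C Q).priorLaw (probe γ i₀ i₁ i' j' s' t') := by
  have hm : Measurable fun z : ℝ × (coin8.Θ × coin8.Θ) =>
      probeVal m γ (bias z.2.1) (bias z.2.2) z.1 := by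
    have h1 : Measurable fun z : ℝ × (coin8.Θ × coin8.Θ) => bias z.2.1 :=
      measurable_bias.comp (measurable_fst.comp measurable_snd)
    have h2 : Measurable fun z : ℝ × (coin8.Θ × coin8.Θ) => bias z.2.2 :=
      measurable_bias.comp (measurable_snd.comp measurable_snd)
    exact (((h2.sub_const _).mul ((h1.const_mul _).add (measurable_fst.const_mul _))).const_add _)
  have key : ∀ (i j : Fin m) (s : ZMod 2) (t : Fin Q),
      (hard C Q).priorLaw (probe γ i₀ i₁ i j s t)
        = (((ofCode C).prior.map (fun c => if word c j = s then (1 : ℝ) else 0)).prod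
          (coin8.prior.prod coin8.prior)).map
            fun z => probeVal m γ (bias z.2.1) (bias z.2.2) z.1 := by
    intro i j s t
    have hs : Measurable (fun c : (ofCode C).Θ => if word c j = s then (1 : ℝ) else 0) :=
      Measurable.of_discrete
    have h1 := (hs.measurePreserving (ofCode C).prior).prod
      (MeasurePreserving.id (coin8.prior.prod coin8.prior))
    have h2 := h1.comp (measurePreserving_hyp (C := C) i h t)
    rw [← h2.map_eq, Measure.map_map hm h2.measurable]
    refine congrArg (fun f => Measure.map f _) (funext fun θ => ?_)
    exact trueAnswer_probe γ h i j s t θ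
  rw [key, key, map_symbol_eq hj hj' s s']

end Model

end BayesADA

end

noncomputable section

namespace BayesADA

/-! ### The proxy distribution -/

theorem proxy_nonneg_and_sum (M : Model) (η : ℝ) (h : Transcript M.X) :
    (∀ x, 0 ≤ proxy M η h x) ∧ ∑ x, proxy M η h x = 1 := by
  induction h with
  | nil => exact ⟨M.priorMean_nonneg, M.sum_priorMean⟩
  | cons e h ih =>
    have hw : ∀ x, 0 ≤ proxy M η h x * Real.exp
        (η * Real.sign (e.2 - ∑ z, proxy M η h z * e.1 z) * e.1 x) :=
      fun x => mul_nonneg (ih.1 x) (Real.exp_pos _).le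
    have hpos : 0 < ∑ x, proxy M η h x * Real.exp
        (η * Real.sign (e.2 - ∑ z, proxy M η h z * e.1 z) * e.1 x) := by
      obtain ⟨x, -, hx⟩ := Finset.exists_ne_zero_of_sum_ne_zero (ih.2.trans_ne one_ne_zero)
      refine Finset.sum_pos' (fun x _ => hw x) ⟨x, Finset.mem_univ _, ?_⟩
      exact mul_pos (lt_of_le_of_ne (ih.1 x) hx.symm) (Real.exp_pos _)
    constructor
    · exact fun x => div_nonneg (hw x) hpos.le
    · change ∑ x, _ / _ = (1 : ℝ)
      rw [← Finset.sum_div, div_self hpos.ne']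

/-- A symmetry of the prior mean and of all past queries is a symmetry of the proxy. -/
theorem proxy_comp_of_invariant (M : Model) (η : ℝ) (σ : M.X → M.X)
    (hσ : ∀ x, M.priorMean (σ x) = M.priorMean x) (h : Transcript M.X)
    (hh : ∀ e ∈ h, ∀ x, e.1 (σ x) = e.1 x) (x : M.X) :
    proxy M η h (σ x) = proxy M η h x := by
  induction h with
  | nil => exact hσ x
  | cons e h ih =>
    simp only [proxy, mwUpdate]
    rw [ih fun e' he' => hh e' (List.mem_cons_of_mem _ he'), hh e List.mem_cons_self]

theorem measurable_proxy_cons (M : Model) (η : ℝ) {Ω : Type*} [MeasurableSpace Ω]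
    (q : M.X → ℝ) {h : Ω → Transcript M.X} {a : Ω → ℝ} (ha : Measurable a)
    (hh : ∀ x, Measurable fun ω => proxy M η (h ω) x) (x : M.X) :
    Measurable fun ω => proxy M η ((q, a ω) :: h ω) x := by
  have hsign : Measurable Real.sign := by
    refine Measurable.ite (measurableSet_lt measurable_id measurable_const) measurable_const ?_
    exact Measurable.ite (measurableSet_lt measurable_const measurable_id) measurable_const
      measurable_const
  have hsg : Measurable fun ω => Real.sign (a ω - ∑ z, proxy M η (h ω) z * q z) :=
    hsign.comp (ha.sub (Finset.measurable_sum _ fun z _ => (hh z).mul_const _))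
  have hw : ∀ y, Measurable fun ω => proxy M η (h ω) y * Real.exp
      (η * Real.sign (a ω - ∑ z, proxy M η (h ω) z * q z) * q y) := fun y =>
    (hh y).mul (Real.measurable_exp.comp ((hsg.const_mul _).mul_const _))
  exact (hw x).div (Finset.measurable_sum _ fun y _ => hw y)

namespace Model

variable {m : ℕ} [NeZero m] {C : Submodule (ZMod 2) (Fin m → ZMod 2)} {Q : ℕ}

/-- All flips reversed. -/
def reverse (y : coin8.X) : coin8.X := fun r => 1 - flip y r

/-- All flips of the `t`-th coin of the factor `i₁` reversed. -/
def toggle (i₁ : Fin m) (t : Fin Q) (x : (hard C Q).X) : (hard C Q).X := fun l =>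
  ((smpCode x l, fun t' => if l = i₁ ∧ t' = t then reverse (smpCoin x l t')
    else smpCoin x l t') : (ofCode C).X × (Fin Q → coin8.X))

theorem smpCode_toggle (i₁ : Fin m) (t : Fin Q) (x : (hard C Q).X) (l : Fin m) :
    smpCode (toggle i₁ t x) l = smpCode x l := rfl

theorem smpCoin_toggle_self (i₁ : Fin m) (t : Fin Q) (x : (hard C Q).X) :
    smpCoin (toggle i₁ t x) i₁ t = reverse (smpCoin x i₁ t) :=
  if_pos ⟨rfl, rfl⟩

theorem smpCoin_toggle_of_ne (i₁ : Fin m) (t : Fin Q) (x : (hard C Q).X) {l : Fin m} {t' : Fin Q}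
    (h : ¬ (l = i₁ ∧ t' = t)) : smpCoin (toggle i₁ t x) l t' = smpCoin x l t' :=
  if_neg h

theorem priorMean_hard (x : (hard C Q).X) : (hard C Q).priorMean x
    = ∏ l, ((ofCode C).priorMean (smpCode x l) * ∏ t, coin8.priorMean (smpCoin x l t)) := by
  refine (priorMean_tensorPow _ x).trans (Finset.prod_congr rfl fun l _ => ?_)
  refine (priorMean_tensor _ _ (x l)).trans ?_
  congr 1
  exact priorMean_tensorPow _ _

theorem priorMean_toggle (i₁ : Fin m) (t : Fin Q) (x : (hard C Q).X) :
    (hard C Q).priorMean (toggle i₁ t x) = (hard C Q).priorMean x := by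
  rw [priorMean_hard, priorMean_hard]
  refine Finset.prod_congr rfl fun l _ => ?_
  rw [smpCode_toggle]
  congr 1
  refine Finset.prod_congr rfl fun t' _ => ?_
  by_cases h : l = i₁ ∧ t' = t
  · rw [h.1, h.2, smpCoin_toggle_self]
    exact priorMean_coin8_flip _
  · rw [smpCoin_toggle_of_ne i₁ t x h]

theorem toggle_involutive (i₁ : Fin m) (t : Fin Q) :
    Function.Involutive (toggle (C := C) i₁ t) := fun x => by
  funext l
  refine Prod.ext (smpCode_toggle _ _ _ _) (funext fun t' => ?_)
  change smpCoin (toggle i₁ t (toggle i₁ t x)) l t' = smpCoin x l t'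
  by_cases h : l = i₁ ∧ t' = t
  · rw [h.1, h.2, smpCoin_toggle_self, smpCoin_toggle_self]
    funext r
    change 1 - (1 - flip (smpCoin x i₁ t) r) = flip (smpCoin x i₁ t) r
    omega
  · rw [smpCoin_toggle_of_ne i₁ t _ h, smpCoin_toggle_of_ne i₁ t _ h]

theorem probe_toggle_of_ne (γ : ℝ) (i₀ i₁ i j : Fin m) (s : ZMod 2) {t t' : Fin Q} (h : t' ≠ t)
    (x : (hard C Q).X) : probe γ i₀ i₁ i j s t' (toggle i₁ t x) = probe γ i₀ i₁ i j s t' x := by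
  unfold probe
  rw [smpCoin_toggle_of_ne i₁ t x fun h' => h h'.2, smpCoin_toggle_of_ne i₁ t x fun h' => h h'.2,
    smpCode_toggle]

theorem flipVal_reverse (y : coin8.X) :
    flipVal (reverse y) = 1 - flipVal y := by
  have h : flip (reverse y) 0 = 1 - flip y 0 := rfl
  unfold flipVal
  rw [h]
  generalize flip y 0 = b
  have : b = 0 ∨ b = 1 := by omega
  rcases this with rfl | rfl <;> simp

theorem probe_toggle_self (γ : ℝ) {i₀ i₁ : Fin m} (h : i₀ ≠ i₁) (i j : Fin m) (s : ZMod 2)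
    (t : Fin Q) (x : (hard C Q).X) :
    probe γ i₀ i₁ i j s t (toggle i₁ t x) = 1 - probe γ i₀ i₁ i j s t x := by
  unfold probe
  rw [smpCoin_toggle_of_ne i₁ t x fun h' => h h'.1, smpCoin_toggle_self, smpCode_toggle,
    flipVal_reverse]
  ring

/-- The proxy of private multiplicative weights does not see the probes. -/
theorem proxyAnswer_probe (η γ : ℝ) {i₀ i₁ : Fin m} (h : i₀ ≠ i₁) (i j : Fin m) (s : ZMod 2)
    (t : Fin Q) (T : Transcript (hard C Q).X)
    (hT : ∀ e ∈ T, ∃ i j s, ∃ t' ≠ t, e.1 = probe γ i₀ i₁ i j s t') :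
    proxyAnswer (hard C Q) η T (probe γ i₀ i₁ i j s t) = 1 / 2 := by
  -- All earlier probes use coins other than the `t`-th, so the reversal of this coin fixes them
  -- and, with them, the proxy.
  have hinv := proxy_comp_of_invariant (hard C Q) η (toggle i₁ t) (priorMean_toggle i₁ t) T
    fun e he x => by
      obtain ⟨i, j, s, t', ht', h'⟩ := hT e he
      rw [h', probe_toggle_of_ne _ _ _ _ _ _ ht']
  -- Reindexing by the reversal shows that the proxy gives the probe and its complement the same
  -- mean. The two means sum to one.
  have hsum : ∑ x, proxy (hard C Q) η T x * probe γ i₀ i₁ i j s t x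
      = ∑ x, proxy (hard C Q) η T x * (1 - probe γ i₀ i₁ i j s t x) := by
    rw [← Equiv.sum_comp (toggle_involutive i₁ t).toPerm]
    refine Finset.sum_congr rfl fun x _ => ?_
    change proxy (hard C Q) η T (toggle i₁ t x) * probe γ i₀ i₁ i j s t (toggle i₁ t x) = _
    rw [hinv, probe_toggle_self γ h]
  simp only [mul_sub, mul_one, Finset.sum_sub_distrib, (proxy_nonneg_and_sum _ η T).2] at hsum
  unfold proxyAnswer
  linarith

end Model

end BayesADA

end

noncomputable section

namespace BayesADA

/-! ### Strategies with one adaptive query -/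

/-- The answer is far from one half. -/
def isFar (a : ℝ) : Bool := decide (1 / 8 < |a - 1 / 2|)

theorem measurable_isFar : Measurable isFar := by
  refine measurable_to_bool ?_
  have : isFar ⁻¹' {true} = {a | 1 / 8 < |a - 1 / 2|} := by
    ext a
    simp [isFar]
  rw [this]
  exact measurableSet_lt measurable_const (measurable_norm.comp (measurable_id.sub_const _))

variable {Q : ℕ}

/-- Ask the queries `P` and then a query that depends on which answers were far from one half. -/
def probingAnalyst {X : Type} (P : Fin Q → X → ℝ) (F : (Fin Q → Bool) → X → ℝ)
    (hP : ∀ t x, P t x ∈ Set.Icc (0 : ℝ) 1) (hF : ∀ β x, F β x ∈ Set.Icc (0 : ℝ) 1) :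
    Analyst X where
  query l := if h : l.length < Q then P ⟨l.length, h⟩
    -- Answers are listed latest first, so probe `t` sits at index `Q - 1 - t`. In round `Q` the
    -- list has length `Q` and the default 0 is never read.
    else F fun t => isFar (l.getD (Q - 1 - t) 0)
  query_mem l x := by
    split_ifs
    exacts [hP _ x, hF _ x]
  measurable_query k := by
    by_cases h : k < Q
    · simp only [List.length_ofFn, h, dif_pos]
      exact (measurable_const : Measurable fun _ : Fin k → ℝ => P ⟨k, h⟩)
    · simp only [List.length_ofFn, h, dif_neg, not_false_eq_true]
      have h1 : Measurable fun (a : Fin k → ℝ) (t : Fin Q) =>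
          isFar ((List.ofFn a).getD (Q - 1 - t) 0) := by
        refine measurable_pi_lambda _ fun t => measurable_isFar.comp ?_
        simp only [List.getD_eq_getElem?_getD, List.getElem?_ofFn]
        by_cases h2 : Q - 1 - (t : ℕ) < k
        · simp only [h2, dif_pos, Option.getD_some]
          exact measurable_pi_apply _
        · simp only [h2, dif_neg, not_false_eq_true, Option.getD_none]
          exact measurable_const
      exact (Measurable.of_discrete (f := F)).comp h1

/-- Against this strategy, the curator answers the first `Q` queries by a function `r` of the
posterior mean and of the seed. -/
structure Curator.Responds {M : Model} {n : ℕ} (K : Curator M n) (A : Analyst M.X)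
    (P : Fin Q → M.X → ℝ) (r : ℝ → K.Seed → ℝ) : Prop where
  measurable_response : ∀ a, Measurable (r a)
  answer_eq : ∀ x (t : Fin Q) (u : Fin t → K.Seed) v,
    K.answer x (play A K x t u) (P t) v = r (M.posteriorMean x (P t)) v

section Play

variable {M : Model} {n : ℕ} {K : Curator M n} {P : Fin Q → M.X → ℝ}
  {F : (Fin Q → Bool) → M.X → ℝ} {hP : ∀ t x, P t x ∈ Set.Icc (0 : ℝ) 1}
  {hF : ∀ β x, F β x ∈ Set.Icc (0 : ℝ) 1}

theorem length_play (A : Analyst M.X) (x : Fin n → M.X) (k : ℕ) (u : Fin k → K.Seed) :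
    (play A K x k u).length = k := by
  induction k with
  | zero => rfl
  | succ k ih => simp only [play, List.length_cons, ih]

theorem probingAnalyst_query_play (x : Fin n → M.X) (k : ℕ) (hk : k < Q) (u : Fin k → K.Seed) :
    (probingAnalyst P F hP hF).query
      ((play (probingAnalyst P F hP hF) K x k u).map Prod.snd) = P ⟨k, hk⟩ := by
  have h : ((play (probingAnalyst P F hP hF) K x k u).map Prod.snd).length = k := by
    rw [List.length_map, length_play]
  generalize (play (probingAnalyst P F hP hF) K x k u).map Prod.snd = l at h
  subst h
  exact dif_pos hk

theorem play_succ (x : Fin n → M.X) (k : ℕ) (hk : k < Q) (u : Fin (k + 1) → K.Seed) :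
    play (probingAnalyst P F hP hF) K x (k + 1) u
      = (P ⟨k, hk⟩, K.answer x (play (probingAnalyst P F hP hF) K x k (Fin.init u)) (P ⟨k, hk⟩)
          (u (Fin.last k))) :: play (probingAnalyst P F hP hF) K x k (Fin.init u) := by
  simp only [play]
  rw [probingAnalyst_query_play x k hk]

theorem query_of_mem_play (x : Fin n → M.X) (k : ℕ) (hk : k ≤ Q) (u : Fin k → K.Seed)
    {e : (M.X → ℝ) × ℝ} (he : e ∈ play (probingAnalyst P F hP hF) K x k u) :
    ∃ t : Fin Q, (t : ℕ) < k ∧ e.1 = P t := by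
  induction k with
  | zero => simp [play] at he
  | succ k ih =>
    rw [play_succ x k hk, List.mem_cons] at he
    rcases he with rfl | he
    · exact ⟨⟨k, hk⟩, k.lt_succ_self, rfl⟩
    · obtain ⟨t, ht, h⟩ := ih (Nat.le_of_succ_le hk) _ he
      exact ⟨t, Nat.lt_succ_of_lt ht, h⟩

variable {r : ℝ → K.Seed → ℝ}

theorem play_eq_ofFn (hK : K.Responds (probingAnalyst P F hP hF) P r)
    (x : Fin n → M.X) (k : ℕ) (hk : k ≤ Q) (u : Fin k → K.Seed) :
    play (probingAnalyst P F hP hF) K x k u = (List.ofFn fun t : Fin k =>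
      (P (Fin.castLE hk t), r (M.posteriorMean x (P (Fin.castLE hk t))) (u t))).reverse := by
  induction k with
  | zero => simp [play]
  | succ k ih =>
    rw [play_succ x k hk, hK.answer_eq x ⟨k, hk⟩, ih (Nat.le_of_succ_le hk), List.ofFn_succ_last,
      List.reverse_append, List.reverse_singleton, List.singleton_append]
    rfl

theorem probingAnalyst_query_last (hK : K.Responds (probingAnalyst P F hP hF) P r)
    (x : Fin n → M.X) (u : Fin Q → K.Seed) :
    (probingAnalyst P F hP hF).query
        ((play (probingAnalyst P F hP hF) K x Q u).map Prod.snd)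
      = F fun t => isFar (r (M.posteriorMean x (P t)) (u t)) := by
  have h : ¬ ((play (probingAnalyst P F hP hF) K x Q u).map Prod.snd).length < Q := by
    rw [List.length_map, length_play]
    exact lt_irrefl _
  refine (dif_neg h).trans (congrArg F (funext fun t => congrArg isFar ?_))
  rw [play_eq_ofFn hK x Q le_rfl u, List.map_reverse, List.map_ofFn, List.getD_eq_getElem?_getD,
    List.getElem?_reverse (by rw [List.length_ofFn]; omega), List.length_ofFn, List.getElem?_ofFn]
  have e : Q - 1 - (Q - 1 - (t : ℕ)) = t := by omega
  rw [e, dif_pos t.2]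
  rfl

/-- Whether the answers to the first `Q` queries were far from one half. -/
def farBits (P : Fin Q → M.X → ℝ) (r : ℝ → K.Seed → ℝ)
    (x : Fin n → M.X) (u : Fin Q → K.Seed) (t : Fin Q) : Bool :=
  isFar (r (M.posteriorMean x (P t)) (u t))

theorem measurable_farBits (hK : K.Responds (probingAnalyst P F hP hF) P r)
    (x : Fin n → M.X) : Measurable (farBits P r x) :=
  measurable_pi_lambda _ fun t =>
    measurable_isFar.comp ((hK.measurable_response _).comp (measurable_pi_apply t))

/-- The answer to the last query. -/
def lastAnswer (A : Analyst M.X) (K : Curator M n) (F : (Fin Q → Bool) → M.X → ℝ)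
    (β : (Fin n → M.X) → (Fin Q → K.Seed) → Fin Q → Bool)
    (x : Fin n → M.X) (u : Fin (Q + 1) → K.Seed) : ℝ :=
  K.answer x (play A K x Q (Fin.init u)) (F (β x (Fin.init u))) (u (Fin.last Q))

/-- The strategy can win in two ways. Here only the accuracy of the probes is retained, and in
`accurateProb_le_last` only that of the final query. -/
theorem accurateProb_le_first (hK : K.Responds (probingAnalyst P F hP hF) P r)
    (ε : ℝ) :
    accurateProb (probingAnalyst P F hP hF) K (Q + 1) ε
      ≤ ((M.dataLaw n).prod (Measure.pi fun _ : Fin (Q + 1) => K.seedLaw)).real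
        {ω | ∀ t, |M.trueAnswer ω.1.1 (P t)
          - r (M.posteriorMean ω.1.2 (P t)) (Fin.init (α := fun _ => K.Seed) ω.2 t)| < ε} := by
  refine measureReal_mono fun ω hω t => ?_
  refine hω (P t, r (M.posteriorMean ω.1.2 (P t)) (Fin.init (α := fun _ => K.Seed) ω.2 t)) ?_
  simp only [play]
  refine List.mem_cons_of_mem _ ?_
  rw [play_eq_ofFn hK ω.1.2 Q le_rfl]
  rw [List.mem_reverse, List.mem_ofFn]
  exact ⟨t, rfl⟩

theorem accurateProb_le_last (hK : K.Responds (probingAnalyst P F hP hF) P r)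
    (ε : ℝ) :
    accurateProb (probingAnalyst P F hP hF) K (Q + 1) ε
      ≤ ((M.dataLaw n).prod (Measure.pi fun _ : Fin (Q + 1) => K.seedLaw)).real
        {ω | |M.trueAnswer ω.1.1 (F (farBits P r ω.1.2 (Fin.init ω.2)))
          - lastAnswer (probingAnalyst P F hP hF) K F (farBits P r) ω.1.2 ω.2| < ε} := by
  refine measureReal_mono fun ω hω => ?_
  refine hω (F (farBits P r ω.1.2 (Fin.init ω.2)),
    lastAnswer (probingAnalyst P F hP hF) K F (farBits P r) ω.1.2 ω.2) ?_
  simp only [play]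
  refine List.mem_cons.2 (.inl ?_)
  rw [probingAnalyst_query_last hK]
  rfl

end Play

end BayesADA

end

/-! ### Both curators answer probes by a fixed random function of the posterior mean -/

noncomputable section

namespace BayesADA

namespace Model

variable {m : ℕ} [NeZero m] {C : Submodule (ZMod 2) (Fin m → ZMod 2)} {Q n : ℕ}

variable (C) in
/-- What a probe is aimed at: a factor, a live position and a symbol. -/
abbrev Target : Type := Fin m × {j : Fin m // Live C j} × ZMod 2

/-- The probes with given targets. -/
def probes (γ : ℝ) (i₀ i₁ : Fin m) (sched : Fin Q → Target C) (t : Fin Q) : (hard C Q).X → ℝ :=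
  probe γ i₀ i₁ (sched t).1 (sched t).2.1 (sched t).2.2 t

/-- With a common prior law `ν`, the obfuscation `g` becomes on probes a single function `g ν` of
the posterior mean and the seed. Without probes any `ν` will do. -/
theorem exists_priorLaw_probes (γ : ℝ) {i₀ i₁ : Fin m} (h : i₀ ≠ i₁) (sched : Fin Q → Target C) :
    ∃ ν, ∀ t, (hard C Q).priorLaw (probes γ i₀ i₁ sched t) = ν := by
  rcases Q with _ | Q
  · exact ⟨0, fun t => t.elim0⟩
  · exact ⟨(hard C (Q + 1)).priorLaw (probes γ i₀ i₁ sched 0), fun t =>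
      priorLaw_probe_eq γ h _ _ (sched t).2.1.2 (sched 0).2.1.2 _ _ t 0⟩

section

variable {γ : ℝ} {i₀ i₁ : Fin m} {sched : Fin Q → Target C}
  {F : (Fin Q → Bool) → (hard C Q).X → ℝ}
  {hP : ∀ t x, probes γ i₀ i₁ sched t x ∈ Set.Icc (0 : ℝ) 1}
  {hF : ∀ β x, F β x ∈ Set.Icc (0 : ℝ) 1} {ν : Measure ℝ}

theorem obfuscated_responds (hν : ∀ t, (hard C Q).priorLaw (probes γ i₀ i₁ sched t) = ν)
    (G : Obfuscation) :
    (obfuscatedCurator (hard C Q) n G).Responds (probingAnalyst _ F hP hF)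
      (probes γ i₀ i₁ sched) (G.g ν) where
  measurable_response := G.measurable_g ν
  answer_eq x t u v := by
    change G.g ((hard C Q).priorLaw (probes γ i₀ i₁ sched t)) _ v = _
    rw [hν]

theorem obfuscated_measurable_last
    (hν : ∀ t, (hard C Q).priorLaw (probes γ i₀ i₁ sched t) = ν) (G : Obfuscation)
    (x : Fin n → (hard C Q).X) :
    Measurable (lastAnswer (probingAnalyst _ F hP hF) (obfuscatedCurator (hard C Q) n G) F
      (farBits (K := obfuscatedCurator (hard C Q) n G) (probes γ i₀ i₁ sched) (G.g ν)) x) := by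
  have hβ := (measurable_farBits (obfuscated_responds (n := n) (hF := hF) (hP := hP) hν G) x).comp
    (measurePreserving_init G.seedLaw Q).measurable
  have h1 : Measurable fun p : (Fin Q → Bool) × G.Seed =>
      G.g ((hard C Q).priorLaw (F p.1)) ((hard C Q).posteriorMean x (F p.1)) p.2 :=
    measurable_from_prod_countable_right fun β =>
      G.measurable_g ((hard C Q).priorLaw (F β)) ((hard C Q).posteriorMean x (F β))
  exact h1.comp (hβ.prodMk (measurable_pi_apply (Fin.last Q)))

/-- The response of private multiplicative weights to a probe. -/
def pmwResponse (G : Obfuscation) (ν : Measure ℝ) (T : ℝ) (noise : G.Seed → ℝ) (a : ℝ)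
    (u : G.Seed) : ℝ :=
  if |a + noise u - 1 / 2| ≤ T then 1 / 2 else G.g ν a u

/-- The proxy answers every probe by 1/2 whatever its past updates. Neither the comparison nor the
released value therefore depends on the transcript, and the learning rate disappears from the
response. -/
theorem pmw_responds (h : i₀ ≠ i₁)
    (hν : ∀ t, (hard C Q).priorLaw (probes γ i₀ i₁ sched t) = ν)
    (G : Obfuscation) (η T : ℝ) (noise : G.Seed → ℝ) (hnoise : Measurable noise) :
    (pmwCurator (hard C Q) n η T G noise hnoise).Responds (probingAnalyst _ F hP hF)
      (probes γ i₀ i₁ sched) (pmwResponse G ν T noise) where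
  measurable_response a := by
    refine Measurable.ite ?_ measurable_const (G.measurable_g _ _)
    exact measurableSet_le
      (measurable_norm.comp ((measurable_const.add hnoise).sub measurable_const))
      measurable_const
  answer_eq x t u v := by
    have hp := proxyAnswer_probe η γ h (sched t).1 (sched t).2.1 (sched t).2.2 t
      (play (probingAnalyst _ F hP hF) (pmwCurator (hard C Q) n η T G noise hnoise) x t u)
      fun e he => by
        obtain ⟨t', ht', h'⟩ := query_of_mem_play x t t.2.le u he
        exact ⟨_, _, _, t', fun h'' => ht'.ne (congrArg Fin.val h''), h'⟩
    change (if |_ + noise v - proxyAnswer (hard C Q) η _ (probe γ i₀ i₁ _ _ _ t)| ≤ T then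
      proxyAnswer (hard C Q) η _ (probe γ i₀ i₁ _ _ _ t)
      else G.g ((hard C Q).priorLaw (probes γ i₀ i₁ sched t)) _ v) = _
    rw [hp, hν]
    rfl

theorem pmw_measurable_last (h : i₀ ≠ i₁)
    (hν : ∀ t, (hard C Q).priorLaw (probes γ i₀ i₁ sched t) = ν)
    (G : Obfuscation) (η T : ℝ) (noise : G.Seed → ℝ) (hnoise : Measurable noise)
    (x : Fin n → (hard C Q).X) :
    Measurable (lastAnswer (probingAnalyst _ F hP hF)
      (pmwCurator (hard C Q) n η T G noise hnoise) F
      (farBits (K := pmwCurator (hard C Q) n η T G noise hnoise) (probes γ i₀ i₁ sched)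
        (pmwResponse G ν T noise)) x) := by
  have hK := pmw_responds (n := n) (hF := hF) (hP := hP) h hν G η T noise hnoise
  have hβ := (measurable_farBits hK x).comp (measurePreserving_init G.seedLaw Q).measurable
  -- The final query is not a probe, so the actual proxy matters there. It is followed through the
  -- rounds as a measurable function of the seeds.
  have hD' : ∀ (k : ℕ) (_ : k ≤ Q) (y : (hard C Q).X), Measurable fun u : Fin k → G.Seed =>
      proxy (hard C Q) η (play (probingAnalyst _ F hP hF)
        (pmwCurator (hard C Q) n η T G noise hnoise) x k u) y := by
    intro k
    induction k with
    | zero => exact fun _ _ => measurable_const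
    | succ k ih =>
      intro hk y
      have h1 : ∀ u : Fin (k + 1) → G.Seed, play (probingAnalyst _ F hP hF)
          (pmwCurator (hard C Q) n η T G noise hnoise) x (k + 1) u
          = (probes γ i₀ i₁ sched ⟨k, hk⟩, pmwResponse G ν T noise
            ((hard C Q).posteriorMean x (probes γ i₀ i₁ sched ⟨k, hk⟩)) (u (Fin.last k)))
            :: play (probingAnalyst _ F hP hF) (pmwCurator (hard C Q) n η T G noise hnoise) x k
              (Fin.init u) := fun u => by
        refine (play_succ (K := pmwCurator (hard C Q) n η T G noise hnoise) x k hk u).trans ?_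
        exact congrArg (fun z => (_, z) :: _) (hK.answer_eq x ⟨k, hk⟩ (Fin.init u) _)
      simp only [h1]
      have hinit : Measurable fun u : Fin (k + 1) → G.Seed => (Fin.init u : Fin k → G.Seed) :=
        (measurePreserving_init G.seedLaw k).measurable
      have hcomp : ∀ y, Measurable fun u : Fin (k + 1) → G.Seed =>
          proxy (hard C Q) η (play (probingAnalyst _ F hP hF)
            (pmwCurator (hard C Q) n η T G noise hnoise) x k (Fin.init u)) y := fun y =>
        Measurable.comp (g := fun u : Fin k → G.Seed => proxy (hard C Q) η
          (play (probingAnalyst _ F hP hF) (pmwCurator (hard C Q) n η T G noise hnoise) x k u) y)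
          (ih (Nat.le_of_succ_le hk) y) hinit
      exact measurable_proxy_cons _ η _ ((hK.measurable_response _).comp
        (measurable_pi_apply (X := fun _ : Fin (k + 1) => G.Seed) (Fin.last k))) hcomp y
  have hD := fun y => (hD' Q le_rfl y).comp (measurePreserving_init G.seedLaw Q).measurable
  have hpa : Measurable fun p : ((hard C Q).X → ℝ) × (Fin Q → Bool) =>
      ∑ y, p.1 y * F p.2 y :=
    Finset.measurable_sum _ fun y _ => ((measurable_pi_apply y).comp measurable_fst).mul
      ((Measurable.of_discrete (f := fun β => F β y)).comp measurable_snd)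
  have hpa' := hpa.comp ((measurable_pi_lambda _ hD).prodMk hβ)
  have hpm := (Measurable.of_discrete (f := fun β => (hard C Q).posteriorMean x (F β))).comp hβ
  have h1 : Measurable fun p : (Fin Q → Bool) × G.Seed =>
      G.g ((hard C Q).priorLaw (F p.1)) ((hard C Q).posteriorMean x (F p.1)) p.2 :=
    measurable_from_prod_countable_right fun β =>
      G.measurable_g ((hard C Q).priorLaw (F β)) ((hard C Q).posteriorMean x (F β))
  have hg := h1.comp (hβ.prodMk (measurable_pi_apply (Fin.last Q)))
  have hn := hnoise.comp (measurable_pi_apply (X := fun _ : Fin (Q + 1) => G.Seed) (Fin.last Q))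
  refine Measurable.ite ?_ hpa' hg
  exact measurableSet_le (measurable_norm.comp ((hpm.add hn).sub hpa')) measurable_const

end

end Model

end BayesADA

end

noncomputable section

namespace BayesADA

namespace Model

/-! ### The response to a single probe -/

/-- The weight of the code in a probe, for which a symbol shifts the posterior mean exactly as one
more head does. -/
def weight (m n : ℕ) : ℝ := (m - 1) / (8 * n + 2)

theorem weight_nonneg (m n : ℕ) [NeZero m] : 0 ≤ weight m n := by
  have h : (1 : ℝ) ≤ m := by exact_mod_cast NeZero.pos m
  exact div_nonneg (by linarith) (by positivity)

/-- The eight flips per sample more than suffice for this. The bound keeps the values of a probe in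
the unit interval. -/
theorem weight_le_one {m n : ℕ} (h : m ≤ 4 * n) : weight m n ≤ 1 := by
  have h' : (m : ℝ) ≤ 4 * n := by exact_mod_cast h
  exact (div_le_one (by positivity)).2 (by linarith [(n.cast_nonneg : (0 : ℝ) ≤ n)])

/-- The posterior mean of a probe with `k` and `k'` heads, the symbol having posterior
probability `e`. -/
def probeMean (m n k k' : ℕ) (e : ℝ) : ℝ :=
  probeVal m (weight m n) ((k + 1 : ℝ) / (8 * n + 2)) ((k' + 1 : ℝ) / (8 * n + 2)) e

/-- The weight is chosen so that `weight m n / m = (1 - 1/m) / (8n + 2)`, which is the step of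
Laplace's estimate times its coefficient in the probe. -/
theorem probeMean_shift (m n : ℕ) [NeZero m] (k k' : ℕ) :
    probeMean m n k k' 1 = probeMean m n (k + 1) k' 0 := by
  have h : (0 : ℝ) < m := by exact_mod_cast NeZero.pos m
  unfold probeMean probeVal weight
  push_cast
  field_simp
  ring

variable {S : Type*} [MeasurableSpace S] (μ : Measure S) [IsProbabilityMeasure μ]
  (r : ℝ → S → ℝ) (m n : ℕ)

/-- The law of the data of two coins and of a seed. -/
def roundLaw : Measure ((CoinData n × CoinData n) × S) :=
  ((coin8.dataLaw n).prod (coin8.dataLaw n)).prod μ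

instance : IsProbabilityMeasure (roundLaw μ n) := by unfold roundLaw; infer_instance

/-- The response to a probe, as a function of the two coins and the seed. -/
def response (e : ℝ) (z : (CoinData n × CoinData n) × S) : ℝ :=
  r (probeMean m n (heads z.1.1.2) (heads z.1.2.2) e) z.2

theorem measurable_heads : Measurable fun b : CoinData n => heads b.2 :=
  (Measurable.of_discrete (f := fun x : Fin n → coin8.X => heads x)).comp measurable_snd

variable {r}

/-- The response is measurable in the seed for each fixed posterior mean, but arbitrary in the
posterior mean. Joint measurability holds because the posterior mean factors through a countable
discrete quantity. -/
theorem measurable_comp_discrete {Ω κ : Type*} [MeasurableSpace Ω] [MeasurableSpace κ]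
    [DiscreteMeasurableSpace κ] [Countable κ] (hr : ∀ a, Measurable (r a)) (g : κ → ℝ)
    {k : Ω → κ} (hk : Measurable k) {s : Ω → S} (hs : Measurable s) :
    Measurable fun ω => r (g (k ω)) (s ω) :=
  Measurable.comp (g := fun p : κ × S => r (g p.1) p.2)
    (measurable_from_prod_countable_right fun a => hr (g a)) (hk.prodMk hs)

theorem measurable_response (hr : ∀ a, Measurable (r a)) (e : ℝ) :
    Measurable (response r m n e) :=
  measurable_comp_discrete hr (fun k : ℕ × ℕ => probeMean m n k.1 k.2 e)
    (k := fun z : (CoinData n × CoinData n) × S => (heads z.1.1.2, heads z.1.2.2))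
    (((measurable_heads n).comp (measurable_fst.comp measurable_fst)).prodMk
      ((measurable_heads n).comp (measurable_snd.comp measurable_fst))) measurable_snd

variable (r)

/-- The probability of a response far from one half. -/
def farProb (e : ℝ) : ℝ := (roundLaw μ n).real {z | isFar (response r m n e z) = true}

/-- The probability of a response far from one half, given the number of heads of the first coin. -/
def farProbAt (k : ℕ) (e : ℝ) : ℝ := ((coin8.dataLaw n).prod μ).real
  {z | isFar (r (probeMean m n k (heads z.1.2) e) z.2) = true}

variable {r}

theorem measurable_response_at (hr : ∀ a, Measurable (r a)) (k : ℕ) (e : ℝ) :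
    Measurable fun z : CoinData n × S => r (probeMean m n k (heads z.1.2) e) z.2 :=
  measurable_comp_discrete hr (fun k' : ℕ => probeMean m n k k' e)
    (k := fun z : CoinData n × S => heads z.1.2)
    ((measurable_heads n).comp measurable_fst) measurable_snd

/-- Independence of the first coin of the rest of a round. -/
theorem roundLaw_real_prod (U : Set (CoinData n)) (V : Set (CoinData n × S)) :
    (roundLaw μ n).real {z | z.1.1 ∈ U ∧ (z.1.2, z.2) ∈ V}
      = (coin8.dataLaw n).real U * ((coin8.dataLaw n).prod μ).real V := by
  have h := congrArg ENNReal.toReal ((measurePreserving_prodAssoc (coin8.dataLaw n)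
    (coin8.dataLaw n) μ).measure_preimage_equiv (U ×ˢ V))
  change _ = (((coin8.dataLaw n).prod ((coin8.dataLaw n).prod μ)).real (U ×ˢ V)) at h
  rw [measureReal_prod_prod] at h
  exact h

/-- Conditioning on the number of heads of the first coin, which is uniform and independent of the
second coin and of the seed. -/
theorem farProb_eq_sum (hr : ∀ a, Measurable (r a)) (e : ℝ) :
    farProb μ r m n e = (1 / (8 * n + 1)) * ∑ k ∈ Finset.range (8 * n + 1), farProbAt μ r m n k e := by
  have hset : {z | isFar (response r m n e z) = true} = ⋃ k ∈ Finset.range (8 * n + 1),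
      {z : (CoinData n × CoinData n) × S | z.1.1 ∈ {b : CoinData n | heads b.2 = k} ∧ (z.1.2, z.2) ∈
        {w : CoinData n × S | isFar (r (probeMean m n k (heads w.1.2) e) w.2) = true}} := by
    ext z
    simp only [Set.mem_iUnion, Set.mem_ofPred_eq, Finset.mem_range, exists_prop]
    constructor
    · intro h
      exact ⟨_, Nat.lt_succ_of_le (heads_le _), rfl, h⟩
    · rintro ⟨k, -, rfl, h⟩
      exact h
  have hm1 : ∀ k, MeasurableSet {b : CoinData n | heads b.2 = k} := fun k =>
    measurableSet_eq_fun (measurable_heads n) measurable_const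
  have hm2 : ∀ k, MeasurableSet
      {w : CoinData n × S | isFar (r (probeMean m n k (heads w.1.2) e) w.2) = true} := fun k =>
    measurableSet_eq_fun (measurable_isFar.comp (measurable_response_at m n hr k e))
      measurable_const
  rw [farProb, hset, measureReal_biUnion_finset]
  · rw [Finset.mul_sum]
    refine Finset.sum_congr rfl fun k hk => ?_
    rw [roundLaw_real_prod, dataLaw_coin8_heads (Nat.lt_succ_iff.1 (Finset.mem_range.1 hk))]
    rfl
  · intro k _ k' _ hkk'
    refine Set.disjoint_left.2 fun z hz hz' => hkk' ?_
    exact hz.1.symm.trans hz'.1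
  · intro k _
    exact ((hm1 k).preimage (measurable_fst.comp measurable_fst)).inter
      ((hm2 k).preimage ((measurable_snd.comp measurable_fst).prodMk measurable_snd))

/-- The gap between the responses to the two symbols telescopes. -/
theorem farProb_one_sub_zero [NeZero m] (hr : ∀ a, Measurable (r a)) :
    farProb μ r m n 1 - farProb μ r m n 0
      = (1 / (8 * n + 1)) * (farProbAt μ r m n (8 * n) 1 - farProbAt μ r m n 0 0) := by
  -- A response sees only the posterior mean, so it cannot tell the symbol from one more head.
  have h : ∀ k, farProbAt μ r m n k 1 = farProbAt μ r m n (k + 1) 0 := fun k => by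
    unfold farProbAt
    simp only [probeMean_shift]
  rw [farProb_eq_sum μ m n hr, farProb_eq_sum μ m n hr, ← mul_sub, ← Finset.sum_sub_distrib]
  simp only [h]
  rw [Finset.sum_range_sub fun k => farProbAt μ r m n k 0]

variable (r)

/-- The probability of an inaccurate response to a probe with symbol indicator `e`. -/
def errorProb (ε e : ℝ) : ℝ := (roundLaw μ n).real {z | ε ≤
  |probeVal m (weight m n) (bias z.1.1.1) (bias z.1.2.1) e - response r m n e z|}

variable {r}

/-- With no heads the first bias is below 1/16, up to exponentially small probability. The true
answer is then within 1/32 of 1/2, and every far response is an error. -/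
theorem errorProb_zero_ge [NeZero m] :
    farProbAt μ r m n 0 0 / (8 * n + 1) - (15 / 16) ^ (8 * n) ≤ errorProb μ r m n (1 / 40) 0 := by
  have hm : (1 : ℝ) ≤ m := by exact_mod_cast NeZero.pos m
  have h1 := roundLaw_real_prod μ n {b : CoinData n | heads b.2 = 0}
    {w : CoinData n × S | isFar (r (probeMean m n 0 (heads w.1.2) 0) w.2) = true}
  rw [dataLaw_coin8_heads (Nat.zero_le _)] at h1
  have h2 := roundLaw_real_prod μ n {b : CoinData n | heads b.2 = 0 ∧ 1 / 16 < bias b.1} Set.univ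
  rw [probReal_univ, mul_one] at h2
  have h3 := (dataLaw_coin8_no_heads n (1 / 16)).resolve_right (by norm_num)
  have h4 : (1 - 1 / 16 : ℝ) = 15 / 16 := by norm_num
  rw [h4] at h3
  have hsub : {z : (CoinData n × CoinData n) × S | z.1.1 ∈ {b : CoinData n | heads b.2 = 0} ∧
      (z.1.2, z.2) ∈
        {w : CoinData n × S | isFar (r (probeMean m n 0 (heads w.1.2) 0) w.2) = true}}
      ⊆ {z | 1 / 40 ≤ |probeVal m (weight m n) (bias z.1.1.1) (bias z.1.2.1) 0
          - response r m n 0 z|}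
        ∪ {z | z.1.1 ∈ {b : CoinData n | heads b.2 = 0 ∧ 1 / 16 < bias b.1} ∧
          (z.1.2, z.2) ∈ Set.univ} := by
    rintro z ⟨hz1, hz2⟩
    have hz1' : heads z.1.1.2 = 0 := hz1
    by_cases hb : 1 / 16 < bias z.1.1.1
    · exact .inr ⟨⟨hz1, hb⟩, trivial⟩
    left
    have hfar : 1 / 8 < |response r m n 0 z - 1 / 2| := by
      have : isFar (response r m n 0 z) = true := by
        rw [response, hz1']
        exact hz2
      exact of_decide_eq_true this
    have hval : |probeVal m (weight m n) (bias z.1.1.1) (bias z.1.2.1) 0 - 1 / 2| ≤ 1 / 32 := by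
      have e : probeVal m (weight m n) (bias z.1.1.1) (bias z.1.2.1) 0 - 1 / 2
          = (bias z.1.2.1 - 1 / 2) * ((1 - 1 / (m : ℝ)) * bias z.1.1.1) := by
        unfold probeVal; ring
      have h5 : |bias z.1.2.1 - 1 / 2| ≤ 1 / 2 := abs_le.2
        ⟨by linarith [bias_nonneg z.1.2.1], by linarith [bias_le_one z.1.2.1]⟩
      have h6 : 0 ≤ 1 - 1 / (m : ℝ) := by
        rw [sub_nonneg, div_le_one (by linarith)]; exact hm
      have h6' : 1 - 1 / (m : ℝ) ≤ 1 := by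
        have : 0 ≤ 1 / (m : ℝ) := by positivity
        linarith
      have h7 : |(1 - 1 / (m : ℝ)) * bias z.1.1.1| ≤ 1 / 16 := by
        rw [abs_of_nonneg (mul_nonneg h6 (bias_nonneg _))]
        exact (mul_le_of_le_one_left (bias_nonneg _) h6').trans (not_lt.1 hb)
      rw [e, abs_mul]
      calc _ ≤ (1 / 2 : ℝ) * (1 / 16) := mul_le_mul h5 h7 (abs_nonneg _) (by norm_num)
        _ = 1 / 32 := by norm_num
    have := abs_sub_abs_le_abs_sub (response r m n 0 z - 1 / 2)
      (probeVal m (weight m n) (bias z.1.1.1) (bias z.1.2.1) 0 - 1 / 2)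
    rw [sub_sub_sub_cancel_right, abs_sub_comm (response r m n 0 z)
      (probeVal m (weight m n) (bias z.1.1.1) (bias z.1.2.1) 0)] at this
    change (1 / 40 : ℝ) ≤ _
    linarith
  have h5 := (measureReal_mono hsub).trans (measureReal_union_le (μ := roundLaw μ n) _ _)
  rw [h1, h2] at h5
  have h6 : 1 / (8 * n + 1) * ((coin8.dataLaw n).prod μ).real
      {w : CoinData n × S | isFar (r (probeMean m n 0 (heads w.1.2) 0) w.2) = true}
      = farProbAt μ r m n 0 0 / (8 * n + 1) := by
    unfold farProbAt
    ring
  rw [h6] at h5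
  unfold errorProb
  linarith

/-- With only heads the first bias is at least 19/20, up to exponentially small probability, and the
second bias is at least 1/6 from 1/2 with probability 2/3. The true answer is then at least 3/20
from 1/2, and every response that is not far is an error. -/
theorem errorProb_one_ge (hm : 20 ≤ m) (hr : ∀ a, Measurable (r a)) :
    (2 / 3 - farProbAt μ r m n (8 * n) 1) / (8 * n + 1) - (19 / 20) ^ (8 * n)
      ≤ errorProb μ r m n (1 / 40) 1 := by
  have hm' : (20 : ℝ) ≤ m := by exact_mod_cast hm
  have h1 := roundLaw_real_prod μ n {b : CoinData n | heads b.2 = 8 * n}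
    {w : CoinData n × S | isFar (r (probeMean m n (8 * n) (heads w.1.2) 1) w.2) = true}ᶜ
  have hmeas : MeasurableSet
      {w : CoinData n × S | isFar (r (probeMean m n (8 * n) (heads w.1.2) 1) w.2) = true} :=
    measurableSet_eq_fun (measurable_isFar.comp (measurable_response_at m n hr (8 * n) 1))
      measurable_const
  rw [dataLaw_coin8_heads le_rfl, probReal_compl_eq_one_sub hmeas] at h1
  have h2 := roundLaw_real_prod μ n {b : CoinData n | heads b.2 = 8 * n ∧ bias b.1 < 19 / 20}
    Set.univ
  rw [probReal_univ, mul_one] at h2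
  have h3 := dataLaw_coin8_all_heads n (a := 19 / 20) (by norm_num)
  have h4 := roundLaw_real_prod μ n {b : CoinData n | heads b.2 = 8 * n}
    {w : CoinData n × S | |bias w.1.1 - 1 / 2| < 1 / 6}
  have hnear : ((coin8.dataLaw n).prod μ).real {w : CoinData n × S | |bias w.1.1 - 1 / 2| < 1 / 6}
      ≤ 1 / 3 := by
    have hms : MeasurableSet {p : coin8.Θ | |bias p - 1 / 2| < 1 / 6} :=
      measurableSet_lt (measurable_norm.comp (measurable_bias.sub_const _)) measurable_const
    have hmp : MeasurePreserving (fun w : CoinData n × S => w.1.1)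
        ((coin8.dataLaw n).prod μ) coin8.prior :=
      MeasurePreserving.comp ⟨measurable_fst, dataLaw_map_fst coin8 n⟩ measurePreserving_fst
    have := hmp.measureReal_preimage hms.nullMeasurableSet
    exact this.trans_le volume_unitInterval_near_half
  rw [dataLaw_coin8_heads le_rfl] at h4
  have hsub : {z : (CoinData n × CoinData n) × S | z.1.1 ∈ {b : CoinData n | heads b.2 = 8 * n} ∧
      (z.1.2, z.2) ∈ {w : CoinData n × S |
        isFar (r (probeMean m n (8 * n) (heads w.1.2) 1) w.2) = true}ᶜ}
      ⊆ ({z | 1 / 40 ≤ |probeVal m (weight m n) (bias z.1.1.1) (bias z.1.2.1) 1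
          - response r m n 1 z|}
        ∪ {z | z.1.1 ∈ {b : CoinData n | heads b.2 = 8 * n ∧ bias b.1 < 19 / 20} ∧
          (z.1.2, z.2) ∈ Set.univ})
        ∪ {z | z.1.1 ∈ {b : CoinData n | heads b.2 = 8 * n} ∧
          (z.1.2, z.2) ∈ {w : CoinData n × S | |bias w.1.1 - 1 / 2| < 1 / 6}} := by
    rintro z ⟨hz1, hz2⟩
    have hz1' : heads z.1.1.2 = 8 * n := hz1
    by_cases hp : |bias z.1.2.1 - 1 / 2| < 1 / 6
    · exact .inr ⟨hz1, hp⟩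
    left
    by_cases hb : bias z.1.1.1 < 19 / 20
    · exact .inr ⟨⟨hz1, hb⟩, trivial⟩
    left
    have hfar : |response r m n 1 z - 1 / 2| ≤ 1 / 8 := by
      have : ¬ isFar (response r m n 1 z) = true := by
        rw [response, hz1']
        exact hz2
      by_contra hc
      exact this (decide_eq_true (not_le.1 hc))
    -- The constants 3/20 here and 1/8 in `isFar` leave exactly the error 1/40.
    have hval : 3 / 20 ≤ |probeVal m (weight m n) (bias z.1.1.1) (bias z.1.2.1) 1 - 1 / 2| := by
      have e : probeVal m (weight m n) (bias z.1.1.1) (bias z.1.2.1) 1 - 1 / 2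
          = (bias z.1.2.1 - 1 / 2) * ((1 - 1 / (m : ℝ)) * bias z.1.1.1 + weight m n / m) := by
        unfold probeVal; ring
      have h6 : 19 / 20 ≤ 1 - 1 / (m : ℝ) := by
        have : 1 / (m : ℝ) ≤ 1 / 20 := one_div_le_one_div_of_le (by norm_num) hm'
        linarith
      have hw : 0 ≤ weight m n / m :=
        div_nonneg (div_nonneg (by linarith) (by positivity)) (by linarith)
      have h7 : 9 / 10 ≤ (1 - 1 / (m : ℝ)) * bias z.1.1.1 + weight m n / m := by
        have := mul_le_mul h6 (not_lt.1 hb) (by norm_num) (by linarith)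
        linarith
      rw [e, abs_mul, abs_of_nonneg (by linarith : 0 ≤ (1 - 1 / (m : ℝ)) * bias z.1.1.1
        + weight m n / m)]
      calc (3 / 20 : ℝ) = 1 / 6 * (9 / 10) := by norm_num
        _ ≤ _ := mul_le_mul (not_lt.1 hp) h7 (by norm_num) (abs_nonneg _)
    have := abs_sub_abs_le_abs_sub
      (probeVal m (weight m n) (bias z.1.1.1) (bias z.1.2.1) 1 - 1 / 2)
      (response r m n 1 z - 1 / 2)
    rw [sub_sub_sub_cancel_right] at this
    change (1 / 40 : ℝ) ≤ _
    linarith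
  have h5 := (measureReal_mono hsub).trans ((measureReal_union_le (μ := roundLaw μ n) _ _).trans
    (add_le_add_left (measureReal_union_le (μ := roundLaw μ n) _ _) _))
  rw [h1, h2, h4] at h5
  have hN : (0 : ℝ) < 8 * n + 1 := by positivity
  have h6 : 1 / (8 * n + 1) * ((coin8.dataLaw n).prod μ).real
      {w : CoinData n × S | |bias w.1.1 - 1 / 2| < 1 / 6} ≤ 1 / (8 * n + 1) * (1 / 3) :=
    mul_le_mul_of_nonneg_left hnear (by positivity)
  have h7 : (2 / 3 - farProbAt μ r m n (8 * n) 1) / (8 * n + 1)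
      = 1 / (8 * n + 1) * (1 - ((coin8.dataLaw n).prod μ).real {w : CoinData n × S |
        isFar (r (probeMean m n (8 * n) (heads w.1.2) 1) w.2) = true})
        - 1 / (8 * n + 1) * (1 / 3) := by
    unfold farProbAt
    ring
  rw [h7]
  unfold errorProb
  linarith

/-- Either the responses to the two symbols are far apart, or responses are inaccurate. -/
theorem farProb_gap_or_errorProb (hm : 20 ≤ m) (hr : ∀ a, Measurable (r a))
    (hn : (8 * n + 1) * (19 / 20 : ℝ) ^ (8 * n) ≤ 1 / 30) :
    1 / (2 * (8 * n + 1)) ≤ farProb μ r m n 1 - farProb μ r m n 0 ∨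
      ∃ e : ℝ, (e = 0 ∨ e = 1) ∧ 1 / (30 * (8 * n + 1)) ≤ errorProb μ r m n (1 / 40) e := by
  have : NeZero m := ⟨by omega⟩
  have hN : (0 : ℝ) < 8 * n + 1 := by positivity
  have hpow : (19 / 20 : ℝ) ^ (8 * n) ≤ 1 / 30 / (8 * n + 1) := by
    rw [le_div_iff₀ hN]; linarith
  have e30 : 1 / (30 * (8 * n + 1) : ℝ) = 1 / 30 / (8 * n + 1) := by field_simp
  rw [farProb_one_sub_zero μ m n hr, e30]
  -- If the two ends of the telescoping sum are at most 1/10 and at least 6/10, the gap is 1/2 of a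
  -- window step. Otherwise the margins 1/10 and 2/3 - 6/10 leave room for the exponentially small
  -- loss, which is at most 1/30 of a step.
  by_cases h0 : 1 / 10 < farProbAt μ r m n 0 0
  · refine .inr ⟨0, .inl rfl, le_trans ?_ (errorProb_zero_ge μ m n)⟩
    have h1 : (15 / 16 : ℝ) ^ (8 * n) ≤ (19 / 20) ^ (8 * n) :=
      pow_le_pow_left₀ (by norm_num) (by norm_num) _
    have h2 : (1 / 10) / (8 * n + 1 : ℝ) ≤ farProbAt μ r m n 0 0 / (8 * n + 1) :=
      div_le_div_of_nonneg_right h0.le hN.le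
    have h3 : (1 / 10) / (8 * n + 1 : ℝ) = 3 * (1 / 30 / (8 * n + 1)) := by ring
    have : 0 < 1 / 30 / (8 * n + 1 : ℝ) := by positivity
    linarith
  by_cases h1 : farProbAt μ r m n (8 * n) 1 < 6 / 10
  · refine .inr ⟨1, .inr rfl, le_trans ?_ (errorProb_one_ge μ m n hm hr)⟩
    have h2 : (1 / 15) / (8 * n + 1 : ℝ)
        ≤ (2 / 3 - farProbAt μ r m n (8 * n) 1) / (8 * n + 1) :=
      div_le_div_of_nonneg_right (by linarith) hN.le
    have h3 : (1 / 15) / (8 * n + 1 : ℝ) = 2 * (1 / 30 / (8 * n + 1)) := by ring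
    linarith
  · left
    have h2 : 1 / (2 * (8 * n + 1) : ℝ) = 1 / (8 * n + 1) * (1 / 2) := by field_simp
    rw [h2]
    exact mul_le_mul_of_nonneg_left (by linarith) (by positivity)

end Model

end BayesADA

end

/-! ### Independent rounds, and the case of inaccurate responses to probes -/

noncomputable section

namespace BayesADA

/-- A bound on sections gives a bound on a product measure. -/
theorem measureReal_prod_le_of_section {α β : Type*} [MeasurableSpace α] [MeasurableSpace β]
    (μ : Measure α) (ν : Measure β) [IsProbabilityMeasure μ] [IsProbabilityMeasure ν]
    {E : Set (α × β)} (hE : MeasurableSet E) {B : Set α} (hB : MeasurableSet B) {c : ℝ}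
    (hc : 0 ≤ c) (h : ∀ᵐ a ∂μ, a ∈ B → ν.real {b | (a, b) ∈ E} ≤ c) :
    (μ.prod ν).real E ≤ μ.real Bᶜ + c := by
  have h1 : (μ.prod ν) E ≤ μ Bᶜ + ENNReal.ofReal c := by
    rw [Measure.prod_apply hE]
    calc ∫⁻ a, ν (Prod.mk a ⁻¹' E) ∂μ
        ≤ ∫⁻ a, Bᶜ.indicator 1 a + ENNReal.ofReal c ∂μ := by
          refine lintegral_mono_ae ?_
          filter_upwards [h] with a ha
          by_cases haB : a ∈ B
          · rw [Set.indicator_of_notMem (by simpa using haB), zero_add,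
              ENNReal.le_ofReal_iff_toReal_le (measure_ne_top _ _) hc]
            exact ha haB
          · rw [Set.indicator_of_mem (by simpa using haB)]
            exact prob_le_one.trans le_self_add
      _ = _ := by
          rw [lintegral_add_right _ measurable_const, lintegral_indicator_one hB.compl,
            lintegral_const, measure_univ, mul_one]
  have h2 := ENNReal.toReal_mono (by finiteness) h1
  rwa [ENNReal.toReal_add (by finiteness) (by finiteness), ENNReal.toReal_ofReal hc] at h2

/-- The probability that some coordinates of an independent tuple all lie in a set. -/
theorem pi_real_forall_mem {ι α : Type*} [Fintype ι] [MeasurableSpace α] (μ : Measure α)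
    [IsProbabilityMeasure μ] (T : Finset ι) (U : Set α) :
    (Measure.pi fun _ : ι => μ).real {z | ∀ t ∈ T, z t ∈ U} = μ.real U ^ T.card := by
  classical
  have h : {z : ι → α | ∀ t ∈ T, z t ∈ U}
      = Set.pi Set.univ fun t => if t ∈ T then U else Set.univ := by
    ext z
    simp only [Set.mem_ofPred_eq, Set.mem_pi, Set.mem_univ, forall_const]
    refine forall_congr' fun t => ?_
    by_cases ht : t ∈ T <;> simp [ht]
  rw [h, measureReal_def, Measure.pi_pi, ENNReal.toReal_prod]
  have h2 : ∀ t, (μ (if t ∈ T then U else Set.univ)).toReal = if t ∈ T then μ.real U else 1 :=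
    fun t => by split_ifs <;> simp [measureReal_def]
  simp only [h2, Finset.prod_ite_mem, Finset.univ_inter, Finset.prod_const]

namespace Model

variable {m : ℕ} [NeZero m] {C : Submodule (ZMod 2) (Fin m → ZMod 2)} {Q n : ℕ}

variable (C n) in
/-- The law of the code parts of the data. -/
abbrev codesLaw : Measure (Fin m → CodeData C n) := Measure.pi fun _ => (ofCode C).dataLaw n

theorem ae_codesLaw_consistent : ∀ᵐ y ∂codesLaw C n, ∀ i, Consistent (y i).2 (y i).1 :=
  ae_all_iff.2 fun i => (measurePreserving_eval
    (fun _ : Fin m => (ofCode C).dataLaw n) i).quasiMeasurePreserving.ae (ae_consistent n)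

/-- The codes and the rounds. -/
def rounds {S : Type*} (i₀ i₁ : Fin m)
    (p : ((hard C Q).Θ × (Fin n → (hard C Q).X)) × (Fin (Q + 1) → S)) :
    (Fin m → CodeData C n) × (Fin Q → (CoinData n × CoinData n) × S) :=
  (codeData p.1, fun t => ((coinData p.1 i₀ t, coinData p.1 i₁ t), Fin.init p.2 t))

section

variable {S : Type*} [MeasurableSpace S] (μ : Measure S) [IsProbabilityMeasure μ]
  {r : ℝ → S → ℝ} {i₀ i₁ : Fin m}

/-- The law of independent rounds. -/
abbrev roundsLaw (n Q : ℕ) : Measure (Fin Q → (CoinData n × CoinData n) × S) :=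
  Measure.pi fun _ => roundLaw μ n

theorem measurePreserving_rounds' (h : i₀ ≠ i₁) :
    MeasurePreserving (rounds i₀ i₁)
      (((hard C Q).dataLaw n).prod (Measure.pi fun _ : Fin (Q + 1) => μ))
      ((codesLaw C n).prod (roundsLaw μ n Q)) :=
  measurePreserving_rounds μ h

theorem ae_rounds_consistent (h : i₀ ≠ i₁) :
    ∀ᵐ ω ∂(((hard C Q).dataLaw n).prod (Measure.pi fun _ : Fin (Q + 1) => μ)),
      ∀ i, Consistent (codeData ω.1 i).2 (codeData ω.1 i).1 :=
  (measurePreserving_rounds' (C := C) (Q := Q) (n := n) μ h).quasiMeasurePreserving.ae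
    (Measure.quasiMeasurePreserving_fst.ae ae_codesLaw_consistent)

/-- The response to a probe in terms of the codes and the rounds. -/
theorem response_probes (h : i₀ ≠ i₁) (sched : Fin Q → Target C)
    {ω : ((hard C Q).Θ × (Fin n → (hard C Q).X)) × (Fin (Q + 1) → S)}
    (hω : Possible ω.1.2) (t : Fin Q) :
    r ((hard C Q).posteriorMean ω.1.2 (probes (weight m n) i₀ i₁ sched t))
        (Fin.init (α := fun _ => S) ω.2 t)
      = response r m n (symbolProb ((rounds i₀ i₁ ω).1 (sched t).1).2 (sched t).2.1 (sched t).2.2)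
          ((rounds i₀ i₁ ω).2 t) := by
  have := posteriorMean_probe (weight m n) h (sched t).1 (sched t).2.1 (sched t).2.2 t hω
  exact congrArg (fun a => r a (Fin.init (α := fun _ => S) ω.2 t)) this

variable (r m n) in
/-- The error of the response to a probe, for a symbol of posterior probability `e` and
indicator `e'`. -/
def roundError (e e' : ℝ) (z : (CoinData n × CoinData n) × S) : ℝ :=
  |probeVal m (weight m n) (bias z.1.1.1) (bias z.1.2.1) e' - response r m n e z|

theorem measurable_roundError (hr : ∀ a, Measurable (r a)) (e e' : ℝ) :
    Measurable (roundError m n r e e') := by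
  have h1 : Measurable fun z : (CoinData n × CoinData n) × S => bias z.1.1.1 :=
    measurable_bias.comp (measurable_fst.comp (measurable_fst.comp measurable_fst))
  have h2 : Measurable fun z : (CoinData n × CoinData n) × S => bias z.1.2.1 :=
    measurable_bias.comp (measurable_fst.comp (measurable_snd.comp measurable_fst))
  exact measurable_norm.comp ((((h2.sub_const _).mul ((h1.const_mul _).add_const _)).const_add
    _).sub (measurable_response m n hr e))

theorem measurableSet_roundError_lt (hr : ∀ a, Measurable (r a)) (e e' : Fin Q → ℝ) (ε : ℝ) :
    MeasurableSet {z : Fin Q → (CoinData n × CoinData n) × S |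
      ∀ t, roundError m n r (e t) (e' t) (z t) < ε} := by
  have h : {z : Fin Q → (CoinData n × CoinData n) × S |
      ∀ t, roundError m n r (e t) (e' t) (z t) < ε}
      = Set.pi Set.univ fun t => {w | roundError m n r (e t) (e' t) w < ε} := by
    ext z
    simp
  rw [h]
  exact MeasurableSet.univ_pi fun t =>
    measurableSet_lt (measurable_roundError hr (e t) (e' t)) measurable_const

theorem codesLaw_unseen (i j : Fin m) :
    (codesLaw C n).real {y | ∃ l, pos ((y i).2 l) = j}ᶜ = (1 - 1 / (m : ℝ)) ^ n := by
  classical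
  have hm : (m : ℝ) ≠ 0 := by exact_mod_cast NeZero.ne m
  have h1 := congrArg ENNReal.toReal ((measurePreserving_eval
    (fun _ : Fin m => (ofCode C).dataLaw n) i).measure_preimage
    (MeasurableSet.of_discrete (s := {z : CodeData C n | ∀ l, pos (z.2 l) ≠ j})).nullMeasurableSet)
  have h2 := dataLaw_ofCode_pos (C := C) n fun p => ∀ l, p l ≠ j
  have h3 : (Finset.univ.filter fun p : Fin n → Fin m => ∀ l, p l ≠ j)
      = Fintype.piFinset fun _ => Finset.univ.erase j := by
    ext p
    simp [Fintype.mem_piFinset]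
  have h4 : {y : Fin m → CodeData C n | ∃ l, pos ((y i).2 l) = j}ᶜ
      = {y | ∀ l, pos ((y i).2 l) ≠ j} := by
    ext y
    simp
  rw [h4]
  refine h1.trans (h2.trans ?_)
  have h5 : (Finset.univ.filter fun p : Fin n → Fin m => ∀ l, p l ≠ j).card = (m - 1) ^ n := by
    rw [h3, Fintype.card_piFinset]
    simp
  have h6 : ((m - 1 : ℕ) : ℝ) = m - 1 := by
    rw [Nat.cast_sub (NeZero.pos m)]
    simp
  have h7 : (1 / (m : ℝ)) ^ n * ((m - 1 : ℝ)) ^ n = (1 - 1 / (m : ℝ)) ^ n := by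
    rw [← mul_pow]
    congr 1
    field_simp
  rw [← h7, ← h6, ← Nat.cast_pow, ← h5]
  congr!

/-- If responses are inaccurate too often, some probe is answered inaccurately. -/
theorem accurate_probes_le (h : i₀ ≠ i₁) (hr : ∀ a, Measurable (r a)) (sched : Fin Q → Target C)
    (i : Fin m) (j : {j : Fin m // Live C j}) {R : ℕ}
    (hR : ∀ s, R ≤ (Finset.univ.filter fun t => sched t = (i, j, s)).card) (ε : ℝ) {e : ℝ}
    (he : e = 0 ∨ e = 1) :
    (((hard C Q).dataLaw n).prod (Measure.pi fun _ : Fin (Q + 1) => μ)).real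
        {ω | ∀ t, |(hard C Q).trueAnswer ω.1.1 (probes (weight m n) i₀ i₁ sched t)
          - r ((hard C Q).posteriorMean ω.1.2 (probes (weight m n) i₀ i₁ sched t))
            (Fin.init (α := fun _ => S) ω.2 t)| < ε}
      ≤ (1 - 1 / (m : ℝ)) ^ n + (1 - errorProb μ r m n ε e) ^ R := by
  classical
  set E : Set ((Fin m → CodeData C n) × (Fin Q → (CoinData n × CoinData n) × S)) :=
    {v | ∀ t, roundError m n r (symbolProb (v.1 (sched t).1).2 (sched t).2.1 (sched t).2.2)
      (if word (v.1 (sched t).1).1 (sched t).2.1 = (sched t).2.2 then 1 else 0) (v.2 t) < ε}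
    with hEdef
  have hE : MeasurableSet E := by
    refine measurableSet_setOfPred.2 (measurable_from_prod_countable_right fun y => ?_)
    exact measurableSet_setOfPred.1 (measurableSet_roundError_lt hr
      (fun t => symbolProb (y (sched t).1).2 (sched t).2.1 (sched t).2.2)
      (fun t => if word (y (sched t).1).1 (sched t).2.1 = (sched t).2.2 then 1 else 0) ε)
  have hU : (roundLaw μ n).real {z | roundError m n r e e z < ε} = 1 - errorProb μ r m n ε e := by
    have h1 : errorProb μ r m n ε e = (roundLaw μ n).real {z | ε ≤ roundError m n r e e z} := rfl
    rw [h1, ← probReal_compl_eq_one_sub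
      (measurableSet_le measurable_const (measurable_roundError hr _ _))]
    congr 1
    ext z
    simp
  have hU0 : 0 ≤ 1 - errorProb μ r m n ε e := by
    rw [← hU]
    exact measureReal_nonneg
  have hU1 : 1 - errorProb μ r m n ε e ≤ 1 := by
    rw [← hU]
    exact measureReal_le_one
  have h1 : (((hard C Q).dataLaw n).prod (Measure.pi fun _ : Fin (Q + 1) => μ)).real
        {ω | ∀ t, |(hard C Q).trueAnswer ω.1.1 (probes (weight m n) i₀ i₁ sched t)
          - r ((hard C Q).posteriorMean ω.1.2 (probes (weight m n) i₀ i₁ sched t))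
            (Fin.init (α := fun _ => S) ω.2 t)| < ε}
      = ((codesLaw C n).prod (roundsLaw μ n Q)).real E := by
    rw [measureReal_def, measureReal_def,
      ← (measurePreserving_rounds' μ h).measure_preimage hE.nullMeasurableSet]
    congr 1
    refine measure_congr ?_
    filter_upwards [ae_rounds_consistent (C := C) (Q := Q) (n := n) μ h] with ω hω
    have hp : Possible ω.1.2 := fun i => ⟨_, hω i⟩
    refine propext (forall_congr' fun t => ?_)
    rw [response_probes (r := r) h sched hp t]
    have := trueAnswer_probe (weight m n) h (sched t).1 (sched t).2.1 (sched t).2.2 t ω.1.1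
    change |(hard C Q).trueAnswer ω.1.1 (probe _ _ _ _ _ _ _) - _| < ε ↔ _
    rw [this]
    rfl
  rw [h1]
  -- The codes are fixed first. Unless position `j` is missing from the samples of factor `i`, its
  -- symbol is known.
  refine (measureReal_prod_le_of_section _ _ hE
    (B := {y | ∃ l, pos ((y i).2 l) = (j : Fin m)}) MeasurableSet.of_discrete
    (pow_nonneg hU0 R) ?_).trans_eq (by rw [codesLaw_unseen])
  filter_upwards [ae_codesLaw_consistent (C := C) (n := n)] with y hy hyj
  obtain ⟨l, hl⟩ := hyj
  have hcons : ∀ c, Consistent (y i).2 c → word c j = word (y i).1 j := fun c hc => by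
    rw [← hl, hc l, hy i l]
  -- A known symbol makes posterior probability and indicator agree. Probing the true symbol
  -- realises `e = 1`, and probing the other one realises `e = 0`.
  obtain ⟨s, hs, hs'⟩ : ∃ s, symbolProb (y i).2 j s = e ∧
      (if word (y i).1 j = s then (1 : ℝ) else 0) = e := by
    rcases he with rfl | rfl
    · have hne : word (y i).1 j ≠ word (y i).1 j + 1 := by
        generalize word (y i).1 (j : Fin m) = a
        revert a
        decide
      exact ⟨word (y i).1 j + 1, symbolProb_eq_zero fun c hc => by rwa [hcons c hc], if_neg hne⟩
    · exact ⟨word (y i).1 j, symbolProb_eq_one (hy i) hcons, if_pos rfl⟩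
  -- Given the codes, the rounds aimed at this target are independent, each accurate with the same
  -- probability.
  calc (roundsLaw μ n Q).real {z | (y, z) ∈ E}
      ≤ (roundsLaw μ n Q).real {z | ∀ t ∈ Finset.univ.filter fun t => sched t = (i, j, s),
          z t ∈ {z | roundError m n r e e z < ε}} := by
        refine measureReal_mono fun z hz t ht => ?_
        have ht' : sched t = (i, j, s) := (Finset.mem_filter.1 ht).2
        have := hz t
        simp only [ht', hs, hs'] at this
        exact this
    _ = (1 - errorProb μ r m n ε e) ^ _ := by rw [pi_real_forall_mem, hU]
    _ ≤ _ := pow_le_pow_of_le_one hU0 hU1 (hR s)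

end

end Model

end BayesADA

end

/-! ### Estimating symbols, decoding, and the separating query -/

noncomputable section

namespace BayesADA

/-- Hoeffding's inequality for functions of the coordinates of an independent tuple. -/
theorem pi_real_sum_ge_le {ι α : Type*} [Fintype ι] [MeasurableSpace α] (μ : Measure α)
    [IsProbabilityMeasure μ] {f : ι → α → ℝ} (hf : ∀ t, Measurable (f t)) {a : ι → ℝ}
    (hb : ∀ t z, f t z ∈ Set.Icc (a t) (a t + 1)) (T : Finset ι) {ε : ℝ} (hε : 0 ≤ ε) :
    (Measure.pi fun _ : ι => μ).real {z | ε ≤ ∑ t ∈ T, (f t (z t) - ∫ x, f t x ∂μ)}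
      ≤ Real.exp (-2 * ε ^ 2 / T.card) := by
  have hi : iIndepFun (fun t (z : ι → α) => f t (z t) - ∫ x, f t x ∂μ)
      (Measure.pi fun _ : ι => μ) :=
    iIndepFun_pi (μ := fun _ : ι => μ) (X := fun t x => f t x - ∫ x, f t x ∂μ)
      fun t => ((hf t).sub_const _).aemeasurable
  -- By Hoeffding's lemma, the variance proxy of a variable in an interval of length one is
  -- `(1/2)²`.
  have hs : ∀ t ∈ T, HasSubgaussianMGF (fun z : ι → α => f t (z t) - ∫ x, f t x ∂μ) (1 / 4)
      (Measure.pi fun _ : ι => μ) := fun t _ => by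
    have hmp := measurePreserving_eval (fun _ : ι => μ) t
    have h1 := hasSubgaussianMGF_of_mem_Icc (μ := Measure.pi fun _ : ι => μ)
      (X := fun z : ι → α => f t (z t)) (a := a t) (b := a t + 1)
      ((hf t).comp (measurable_pi_apply t)).aemeasurable
      (Filter.Eventually.of_forall fun z => hb t (z t))
    have h2 := integral_map (μ := Measure.pi fun _ : ι => μ) hmp.measurable.aemeasurable
      (hf t).aestronglyMeasurable
    rw [hmp.map_eq] at h2
    rw [← show ∫ x, f t x ∂μ = ∫ z, f t (z t) ∂(Measure.pi fun _ : ι => μ) from h2] at h1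
    convert h1 using 1
    rw [add_sub_cancel_left, nnnorm_one]
    norm_num
  refine (HasSubgaussianMGF.measure_sum_ge_le_of_iIndepFun hi hs hε).trans_eq ?_
  congr 1
  push_cast
  rw [Finset.sum_const, nsmul_eq_mul]
  by_cases h : (T.card : ℝ) = 0
  · simp [h]
  · field_simp
    norm_num

theorem pi_real_abs_sum_ge_le {ι α : Type*} [Fintype ι] [MeasurableSpace α] (μ : Measure α)
    [IsProbabilityMeasure μ] {f : ι → α → ℝ} (hf : ∀ t, Measurable (f t)) {a : ι → ℝ}
    (hb : ∀ t z, f t z ∈ Set.Icc (a t) (a t + 1)) (T : Finset ι) {ε : ℝ} (hε : 0 ≤ ε) :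
    (Measure.pi fun _ : ι => μ).real {z | ε ≤ |∑ t ∈ T, (f t (z t) - ∫ x, f t x ∂μ)|}
      ≤ 2 * Real.exp (-2 * ε ^ 2 / T.card) := by
  have h1 := pi_real_sum_ge_le μ hf hb T hε
  have h2 := pi_real_sum_ge_le μ (f := fun t x => -f t x) (a := fun t => -a t - 1)
    (fun t => (hf t).neg) (fun t z => ⟨by linarith [(hb t z).2], by linarith [(hb t z).1]⟩) T hε
  have hsub : {z : ι → α | ε ≤ |∑ t ∈ T, (f t (z t) - ∫ x, f t x ∂μ)|}
      ⊆ {z | ε ≤ ∑ t ∈ T, (f t (z t) - ∫ x, f t x ∂μ)}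
        ∪ {z | ε ≤ ∑ t ∈ T, (-f t (z t) - ∫ x, -f t x ∂μ)} := by
    intro z hz
    have hz' : ε ≤ |∑ t ∈ T, (f t (z t) - ∫ x, f t x ∂μ)| := hz
    rcases le_abs.1 hz' with h | h
    · exact .inl h
    · refine .inr (h.trans_eq ?_)
      simp only [integral_neg]
      rw [← Finset.sum_neg_distrib]
      exact Finset.sum_congr rfl fun t _ => by ring
  have := (measureReal_mono (μ := Measure.pi fun _ : ι => μ) hsub).trans (measureReal_union_le _ _)
  linarith

namespace Model

variable {m : ℕ} [NeZero m] {C : Submodule (ZMod 2) (Fin m → ZMod 2)} {Q n : ℕ}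

/-! ### Estimating symbols -/

/-- The excess of far answers to probes of the symbol one over those of the symbol zero. -/
def score (sched : Fin Q → Target C) (β : Fin Q → Bool) (i : Fin m) (j : {j : Fin m // Live C j}) :
    ℝ :=
  ∑ t with (sched t).1 = i ∧ (sched t).2.1 = j,
    (if (sched t).2.2 = 1 then 1 else -1) * (if β t then 1 else 0)

open Classical in
/-- The symbol that the answers suggest, if any. -/
def estimate (sched : Fin Q → Target C) (a : ℝ) (β : Fin Q → Bool) (i : Fin m)
    (j : {j : Fin m // Live C j}) : Option (ZMod 2) :=
  if a < score sched β i j then some 1 else if score sched β i j < -a then some 0 else none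

/-- The estimate is the symbol that the samples determine, if they do. -/
def Reliable (y : Fin n → (ofCode C).X) (j : Fin m) (o : Option (ZMod 2)) : Prop :=
  ∀ s, o = some s ↔ ∀ c, Consistent y c → word c j = s

section

variable {S : Type*} [MeasurableSpace S] (μ : Measure S) [IsProbabilityMeasure μ]
  {r : ℝ → S → ℝ}

variable (r) in
/-- Which answers are far from one half, in terms of the codes and the rounds. -/
def roundBits (sched : Fin Q → Target C) (y : Fin m → CodeData C n)
    (z : Fin Q → (CoinData n × CoinData n) × S) (t : Fin Q) : Bool :=
  isFar (response r m n (symbolProb (y (sched t).1).2 (sched t).2.1 (sched t).2.2) (z t))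

theorem integral_far (hr : ∀ a, Measurable (r a)) (b e : ℝ) :
    ∫ z, b * (if isFar (response r m n e z) then 1 else 0) ∂(roundLaw μ n)
      = b * farProb μ r m n e := by
  have hm : MeasurableSet {z | isFar (response r m n e z) = true} :=
    measurableSet_eq_fun (measurable_isFar.comp (measurable_response m n hr e)) measurable_const
  rw [integral_const_mul, farProb, ← integral_indicator_one hm]
  congr 1
  refine integral_congr_ae (Filter.Eventually.of_forall fun z => ?_)
  by_cases h : isFar (response r m n e z) = true <;> simp [h]

theorem sum_target (sched : Fin Q → Target C) {R : ℕ}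
    (hR : ∀ v, (Finset.univ.filter fun t => sched t = v).card = R) (i : Fin m)
    (j : {j : Fin m // Live C j}) (g : ZMod 2 → ℝ) :
    ∑ t with (sched t).1 = i ∧ (sched t).2.1 = j, g (sched t).2.2 = R * (g 0 + g 1) := by
  rw [← Finset.sum_fiberwise (Finset.univ.filter fun t => (sched t).1 = i ∧ (sched t).2.1 = j)
    fun t => (sched t).2.2]
  have h : ∀ s, ∑ t ∈ (Finset.univ.filter fun t => (sched t).1 = i ∧ (sched t).2.1 = j) with
      (sched t).2.2 = s, g (sched t).2.2 = R * g s := fun s => by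
    rw [← hR (i, j, s), ← nsmul_eq_mul, ← Finset.sum_const, Finset.filter_filter]
    refine Finset.sum_congr (Finset.filter_congr fun t _ => ?_) fun t ht => ?_
    · rw [Prod.ext_iff, Prod.ext_iff, and_assoc]
    · rw [(Finset.mem_filter.1 ht).2]
  simp only [h]
  rw [← Finset.mul_sum]
  exact congrArg _ (Fin.sum_univ_two (f := g))

/-- The estimate of a symbol is reliable with high probability. -/
theorem estimate_unreliable_le (hr : ∀ a, Measurable (r a)) (sched : Fin Q → Target C) {R : ℕ}
    (hR : ∀ v, (Finset.univ.filter fun t => sched t = v).card = R) {τ : ℝ} (hτ : 0 ≤ τ)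
    (hgap : 2 * τ ≤ farProb μ r m n 1 - farProb μ r m n 0) (i : Fin m)
    (j : {j : Fin m // Live C j}) (y : Fin m → CodeData C n)
    (hy : Consistent (y i).2 (y i).1) :
    (roundsLaw μ n Q).real {z | ¬ Reliable (y i).2 j
      (estimate sched (τ * R) (roundBits r sched y z) i j)} ≤ 2 * Real.exp (-τ ^ 2 * R) := by
  classical
  set T := Finset.univ.filter fun t => (sched t).1 = i ∧ (sched t).2.1 = j with hT
  have hTcard : (T.card : ℝ) = 2 * R := by
    have := sum_target sched hR i j fun _ => 1
    rw [Finset.sum_const, nsmul_eq_mul, mul_one] at this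
    rw [this]
    ring
  set sg : ZMod 2 → ℝ := fun s => if s = 1 then 1 else -1 with hsg
  set f : Fin Q → (CoinData n × CoinData n) × S → ℝ := fun t z => sg (sched t).2.2 *
    (if isFar (response r m n (symbolProb (y i).2 j (sched t).2.2) z) then 1 else 0) with hf
  have hfm : ∀ t, Measurable (f t) := fun t => by
    refine (Measurable.ite ?_ measurable_const measurable_const).const_mul _
    exact measurableSet_eq_fun (measurable_isFar.comp (measurable_response m n hr _))
      measurable_const
  have hfb : ∀ t z, f t z ∈ Set.Icc (if sg (sched t).2.2 = 1 then (0 : ℝ) else -1)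
      ((if sg (sched t).2.2 = 1 then (0 : ℝ) else -1) + 1) := fun t z => by
    simp only [hf, hsg]
    split_ifs <;> norm_num at *
  -- The mean score is `R` times the gap, up to sign, when the symbol is determined. It is zero when
  -- it is not, because both symbols then have posterior probability 1/2.
  have hmean : ∑ t ∈ T, ∫ z, f t z ∂(roundLaw μ n) = R *
      (farProb μ r m n (symbolProb (y i).2 j 1) - farProb μ r m n (symbolProb (y i).2 j 0)) := by
    simp only [hf, integral_far μ hr]
    rw [sum_target sched hR i j fun s => sg s * farProb μ r m n (symbolProb (y i).2 j s)]
    have h0 : sg 0 = -1 := if_neg (by decide)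
    have h1 : sg 1 = 1 := if_pos rfl
    rw [h0, h1]
    ring
  have hscore : ∀ z, score sched (roundBits r sched y z) i j = ∑ t ∈ T, f t (z t) := fun z => by
    refine Finset.sum_congr rfl fun t ht => ?_
    obtain ⟨h1, h2⟩ := (Finset.mem_filter.1 ht).2
    simp only [hf, hsg, roundBits, h1, h2]
  have hmain := pi_real_abs_sum_ge_le (roundLaw μ n) hfm hfb T
    (mul_nonneg hτ (Nat.cast_nonneg R) : 0 ≤ τ * R)
  -- Each position receives `2 R` probes, `R` for either symbol.
  have hexp : -2 * (τ * R) ^ 2 / T.card = -τ ^ 2 * R := by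
    rw [hTcard]
    by_cases h : (R : ℝ) = 0
    · simp [h]
    · field_simp
  rw [hexp] at hmain
  refine (measureReal_mono fun z hz => ?_).trans hmain
  by_contra hlt
  refine hz ?_
  -- A deviation below `τ R` cannot cross the threshold `τ R`, since the possible means are 0 and
  -- values at least `2 τ R` in modulus.
  have hlt' : |score sched (roundBits r sched y z) i j - R *
      (farProb μ r m n (symbolProb (y i).2 j 1) - farProb μ r m n (symbolProb (y i).2 j 0))|
      < τ * R := by
    rw [hscore, ← hmean, ← Finset.sum_sub_distrib]
    exact not_le.1 hlt
  have hR0 : (0 : ℝ) ≤ R := Nat.cast_nonneg R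
  have hτR := mul_nonneg hτ hR0
  have hgapR := mul_le_mul_of_nonneg_right hgap hR0
  obtain ⟨hl, hu⟩ := abs_lt.1 hlt'
  by_cases hdet : ∀ c, Consistent (y i).2 c → word c j = word (y i).1 j
  · have hrel : ∀ s, (∀ c, Consistent (y i).2 c → word c j = s) ↔ word (y i).1 j = s :=
      fun s => ⟨fun h => h _ hy, fun h c hc => (hdet c hc).trans h⟩
    have key : estimate sched (τ * R) (roundBits r sched y z) i j = some (word (y i).1 j) := by
      have h01 : word (y i).1 (j : Fin m) = 0 ∨ word (y i).1 (j : Fin m) = 1 := by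
        generalize word (y i).1 (j : Fin m) = a
        revert a
        decide
      rcases h01 with h | h
      · have e0 : symbolProb (y i).2 j 0 = 1 :=
          symbolProb_eq_one hy fun c hc => (hdet c hc).trans h
        have e1 : symbolProb (y i).2 j 1 = 0 := symbolProb_eq_zero fun c hc => by
          rw [hdet c hc, h]
          decide
        rw [e0, e1] at hl hu
        have : score sched (roundBits r sched y z) i j < -(τ * R) := by linarith
        rw [estimate, if_neg (by linarith), if_pos this, h]
      · have e1 : symbolProb (y i).2 j 1 = 1 :=
          symbolProb_eq_one hy fun c hc => (hdet c hc).trans h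
        have e0 : symbolProb (y i).2 j 0 = 0 := symbolProb_eq_zero fun c hc => by
          rw [hdet c hc, h]
          decide
        rw [e0, e1] at hl hu
        have : τ * R < score sched (roundBits r sched y z) i j := by linarith
        rw [estimate, if_pos this, h]
    intro s
    rw [key, hrel, Option.some_inj]
  · push Not at hdet
    obtain ⟨c, hc, hne⟩ := hdet
    rw [symbolProb_eq_half _ hc hy hne, symbolProb_eq_half _ hc hy hne, sub_self, mul_zero,
      sub_zero] at hl hu
    intro s
    rw [estimate, if_neg (by linarith), if_neg (by linarith)]
    constructor
    · intro h
      cases h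
    · intro h
      exact absurd ((h c hc).trans (h _ hy).symm) hne

end

/-! ### Decoding -/

/-- The codewords that agree with all estimates of their symbols. -/
def decode (o : {j : Fin m // Live C j} → Option (ZMod 2)) : Set (ofCode C).Θ :=
  {c | ∀ (j : {j : Fin m // Live C j}) (s : ZMod 2), o j = some s → word c j = s}

/-- Reliable estimates impose exactly the symbols forced by the samples, among them all sampled live
positions. At the remaining sampled positions every codeword vanishes and there is nothing to check.
-/
theorem decode_eq {y : Fin n → (ofCode C).X} {c₀ : (ofCode C).Θ} (hc₀ : Consistent y c₀)
    {o : {j : Fin m // Live C j} → Option (ZMod 2)} (ho : ∀ j : {j : Fin m // Live C j}, Reliable y j (o j)) :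
    decode o = {c | Consistent y c} := by
  ext c
  constructor
  · intro hc l
    by_cases hl : Live C (pos (y l))
    · exact hc ⟨pos (y l), hl⟩ _ ((ho ⟨pos (y l), hl⟩ _).2 fun d hd => hd l)
    · have hz : ∀ d : (ofCode C).Θ, word d (pos (y l)) = 0 := fun d => by
        by_contra hne
        exact hl ⟨_, word_mem d, hne⟩
      rw [hz, ← hc₀ l, hz]
  · intro hc j s hs
    exact (ho j s).1 hs c hc

/-- The consistent codewords form a coset of the codewords vanishing at the sampled positions.
Ambiguity says that these are only 0 and `w`. -/
theorem consistent_eq_pair {y : Fin n → (ofCode C).X} {c : (ofCode C).Θ} (hc : Consistent y c)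
    (ha : Ambiguous C fun l => pos (y l)) : ∃ d, c ≠ d ∧ {c | Consistent y c} = {c, d} := by
  obtain ⟨w, hw, hw0, hwy, hmin⟩ := ha
  refine ⟨translate w hw c, fun h => hw0 ?_, ?_⟩
  · have := congrArg word h
    rwa [word_translate, left_eq_add] at this
  · ext d
    simp only [Set.mem_ofPred_eq, Set.mem_insert_iff, Set.mem_singleton_iff]
    constructor
    · intro hd
      rcases hmin (word d - word c) (C.sub_mem (word_mem d) (word_mem c)) fun l => by
        rw [Pi.sub_apply, hd l, hc l, sub_self] with h | h
      · exact .inl (word_injective (sub_eq_zero.1 h))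
      · refine .inr (word_injective ?_)
        rw [word_translate, ← h, add_sub_cancel]
    · rintro (rfl | rfl)
      · exact hc
      · intro l
        rw [word_translate, Pi.add_apply, hwy l, add_zero, hc l]

/-- The estimates single out two codewords of some factor. -/
def Resolved (o : Fin m → {j : Fin m // Live C j} → Option (ZMod 2)) : Prop :=
  ∃ p : Fin m × (ofCode C).Θ × (ofCode C).Θ, p.2.1 ≠ p.2.2 ∧ decode (o p.1) = {p.2.1, p.2.2}

variable (Q) in
open Classical in
/-- The query that separates two remaining codewords. -/
def finalQuery (o : Fin m → {j : Fin m // Live C j} → Option (ZMod 2)) (x : (hard C Q).X) : ℝ :=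
  if h : Resolved o then
    if bit (smpCode x h.choose.1) = word h.choose.2.1 (pos (smpCode x h.choose.1)) then 1 else 0
  else 0

theorem finalQuery_mem (o : Fin m → {j : Fin m // Live C j} → Option (ZMod 2))
    (x : (hard C Q).X) : finalQuery Q o x ∈ Set.Icc (0 : ℝ) 1 := by
  unfold finalQuery
  split_ifs <;> simp

theorem trueAnswer_code (θ : (hard C Q).Θ) (i : Fin m) (A : (ofCode C).X → ℝ) :
    (hard C Q).trueAnswer θ (fun x => A (smpCode x i))
      = (ofCode C).trueAnswer (hypCode θ i) A := by
  refine (trueAnswer_tensorPow_apply (cell C Q) θ i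
    fun z => A (Prod.fst (β := (coin8.tensorPow Q).X) z)).trans ?_
  have h := trueAnswer_tensor (ofCode C) (coin8.tensorPow Q) (θ i) A fun _ => 1
  rw [trueAnswer_const, mul_one] at h
  refine Eq.trans ?_ h
  exact congrArg _ (funext fun z => (mul_one _).symm)

/-- Translation of the codeword of one factor. -/
def swap (i : Fin m) (w : Fin m → ZMod 2) (hw : w ∈ C) (θ : (hard C Q).Θ) : (hard C Q).Θ :=
  fun k => (if k = i then translate w hw (hypCode θ k) else hypCode θ k, fun t => hypCoin θ k t)

theorem measurePreserving_swap (i : Fin m) (w : Fin m → ZMod 2) (hw : w ∈ C) :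
    MeasurePreserving (swap (Q := Q) i w hw) (hard C Q).prior (hard C Q).prior := by
  refine measurePreserving_pi (fun _ : Fin m => (cell C Q).prior) (fun _ : Fin m =>
    (cell C Q).prior) (f := fun k θ => (if k = i then translate w hw θ.1 else θ.1, θ.2)) fun k => ?_
  by_cases hk : k = i
  · simp only [hk, if_true]
    exact (measurePreserving_translate w hw).prod (MeasurePreserving.id _)
  · simp only [hk, if_false]
    exact MeasurePreserving.id _

theorem likelihood_hard (x : Fin n → (hard C Q).X) (θ : (hard C Q).Θ) :
    (hard C Q).likelihood x θ = ∏ k, ((ofCode C).likelihood (fun l => smpCode (x l) k) (hypCode θ k)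
      * (coin8.tensorPow Q).likelihood (fun l => smpCoin (x l) k) (hypCoin θ k)) := by
  refine (likelihood_tensorPow (cell C Q) x θ).trans (Finset.prod_congr rfl fun k _ => ?_)
  exact likelihood_tensor (ofCode C) (coin8.tensorPow Q) _ _

theorem likelihood_swap {x : Fin n → (hard C Q).X} (i : Fin m) {w : Fin m → ZMod 2} (hw : w ∈ C)
    (h : ∀ l, w (pos (smpCode (x l) i)) = 0) (θ : (hard C Q).Θ) :
    (hard C Q).likelihood x (swap i w hw θ) = (hard C Q).likelihood x θ := by
  rw [likelihood_hard, likelihood_hard]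
  refine Finset.prod_congr rfl fun k _ => ?_
  congr 1
  change (ofCode C).likelihood _ (if k = i then translate w hw (hypCode θ k) else hypCode θ k) = _
  split_ifs with hk
  · subst hk
    exact likelihood_translate hw h _
  · rfl

theorem consistent_of_likelihood_ne_zero {x : Fin n → (hard C Q).X} {θ : (hard C Q).Θ}
    (h : (hard C Q).likelihood x θ ≠ 0) (i : Fin m) :
    Consistent (fun l => smpCode (x l) i) (hypCode θ i) := by
  by_contra hc
  refine h ?_
  rw [likelihood_hard]
  refine Finset.prod_eq_zero (Finset.mem_univ i) ?_
  rw [likelihood_ofCode, if_neg hc, zero_mul]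

/-- When the estimates are reliable and some factor is ambiguous, the last query separates
equally likely hypotheses. -/
theorem exists_swap (hC : ∀ c ∈ C, ∀ c' ∈ C, c ≠ c' → m ≤ 10 * hammingDist c c')
    {x : Fin n → (hard C Q).X} (hx : Possible x)
    {o : Fin m → {j : Fin m // Live C j} → Option (ZMod 2)}
    (ho : ∀ i (j : {j : Fin m // Live C j}), Reliable (fun l => smpCode (x l) i) j (o i j))
    (ha : ∃ i, Ambiguous C fun l => pos (smpCode (x l) i)) :
    ∃ τ : (hard C Q).Θ → (hard C Q).Θ, MeasurePreserving τ (hard C Q).prior (hard C Q).prior ∧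
      (∀ θ, (hard C Q).likelihood x (τ θ) = (hard C Q).likelihood x θ) ∧
      ∀ θ, (hard C Q).likelihood x θ ≠ 0 →
        1 / 10 ≤ |(hard C Q).trueAnswer θ (finalQuery Q o)
          - (hard C Q).trueAnswer (τ θ) (finalQuery Q o)| := by
  have hm : (0 : ℝ) < m := by exact_mod_cast NeZero.pos m
  have hdec : ∀ i, decode (o i) = {c | Consistent (fun l => smpCode (x l) i) c} := fun i => by
    obtain ⟨c, hc⟩ := hx i
    exact decode_eq hc (ho i)
  have hres : Resolved o := by
    obtain ⟨i, hi⟩ := ha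
    obtain ⟨c, hc⟩ := hx i
    obtain ⟨d, hcd, hd⟩ := consistent_eq_pair hc hi
    exact ⟨(i, c, d), hcd, (hdec i).trans hd⟩
  have hspec := hres.choose_spec
  have hF : (finalQuery Q o : (hard C Q).X → ℝ) = fun x => (fun z => if bit z
      = word hres.choose.2.1 (pos z) then 1 else 0) (smpCode x hres.choose.1) :=
    funext fun x => dif_pos hres
  -- The factor picked by the final query need not be the ambiguous one found above. Because all
  -- estimates are reliable, its two words are nevertheless exactly the consistent ones.
  generalize hres.choose = p at hspec hF
  obtain ⟨i, c, d⟩ := p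
  obtain ⟨hcd, hset⟩ := hspec
  rw [hdec] at hset
  dsimp only at hcd hset hF
  have hcc : Consistent (fun l => smpCode (x l) i) c := by
    have : c ∈ ({c, d} : Set (ofCode C).Θ) := .inl rfl
    rwa [← hset] at this
  have hdd : Consistent (fun l => smpCode (x l) i) d := by
    have : d ∈ ({c, d} : Set (ofCode C).Θ) := .inr rfl
    rwa [← hset] at this
  have hw : word c + word d ∈ C := C.add_mem (word_mem c) (word_mem d)
  have hans : ∀ θ : (hard C Q).Θ, (hard C Q).trueAnswer θ (finalQuery Q o)
      = 1 - hammingDist (word (hypCode θ i)) (word c) / (m : ℝ) := fun θ => by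
    rw [hF, trueAnswer_code θ i fun z => if bit z = word c (pos z) then 1 else 0,
      trueAnswer_agree]
  have hself : ∀ a : Fin m → ZMod 2, a + a = 0 := fun a => by
    ext j
    exact CharTwo.add_self_eq_zero (a j)
  have hdist : (1 / 10 : ℝ) ≤ hammingDist (word c) (word d) / (m : ℝ) := by
    have h1 := hC _ (word_mem c) _ (word_mem d) fun h => hcd (word_injective h)
    have h2 : (m : ℝ) ≤ 10 * hammingDist (word c) (word d) := by exact_mod_cast h1
    rw [le_div_iff₀ hm]
    linarith
  -- Translation by `word c + word d` exchanges `c` and `d`, and the agreement with `c` changes by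
  -- their relative distance.
  refine ⟨swap i _ hw, measurePreserving_swap i _ hw, likelihood_swap i hw fun l => ?_,
    fun θ hθ => ?_⟩
  · rw [Pi.add_apply, hcc l, hdd l]
    exact CharTwo.add_self_eq_zero _
  · have hθ' : hypCode (swap i _ hw θ) i = translate _ hw (hypCode θ i) := if_pos rfl
    have hmem : hypCode θ i ∈ ({c, d} : Set (ofCode C).Θ) := by
      rw [← hset]
      exact consistent_of_likelihood_ne_zero hθ i
    rw [hans, hans, hθ', word_translate]
    rcases hmem with h | h
    · have e : word c + (word c + word d) = word d := by
        rw [← add_assoc, hself, zero_add]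
      rw [h, e, hammingDist_self, hammingDist_comm, Nat.cast_zero, zero_div]
      rw [le_abs]
      left
      linarith
    · have e : word d + (word c + word d) = word c := by
        rw [add_left_comm, hself, add_zero]
      rw [h, e, hammingDist_self, hammingDist_comm, Nat.cast_zero, zero_div]
      rw [le_abs]
      right
      linarith

end Model

end BayesADA

end

/-! ### The case of distinguishable responses: failure of the last answer -/

noncomputable section

namespace BayesADA

namespace Model

/-- If, on a good event of samples and seeds, an involution of equal likelihood changes the answer
to a query by `2ε`, then the response is inaccurate with half the probability of that event. -/
theorem accurate_real_le_half (M : Model) {n : ℕ} {S : Type*} [MeasurableSpace S] (ν : Measure S)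
    [IsProbabilityMeasure ν] (q : (Fin n → M.X) → S → M.X → ℝ) (a : (Fin n → M.X) → S → ℝ) {ε : ℝ}
    (hA : MeasurableSet {ω : (M.Θ × (Fin n → M.X)) × S |
      |M.trueAnswer ω.1.1 (q ω.1.2 ω.2) - a ω.1.2 ω.2| < ε})
    {G : Set ((Fin n → M.X) × S)} (hG : MeasurableSet G)
    (hτ : ∀ p ∈ G, ∃ τ : M.Θ → M.Θ, MeasurePreserving τ M.prior M.prior ∧
      (∀ θ, M.likelihood p.1 (τ θ) = M.likelihood p.1 θ) ∧
      ∀ θ, M.likelihood p.1 θ ≠ 0 →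
        2 * ε ≤ |M.trueAnswer θ (q p.1 p.2) - M.trueAnswer (τ θ) (q p.1 p.2)|) :
    ((M.dataLaw n).prod ν).real {ω | |M.trueAnswer ω.1.1 (q ω.1.2 ω.2) - a ω.1.2 ω.2| < ε}
      ≤ 1 - ((M.dataLaw n).prod ν).real {ω | (ω.1.2, ω.2) ∈ G} / 2 := by
  have hG' : MeasurableSet {ω : (M.Θ × (Fin n → M.X)) × S | (ω.1.2, ω.2) ∈ G} :=
    hG.preimage ((measurable_snd.comp measurable_fst).prodMk measurable_snd)
  set A := {ω : (M.Θ × (Fin n → M.X)) × S |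
      |M.trueAnswer ω.1.1 (q ω.1.2 ω.2) - a ω.1.2 ω.2| < ε} with hAdef
  set G' := {ω : (M.Θ × (Fin n → M.X)) × S | (ω.1.2, ω.2) ∈ G} with hGdef
  -- The inequality is proved for fixed seeds and for each tuple of samples, where the answer is a
  -- constant and only the hypothesis is random.
  have key : ∀ u, 2 * (M.dataLaw n).real ((fun w => (w, u)) ⁻¹' A)
      + (M.dataLaw n).real ((fun w => (w, u)) ⁻¹' G') ≤ 2 := by
    intro u
    have hAu : MeasurableSet ((fun w => (w, u)) ⁻¹' A) := hA.preimage measurable_prodMk_right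
    have hGu : MeasurableSet ((fun w => (w, u)) ⁻¹' G') := hG'.preimage measurable_prodMk_right
    have hone : (∑ x : Fin n → M.X, ∫ θ, M.likelihood x θ ∂M.prior) = 1 := by
      have := M.dataLaw_real_apply n MeasurableSet.univ
      simpa using this.symm
    rw [dataLaw_real_apply _ _ hAu, dataLaw_real_apply _ _ hGu, Finset.mul_sum,
      ← Finset.sum_add_distrib]
    have h2 : (2 : ℝ) = ∑ x : Fin n → M.X, 2 * ∫ θ, M.likelihood x θ ∂M.prior := by
      rw [← Finset.mul_sum, hone, mul_one]
    refine le_of_le_of_eq (Finset.sum_le_sum fun x _ => ?_) h2.symm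
    have hi1 : ∀ {B : Set (M.Θ × (Fin n → M.X))}, MeasurableSet B →
        Integrable (fun θ => M.likelihood x θ * B.indicator (fun _ => (1 : ℝ)) (θ, x)) M.prior :=
      fun {B} hB => M.integrable_likelihood_mul x
        ((measurable_const.indicator hB).comp measurable_prodMk_right) (c := 1) fun θ => by
          by_cases h : (θ, x) ∈ B <;> simp [h]
    have hi0 : Integrable (M.likelihood x) M.prior := by
      have := M.integrable_likelihood_mul x (F := fun _ => 1) measurable_const (c := 1)
        fun _ => by simp
      simpa using this
    by_cases hx : (x, u) ∈ G
    · obtain ⟨τ, hτm, hτl, hτa⟩ := hτ _ hx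
      have hg : ∫ θ, M.likelihood x θ
          * ((fun w => (w, u)) ⁻¹' G').indicator (fun _ => (1 : ℝ)) (θ, x) ∂M.prior
          = ∫ θ, M.likelihood x θ ∂M.prior :=
        integral_congr_ae (Filter.Eventually.of_forall fun θ => by
          have : (θ, x) ∈ (fun w => (w, u)) ⁻¹' G' := hx
          simp [Set.indicator_of_mem this])
      -- As `τ` preserves prior and likelihood, the answer is accurate for `θ` and for `τ θ` with
      -- the same weight.
      have hinv : ∫ θ, M.likelihood x θ
          * ((fun w => (w, u)) ⁻¹' A).indicator (fun _ => (1 : ℝ)) (θ, x) ∂M.prior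
          = ∫ θ, M.likelihood x θ
            * ((fun w => (w, u)) ⁻¹' A).indicator (fun _ => (1 : ℝ)) (τ θ, x) ∂M.prior := by
        have h1 := integral_map (μ := M.prior) hτm.measurable.aemeasurable (f := fun θ =>
          M.likelihood x θ * ((fun w => (w, u)) ⁻¹' A).indicator (fun _ => (1 : ℝ)) (θ, x))
          (by rw [hτm.map_eq]; exact (hi1 hAu).aestronglyMeasurable)
        rw [hτm.map_eq] at h1
        simpa only [hτl] using h1
      have hi2 : Integrable (fun θ => M.likelihood x θ
          * ((fun w => (w, u)) ⁻¹' A).indicator (fun _ => (1 : ℝ)) (τ θ, x)) M.prior := by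
        have := hτm.integrable_comp_of_integrable (hi1 hAu)
        simpa only [Function.comp_def, hτl] using this
      rw [hg, two_mul (∫ θ, M.likelihood x θ ∂M.prior)]
      refine add_le_add_left ?_ _
      rw [two_mul]
      nth_rewrite 2 [hinv]
      rw [← integral_add (hi1 hAu) hi2]
      refine integral_mono ((hi1 hAu).add hi2) hi0 fun θ => ?_
      change M.likelihood x θ * _ + M.likelihood x θ * _ ≤ _
      rw [← mul_add]
      by_cases h0 : M.likelihood x θ = 0
      · simp [h0]
      · refine mul_le_of_le_one_right (M.likelihood_nonneg x θ) ?_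
        by_cases h1 : (θ, x) ∈ (fun w => (w, u)) ⁻¹' A <;>
          by_cases h2 : (τ θ, x) ∈ (fun w => (w, u)) ⁻¹' A
        -- One number cannot be within `ε` of two true answers at distance `2 ε`.
        · exfalso
          have e1 : |M.trueAnswer θ (q x u) - a x u| < ε := h1
          have e2 : |M.trueAnswer (τ θ) (q x u) - a x u| < ε := h2
          have e3 := hτa θ h0
          have e4 := abs_sub_le (M.trueAnswer θ (q x u)) (a x u) (M.trueAnswer (τ θ) (q x u))
          rw [abs_sub_comm (a x u)] at e4
          dsimp only at e3
          linarith
        all_goals simp [h1, h2]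
    · have hg : ∫ θ, M.likelihood x θ
          * ((fun w => (w, u)) ⁻¹' G').indicator (fun _ => (1 : ℝ)) (θ, x) ∂M.prior = 0 := by
        refine (integral_congr_ae (Filter.Eventually.of_forall fun θ => ?_)).trans
          (integral_zero _ _)
        have : (θ, x) ∉ (fun w => (w, u)) ⁻¹' G' := hx
        simp [Set.indicator_of_notMem this]
      rw [hg, add_zero]
      refine mul_le_mul_of_nonneg_left (integral_mono (hi1 hAu) hi0 fun θ => ?_) (by norm_num)
      refine mul_le_of_le_one_right (M.likelihood_nonneg x θ) ?_
      by_cases h1 : (θ, x) ∈ (fun w => (w, u)) ⁻¹' A <;> simp [h1]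
  have h1 : 2 * ((M.dataLaw n).prod ν) A + ((M.dataLaw n).prod ν) G' ≤ 2 := by
    rw [Measure.prod_apply_symm hA, Measure.prod_apply_symm hG',
      ← lintegral_const_mul 2 (measurable_measure_prodMk_right hA),
      ← lintegral_add_left ((measurable_measure_prodMk_right hA).const_mul 2)]
    calc _ ≤ ∫⁻ _, 2 ∂ν := lintegral_mono fun u => by
          have h := ENNReal.ofReal_le_ofReal (key u)
          rw [ENNReal.ofReal_add (by positivity) measureReal_nonneg,
            ENNReal.ofReal_mul (by norm_num), ofReal_measureReal, ofReal_measureReal] at h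
          simpa using h
      _ = 2 := by rw [lintegral_const, measure_univ, mul_one]
  have h2 := ENNReal.toReal_mono (by finiteness) h1
  rw [ENNReal.toReal_add (by finiteness) (by finiteness), ENNReal.toReal_mul] at h2
  have h3 : 2 * ((M.dataLaw n).prod ν).real A + ((M.dataLaw n).prod ν).real G' ≤ 2 := by
    simpa [measureReal_def] using h2
  linarith

/-- For fixed samples the query depends on the seeds only through a countable discrete statistic,
the far bits in the application. Measurability can thus be checked value by value. -/
theorem measurableSet_accurate (M : Model) {n : ℕ} {S κ : Type*} [MeasurableSpace S]
    [MeasurableSpace κ] [DiscreteMeasurableSpace κ] [Countable κ] (q : κ → M.X → ℝ)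
    {k : (Fin n → M.X) → S → κ} (hk : ∀ x, Measurable (k x)) {b : (Fin n → M.X) → S → ℝ}
    (hb : ∀ x, Measurable (b x)) (ε : ℝ) :
    MeasurableSet {ω : (M.Θ × (Fin n → M.X)) × S |
      |M.trueAnswer ω.1.1 (q (k ω.1.2 ω.2)) - b ω.1.2 ω.2| < ε} := by
  have h1 : ∀ x, Measurable fun w : M.Θ × S => M.trueAnswer w.1 (q (k x w.2)) := fun x =>
    Measurable.comp (g := fun v : M.Θ × κ => M.trueAnswer v.1 (q v.2))
      (measurable_from_prod_countable_left fun β => M.measurable_trueAnswer (q β))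
      (measurable_fst.prodMk ((hk x).comp measurable_snd))
  have h2 : Measurable fun v : (Fin n → M.X) × (M.Θ × S) =>
      |M.trueAnswer v.2.1 (q (k v.1 v.2.2)) - b v.1 v.2.2| :=
    measurable_from_prod_countable_right fun x =>
      measurable_norm.comp ((h1 x).sub ((hb x).comp measurable_snd))
  exact measurableSet_lt (Measurable.comp h2 ((measurable_snd.comp measurable_fst).prodMk
    ((measurable_fst.comp measurable_fst).prodMk measurable_snd))) measurable_const

variable {m : ℕ} [NeZero m] {C : Submodule (ZMod 2) (Fin m → ZMod 2)} {Q n : ℕ}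

section

variable {S : Type*} [MeasurableSpace S] (μ : Measure S) [IsProbabilityMeasure μ]
  {r : ℝ → S → ℝ}

variable (r) in
/-- The codes and rounds in which some estimate is not reliable. -/
def unreliable (sched : Fin Q → Target C) (a : ℝ) :
    Set ((Fin m → CodeData C n) × (Fin Q → (CoinData n × CoinData n) × S)) :=
  {v | ∃ i, ∃ j : {j : Fin m // Live C j}, ¬ Reliable (v.1 i).2 j
    (estimate sched a (roundBits r sched v.1 v.2) i j)}

theorem measurable_roundBits (hr : ∀ a, Measurable (r a)) (sched : Fin Q → Target C)
    (y : Fin m → CodeData C n) : Measurable (roundBits r sched y) := by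
  refine measurable_pi_lambda _ fun t => ?_
  exact Measurable.comp (g := fun w : (CoinData n × CoinData n) × S => isFar
    (response r m n (symbolProb (y (sched t).1).2 (sched t).2.1 (sched t).2.2) w))
    (measurable_isFar.comp (measurable_response m n hr _)) (measurable_pi_apply t)

theorem measurableSet_unreliable (hr : ∀ a, Measurable (r a)) (sched : Fin Q → Target C) (a : ℝ) :
    MeasurableSet (unreliable (n := n) r sched a) := by
  refine measurableSet_setOfPred.2 (measurable_from_prod_countable_right fun y => ?_)
  refine Measurable.comp (g := fun β : Fin Q → Bool => ∃ i, ∃ j : {j : Fin m // Live C j},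
    ¬ Reliable (y i).2 j (estimate sched a β i j)) Measurable.of_discrete ?_
  exact measurable_roundBits hr sched y

/-- A union bound over the `m` factors and their at most `m` live positions, for fixed codes. -/
theorem unreliable_le (hr : ∀ a, Measurable (r a)) (sched : Fin Q → Target C) {R : ℕ}
    (hR : ∀ v, (Finset.univ.filter fun t => sched t = v).card = R) {τ : ℝ} (hτ : 0 ≤ τ)
    (hgap : 2 * τ ≤ farProb μ r m n 1 - farProb μ r m n 0) :
    ((codesLaw C n).prod (roundsLaw μ n Q)).real (unreliable r sched (τ * R))
      ≤ 2 * m ^ 2 * Real.exp (-τ ^ 2 * R) := by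
  classical
  refine (measureReal_prod_le_of_section _ _ (measurableSet_unreliable hr sched _)
    (B := Set.univ) MeasurableSet.univ (c := 2 * m ^ 2 * Real.exp (-τ ^ 2 * R))
    (by positivity) ?_).trans_eq (by simp)
  filter_upwards [ae_codesLaw_consistent (C := C) (n := n)] with y hy _
  have hsub : {z | (y, z) ∈ unreliable r sched (τ * R)}
      ⊆ ⋃ p ∈ (Finset.univ : Finset (Fin m × {j : Fin m // Live C j})),
        {z | ¬ Reliable (y p.1).2 p.2
          (estimate sched (τ * R) (roundBits r sched y z) p.1 p.2)} := by
    rintro z ⟨i, j, h⟩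
    exact Set.mem_biUnion (x := (i, j)) (Finset.mem_univ _) h
  refine (measureReal_mono hsub (measure_ne_top _ _)).trans ((measureReal_biUnion_finset_le _ _).trans ?_)
  refine (Finset.sum_le_sum fun p _ => estimate_unreliable_le μ hr sched hR hτ hgap p.1 p.2 y
    (hy p.1)).trans ?_
  rw [Finset.sum_const, nsmul_eq_mul, Finset.card_univ, Fintype.card_prod, Fintype.card_fin]
  have h1 : (Fintype.card {j : Fin m // Live C j} : ℝ) ≤ m := by
    have := Fintype.card_subtype_le (Live C)
    rw [Fintype.card_fin] at this
    exact_mod_cast this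
  push_cast
  have h2 : (m : ℝ) * (Fintype.card {j : Fin m // Live C j} : ℝ) ≤ m * m :=
    mul_le_mul_of_nonneg_left h1 (Nat.cast_nonneg m)
  calc _ ≤ (m : ℝ) * m * (2 * Real.exp (-τ ^ 2 * R)) :=
        mul_le_mul_of_nonneg_right h2 (by positivity)
    _ = _ := by ring

/-- The factors are independent. This is why the model takes `m` copies: a chance of order `1/m` in
each becomes a constant chance overall. -/
theorem codesLaw_not_ambiguous :
    (codesLaw C n).real {y | ∀ i, ¬ Ambiguous C fun l => pos ((y i).2 l)}
      = (1 - ((ofCode C).dataLaw n).real {z | Ambiguous C fun l => pos (z.2 l)}) ^ m := by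
  have h := pi_real_forall_mem (ι := Fin m) ((ofCode C).dataLaw n) Finset.univ
    {z | Ambiguous C fun l => pos (z.2 l)}ᶜ
  rw [probReal_compl_eq_one_sub MeasurableSet.of_discrete, Finset.card_univ,
    Fintype.card_fin] at h
  rw [← h]
  congr 1
  ext y
  simp

end

section Curator

variable {K : Curator (hard C Q) n} {i₀ i₁ : Fin m} {sched : Fin Q → Target C} {a : ℝ}
  {hP : ∀ t x, probes (weight m n) i₀ i₁ sched t x ∈ Set.Icc (0 : ℝ) 1}
  {hF : ∀ β x, finalQuery Q (estimate sched a β) x ∈ Set.Icc (0 : ℝ) 1}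
  {r : ℝ → K.Seed → ℝ}

/-- The samples and seeds for which estimates are reliable and some factor is ambiguous. -/
def decisive (P : Fin Q → (hard C Q).X → ℝ) (r : ℝ → K.Seed → ℝ) (sched : Fin Q → Target C)
    (a : ℝ) : Set ((Fin n → (hard C Q).X) × (Fin (Q + 1) → K.Seed)) :=
  {p | Possible p.1 ∧ (∀ i, ∀ j : {j : Fin m // Live C j}, Reliable (fun l => smpCode (p.1 l) i) j
      (estimate sched a (farBits P r p.1 (Fin.init p.2)) i j)) ∧
    ∃ i, Ambiguous C fun l => pos (smpCode (p.1 l) i)}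

theorem measurable_farBits_init
    (hK : K.Responds (probingAnalyst _ (fun β => finalQuery Q (estimate sched a β)) hP hF)
      (probes (weight m n) i₀ i₁ sched) r) (x : Fin n → (hard C Q).X) :
    Measurable fun u : Fin (Q + 1) → K.Seed =>
      farBits (probes (weight m n) i₀ i₁ sched) r x (Fin.init u) :=
  (measurable_farBits hK x).comp (measurePreserving_init K.seedLaw Q).measurable

theorem measurableSet_decisive
    (hK : K.Responds (probingAnalyst _ (fun β => finalQuery Q (estimate sched a β)) hP hF)
      (probes (weight m n) i₀ i₁ sched) r) :
    MeasurableSet (decisive (probes (weight m n) i₀ i₁ sched) r sched a) := by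
  refine measurableSet_setOfPred.2 (measurable_from_prod_countable_right fun x => ?_)
  exact Measurable.comp (g := fun β : Fin Q → Bool => Possible x ∧
    (∀ i, ∀ j : {j : Fin m // Live C j}, Reliable (fun l => smpCode (x l) i) j
      (estimate sched a β i j)) ∧ ∃ i, Ambiguous C fun l => pos (smpCode (x l) i))
    Measurable.of_discrete (measurable_farBits_init hK x)

/-- Almost surely the samples are possible, and then the bits seen by the analyst are those of the
independent rounds. The good event fails only if an estimate is unreliable or no factor is
ambiguous. -/
theorem decisive_ge (h : i₀ ≠ i₁)
    (hK : K.Responds (probingAnalyst _ (fun β => finalQuery Q (estimate sched a β)) hP hF)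
      (probes (weight m n) i₀ i₁ sched) r) :
    1 - ((codesLaw C n).prod (roundsLaw K.seedLaw n Q)).real (unreliable r sched a)
        - (1 - ((ofCode C).dataLaw n).real {z | Ambiguous C fun l => pos (z.2 l)}) ^ m
      ≤ (((hard C Q).dataLaw n).prod (Measure.pi fun _ : Fin (Q + 1) => K.seedLaw)).real
        {ω | (ω.1.2, ω.2) ∈ decisive (probes (weight m n) i₀ i₁ sched) r sched a} := by
  have hr := hK.measurable_response
  have hmp := measurePreserving_rounds' (C := C) (Q := Q) (n := n) K.seedLaw h
  have hE2 : MeasurableSet {v : (Fin m → CodeData C n) ×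
      (Fin Q → (CoinData n × CoinData n) × K.Seed) |
      ∀ i, ¬ Ambiguous C fun l => pos ((v.1 i).2 l)} :=
    MeasurableSet.preimage (t := {y : Fin m → CodeData C n |
      ∀ i, ¬ Ambiguous C fun l => pos ((y i).2 l)}) MeasurableSet.of_discrete measurable_fst
  have h2 : ((codesLaw C n).prod (roundsLaw K.seedLaw n Q)).real
      {v | ∀ i, ¬ Ambiguous C fun l => pos ((v.1 i).2 l)}
      = (1 - ((ofCode C).dataLaw n).real {z | Ambiguous C fun l => pos (z.2 l)}) ^ m := by
    rw [← codesLaw_not_ambiguous]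
    exact congrArg ENNReal.toReal ((measurePreserving_fst (μ := codesLaw C n)
      (ν := roundsLaw K.seedLaw n Q)).measure_preimage
      (MeasurableSet.of_discrete (s := {y : Fin m → CodeData C n |
        ∀ i, ¬ Ambiguous C fun l => pos ((y i).2 l)})).nullMeasurableSet)
  have h1 := measurableSet_unreliable (n := n) hr sched a
  have h3 : (((hard C Q).dataLaw n).prod (Measure.pi fun _ : Fin (Q + 1) => K.seedLaw)).real
        {ω | (ω.1.2, ω.2) ∈ decisive (probes (weight m n) i₀ i₁ sched) r sched a}ᶜ
      ≤ ((codesLaw C n).prod (roundsLaw K.seedLaw n Q)).real (unreliable r sched a ∪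
        {v | ∀ i, ¬ Ambiguous C fun l => pos ((v.1 i).2 l)}) := by
    rw [measureReal_def, measureReal_def, ← hmp.measure_preimage (h1.union hE2).nullMeasurableSet]
    refine ENNReal.toReal_mono (measure_ne_top _ _) (measure_mono_ae ?_)
    filter_upwards [ae_rounds_consistent (C := C) (Q := Q) (n := n) K.seedLaw h] with ω hω hωc
    have hp : Possible ω.1.2 := fun i => ⟨_, hω i⟩
    have hbits : farBits (probes (weight m n) i₀ i₁ sched) r ω.1.2 (Fin.init ω.2)
        = roundBits r sched (rounds i₀ i₁ ω).1 (rounds i₀ i₁ ω).2 :=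
      funext fun t => congrArg isFar (response_probes h sched hp t)
    by_contra hnot
    refine hωc ⟨hp, fun i j => ?_, ?_⟩
    · by_contra hrel
      refine hnot (.inl ⟨i, j, ?_⟩)
      rw [← hbits]
      exact hrel
    · by_contra hamb
      exact hnot (.inr fun i hi => hamb ⟨i, hi⟩)
  have hd : MeasurableSet {ω : ((hard C Q).Θ × (Fin n → (hard C Q).X)) × (Fin (Q + 1) → K.Seed) |
      (ω.1.2, ω.2) ∈ decisive (probes (weight m n) i₀ i₁ sched) r sched a} :=
    (measurableSet_decisive hK).preimage
      ((measurable_snd.comp measurable_fst).prodMk measurable_snd)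
  rw [probReal_compl_eq_one_sub hd] at h3
  have h4 := h3.trans (measureReal_union_le _ _)
  rw [h2] at h4
  linarith

/-- If the responses to the two symbols are far apart, then the last answer is inaccurate. -/
theorem accurateProb_le_of_gap (h : i₀ ≠ i₁)
    (hK : K.Responds (probingAnalyst _ (fun β => finalQuery Q (estimate sched a β)) hP hF)
      (probes (weight m n) i₀ i₁ sched) r)
    (hlast : ∀ x, Measurable (lastAnswer
      (probingAnalyst _ (fun β => finalQuery Q (estimate sched a β)) hP hF) K
      (fun β => finalQuery Q (estimate sched a β))
      (farBits (probes (weight m n) i₀ i₁ sched) r) x))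
    (hC : ∀ c ∈ C, ∀ c' ∈ C, c ≠ c' → m ≤ 10 * hammingDist c c') :
    accurateProb (probingAnalyst _ (fun β => finalQuery Q (estimate sched a β)) hP hF) K (Q + 1)
        (1 / 40) ≤ 1 - (1 - ((codesLaw C n).prod (roundsLaw K.seedLaw n Q)).real
          (unreliable r sched a)
        - (1 - ((ofCode C).dataLaw n).real {z | Ambiguous C fun l => pos (z.2 l)}) ^ m) / 2 := by
  have hA := measurableSet_accurate (hard C Q) (fun β => finalQuery Q (estimate sched a β))
    (measurable_farBits_init hK) hlast (1 / 40)
  have hG := measurableSet_decisive hK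
  have key := accurate_real_le_half (hard C Q) (Measure.pi fun _ : Fin (Q + 1) => K.seedLaw)
    (fun x u => finalQuery Q (estimate sched a
      (farBits (probes (weight m n) i₀ i₁ sched) r x (Fin.init u))))
    (lastAnswer (probingAnalyst _ (fun β => finalQuery Q (estimate sched a β)) hP hF) K
      (fun β => finalQuery Q (estimate sched a β))
      (farBits (probes (weight m n) i₀ i₁ sched) r)) (ε := 1 / 40) hA hG fun p hp => by
        obtain ⟨hp, hrel, hamb⟩ := hp
        obtain ⟨τ, h1, h2, h3⟩ := exists_swap hC hp hrel hamb
        -- The gap 1/10 exceeds the required `2 * (1/40)`.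
        exact ⟨τ, h1, h2, fun θ hθ => le_trans (by norm_num) (h3 θ hθ)⟩
  have h5 := (accurateProb_le_last hK (1 / 40)).trans key
  have h6 := decisive_ge h hK
  linarith

end Curator

end Model

end BayesADA

end

/-! ### Combining the two cases into one strategy -/

noncomputable section

namespace BayesADA

namespace Model

variable {m : ℕ} [NeZero m] {C : Submodule (ZMod 2) (Fin m → ZMod 2)} {Q n : ℕ}

section

variable {K : Curator (hard C Q) n} {i₀ i₁ : Fin m} {sched : Fin Q → Target C} {R : ℕ}
  {hP : ∀ t x, probes (weight m n) i₀ i₁ sched t x ∈ Set.Icc (0 : ℝ) 1}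
  {hF : ∀ β x, finalQuery Q (estimate sched (1 / (4 * (8 * n + 1)) * R) β) x ∈ Set.Icc (0 : ℝ) 1}
  {r : ℝ → K.Seed → ℝ}

/-- The dichotomy for a single probe decides which queries hurt this curator: a large gap makes the
final query fail, and frequent errors make some probe fail. -/
theorem accurateProb_le_of_responds (hm : 20 ≤ m) (hmn : m ≤ 4 * n) (h : i₀ ≠ i₁)
    (hK : K.Responds (probingAnalyst _
      (fun β => finalQuery Q (estimate sched (1 / (4 * (8 * n + 1)) * R) β)) hP hF)
      (probes (weight m n) i₀ i₁ sched) r)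
    (hlast : ∀ x, Measurable (lastAnswer (probingAnalyst _
      (fun β => finalQuery Q (estimate sched (1 / (4 * (8 * n + 1)) * R) β)) hP hF) K
      (fun β => finalQuery Q (estimate sched (1 / (4 * (8 * n + 1)) * R) β))
      (farBits (probes (weight m n) i₀ i₁ sched) r) x))
    (hC : ∀ c ∈ C, ∀ c' ∈ C, c ≠ c' → m ≤ 10 * hammingDist c c')
    (hR : ∀ v, (Finset.univ.filter fun t => sched t = v).card = R)
    (hn : (8 * n + 1) * (19 / 20 : ℝ) ^ (8 * n) ≤ 1 / 30)
    (hR1 : 90 * (8 * n + 1) ≤ R)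
    (hR2 : 2 * m ^ 2 * Real.exp (-(1 / (4 * (8 * n + 1))) ^ 2 * R) ≤ (1 / 100 : ℝ))
    (hamb : 1 / (40 * m : ℝ)
      ≤ ((ofCode C).dataLaw n).real {z | Ambiguous C fun l => pos (z.2 l)}) :
    accurateProb (probingAnalyst _
      (fun β => finalQuery Q (estimate sched (1 / (4 * (8 * n + 1)) * R) β)) hP hF) K (Q + 1)
        (1 / 40) ≤ 1 - 1 / 200 := by
  have hm0 : (0 : ℝ) < m := by exact_mod_cast NeZero.pos m
  have hN : (0 : ℝ) < 8 * n + 1 := by positivity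
  rcases farProb_gap_or_errorProb K.seedLaw m n hm hK.measurable_response hn with hgap | ⟨e, he, herr⟩
  · have h1 := accurateProb_le_of_gap h hK hlast hC
    have h2 := unreliable_le (C := C) K.seedLaw hK.measurable_response sched hR
      (τ := 1 / (4 * (8 * n + 1))) (by positivity) (by
        refine le_trans (le_of_eq ?_) hgap
        field_simp
        norm_num)
    -- No factor is ambiguous with probability at most `exp (-1/40)`. Since `(1 - 1/100 - 40/41) / 2
    -- > 1/200`, the loss suffices.
    have h3 : (1 - ((ofCode C).dataLaw n).real {z | Ambiguous C fun l => pos (z.2 l)}) ^ m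
        ≤ 40 / 41 := by
      have h4 : 1 - ((ofCode C).dataLaw n).real {z | Ambiguous C fun l => pos (z.2 l)}
          ≤ Real.exp (-(1 / (40 * m : ℝ))) :=
        (sub_le_sub_left hamb 1).trans (Real.one_sub_le_exp_neg _)
      refine (pow_le_pow_left₀ (sub_nonneg.2 measureReal_le_one) h4 m).trans ?_
      rw [← Real.exp_nat_mul]
      have e : (m : ℝ) * -(1 / (40 * m)) = -(1 / 40) := by field_simp
      rw [e, Real.exp_neg, inv_le_comm₀ (Real.exp_pos _) (by norm_num)]
      exact le_trans (by norm_num) (Real.add_one_le_exp _)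
    have h4 := h2.trans hR2
    linarith
  -- A live position exists because ambiguity has positive probability and provides a nonzero
  -- codeword.
  · obtain ⟨j⟩ : Nonempty {j : Fin m // Live C j} := by
      have h0 : 0 < ((ofCode C).dataLaw n).real {z | Ambiguous C fun l => pos (z.2 l)} :=
        lt_of_lt_of_le (by positivity) hamb
      obtain ⟨z, w, hw, hw0, -⟩ : {z : CodeData C n | Ambiguous C fun l => pos (z.2 l)}.Nonempty :=
        Set.nonempty_iff_ne_empty.2 fun h' => by
          rw [h', measureReal_empty] at h0
          exact lt_irrefl _ h0
      obtain ⟨j, hj⟩ := Function.ne_iff.1 hw0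
      exact ⟨⟨j, w, hw, hj⟩⟩
    refine (accurateProb_le_first hK _).trans ((accurate_probes_le K.seedLaw h
      hK.measurable_response sched i₀ j (fun s => (hR _).ge) (1 / 40) he).trans ?_)
    have h1 : (1 - 1 / (m : ℝ)) ^ n ≤ 4 / 5 := by
      have h2 : 1 - 1 / (m : ℝ) ≤ Real.exp (-(1 / m)) := Real.one_sub_le_exp_neg _
      have h3 : 0 ≤ 1 - 1 / (m : ℝ) := by
        rw [sub_nonneg, div_le_one hm0]
        exact_mod_cast NeZero.pos m
      refine (pow_le_pow_left₀ h3 h2 n).trans ?_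
      rw [← Real.exp_nat_mul]
      have h4 : (n : ℝ) * -(1 / m) ≤ -(1 / 4) := by
        have h5 : (m : ℝ) ≤ 4 * n := by exact_mod_cast hmn
        rw [mul_neg, neg_le_neg_iff, mul_one_div, le_div_iff₀ hm0]
        linarith
      refine (Real.exp_le_exp.2 h4).trans ?_
      rw [Real.exp_neg, inv_le_comm₀ (Real.exp_pos _) (by norm_num)]
      exact le_trans (by norm_num) (Real.add_one_le_exp _)
    -- The choice `R ≥ 90 (8n + 1)` gives at least three expected errors, hence `exp (-3) ≤ 1/10`.
    -- Together with the 4/5 for an unseen position this totals 9/10.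
    have h2 : (1 - errorProb K.seedLaw r m n (1 / 40) e) ^ R ≤ 1 / 10 := by
      have h3 : 1 - errorProb K.seedLaw r m n (1 / 40) e
          ≤ Real.exp (-(1 / (30 * (8 * n + 1)))) :=
        (sub_le_sub_left herr 1).trans (Real.one_sub_le_exp_neg _)
      refine (pow_le_pow_left₀ (sub_nonneg.2 measureReal_le_one) h3 R).trans ?_
      rw [← Real.exp_nat_mul]
      have h4 : (R : ℝ) * -(1 / (30 * (8 * n + 1))) ≤ -3 := by
        have h5 : (90 * (8 * n + 1) : ℝ) ≤ R := by exact_mod_cast hR1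
        rw [mul_neg, neg_le_neg_iff, mul_one_div, le_div_iff₀ (by positivity)]
        linarith
      refine (Real.exp_le_exp.2 h4).trans ?_
      rw [Real.exp_neg, inv_le_comm₀ (Real.exp_pos _) (by norm_num)]
      have h6 : Real.exp 3 = Real.exp 1 ^ 3 := by
        rw [← Real.exp_nat_mul]
        norm_num
      rw [h6]
      have h7 : (2.5 : ℝ) ≤ Real.exp 1 := by linarith [Real.exp_one_gt_d9]
      exact le_trans (by norm_num) (pow_le_pow_left₀ (by norm_num) h7 3)
    linarith

end

/-- Probing every symbol `R` times and then separating two codewords defeats both curators. -/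
theorem oneStrategyDefeats_hard (hm : 20 ≤ m) (hmn : m ≤ 4 * n) {R : ℕ} (sched : Fin Q → Target C)
    (hC : ∀ c ∈ C, ∀ c' ∈ C, c ≠ c' → m ≤ 10 * hammingDist c c')
    (hR : ∀ v, (Finset.univ.filter fun t => sched t = v).card = R)
    (hn : (8 * n + 1) * (19 / 20 : ℝ) ^ (8 * n) ≤ 1 / 30)
    (hR1 : 90 * (8 * n + 1) ≤ R)
    (hR2 : 2 * m ^ 2 * Real.exp (-(1 / (4 * (8 * n + 1))) ^ 2 * R) ≤ (1 / 100 : ℝ))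
    (hamb : 1 / (40 * m : ℝ)
      ≤ ((ofCode C).dataLaw n).real {z | Ambiguous C fun l => pos (z.2 l)}) :
    OneStrategyDefeats (hard C Q) n (Q + 1) (1 / 40) (1 / 200) := by
  obtain ⟨i₀, i₁, h⟩ : ∃ i₀ i₁ : Fin m, i₀ ≠ i₁ :=
    ⟨⟨0, by omega⟩, ⟨1, by omega⟩, by simp⟩
  obtain ⟨ν, hν⟩ := exists_priorLaw_probes (weight m n) h sched
  have hP : ∀ t x, probes (weight m n) i₀ i₁ sched t x ∈ Set.Icc (0 : ℝ) 1 := fun t x =>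
    probe_mem (weight_nonneg m n) (weight_le_one hmn) _ _ _ _ _ _ x
  have hF : ∀ β x, finalQuery Q (estimate sched (1 / (4 * (8 * n + 1)) * R) β) x
      ∈ Set.Icc (0 : ℝ) 1 := fun β x => finalQuery_mem _ x
  refine ⟨probingAnalyst (probes (weight m n) i₀ i₁ sched)
    (fun β => finalQuery Q (estimate sched (1 / (4 * (8 * n + 1)) * R) β)) hP hF,
    fun G => ⟨?_, fun η T noise hnoise _ => ?_⟩⟩
  · exact accurateProb_le_of_responds hm hmn h (obfuscated_responds hν G)
      (obfuscated_measurable_last hν G) hC hR hn hR1 hR2 hamb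
  · exact accurateProb_le_of_responds hm hmn h (pmw_responds h hν G η T noise hnoise)
      (pmw_measurable_last h hν G η T noise hnoise) hC hR hn hR1 hR2 hamb

/-- A schedule in which every target occurs `R` times. -/
theorem exists_schedule (C : Submodule (ZMod 2) (Fin m → ZMod 2)) (R : ℕ) :
    ∃ (Q : ℕ) (sched : Fin Q → Target C), Q ≤ 2 * m ^ 2 * R ∧
      ∀ v, (Finset.univ.filter fun t => sched t = v).card = R := by
  classical
  let e := Fintype.equivFin (Target C × Fin R)
  refine ⟨Fintype.card (Target C × Fin R), fun t => (e.symm t).1, ?_, fun v => ?_⟩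
  · have h1 : Fintype.card {j : Fin m // Live C j} ≤ m := by
      simpa using Fintype.card_subtype_le (Live C)
    rw [Fintype.card_prod, Fintype.card_prod, Fintype.card_prod, Fintype.card_fin,
      Fintype.card_fin, ZMod.card]
    calc m * (Fintype.card {j : Fin m // Live C j} * 2) * R ≤ m * (m * 2) * R := by gcongr
      _ = _ := by ring
  · have h1 : (Finset.univ.filter fun t => (e.symm t).1 = v)
        = (Finset.univ : Finset (Fin R)).map
          ⟨fun k => e (v, k), fun k k' h => (Prod.ext_iff.1 (e.injective h)).2⟩ := by
      ext t
      simp only [Finset.mem_filter, Finset.mem_univ, true_and, Finset.mem_map]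
      constructor
      · rintro rfl
        exact ⟨(e.symm t).2, e.apply_symm_apply t⟩
      · rintro ⟨k, rfl⟩
        exact congrArg Prod.fst (e.symm_apply_apply (v, k))
    rw [h1, Finset.card_map, Finset.card_univ, Fintype.card_fin]

end Model

end BayesADA

end

/-! ### The numerical choice of the number of repetitions -/

noncomputable section

namespace BayesADA

theorem mul_pow_le_of_large {n : ℕ} (hn : 3200 ≤ n) :
    (8 * n + 1) * (19 / 20 : ℝ) ^ (8 * n) ≤ 1 / 30 := by
  have hn' : (3200 : ℝ) ≤ n := by exact_mod_cast hn
  have h1 : (19 / 20 : ℝ) ^ (8 * n) ≤ Real.exp (-(2 / 5 * n)) := by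
    have h2 : (19 / 20 : ℝ) ≤ Real.exp (-(1 / 20)) :=
      le_trans (by norm_num) (Real.one_sub_le_exp_neg _)
    refine (pow_le_pow_left₀ (by norm_num) h2 _).trans_eq ?_
    rw [← Real.exp_nat_mul]
    congr 1
    push_cast
    ring
  refine (mul_le_mul_of_nonneg_left h1 (by positivity)).trans ?_
  rw [Real.exp_neg, ← div_eq_mul_inv, div_le_iff₀ (Real.exp_pos _)]
  have h3 := Real.quadratic_le_exp_of_nonneg (x := 2 / 5 * n) (by positivity)
  nlinarith

namespace Model

open Classical in
/-- If the samples are ambiguous often enough, some strategy with `O(n⁴ log n)` queries defeats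
both curators. -/
theorem exists_oneStrategyDefeats {n m : ℕ} [NeZero m] {C : Submodule (ZMod 2) (Fin m → ZMod 2)}
    (hn : 3200 ≤ n) (hmn : m ≤ 4 * n) (hnm : n ≤ 20 * m)
    (hC : ∀ c ∈ C, ∀ c' ∈ C, c ≠ c' → m ≤ 10 * hammingDist c c')
    (hamb : (m : ℝ) ^ n ≤ 40 * m * (Finset.univ.filter fun p : Fin n → Fin m =>
      Ambiguous C p).card) :
    ∃ q : ℕ, (q : ℝ) ≤ 130000 * (n : ℝ) ^ 4 * Real.log n ∧
      OneStrategyDefeats (hardModel C q) n q (1 / 40) (1 / 200) := by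
  have hn' : (3200 : ℝ) ≤ n := by exact_mod_cast hn
  have hmn' : (m : ℝ) ≤ 4 * n := by exact_mod_cast hmn
  have hm : (0 : ℝ) < m := by exact_mod_cast NeZero.pos m
  have hlog : 1 ≤ Real.log n := by
    rw [Real.le_log_iff_exp_le (by linarith)]
    linarith [Real.exp_one_lt_d9]
  -- With `τ = 1 / (4 (8n + 1))` the Hoeffding exponent `τ² R` is at least `3 log n`, so each
  -- estimate fails with probability at most `2 / n³`, enough for a union bound over `m² ≤ 16 n²`
  -- symbols.
  set R : ℕ := ⌈48 * (8 * n + 1 : ℝ) ^ 2 * Real.log n⌉₊ with hRdef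
  have hR : 48 * (8 * n + 1 : ℝ) ^ 2 * Real.log n ≤ R := Nat.le_ceil _
  have hR' : (R : ℝ) ≤ 48 * (8 * n + 1 : ℝ) ^ 2 * Real.log n + 1 :=
    (Nat.ceil_lt_add_one (by positivity)).le
  obtain ⟨Q, sched, hQ, hsched⟩ := exists_schedule C R
  refine ⟨Q + 1, ?_, ?_⟩
  · have hQ' : (Q : ℝ) ≤ 2 * m ^ 2 * R := by exact_mod_cast hQ
    have h1 : (m : ℝ) ^ 2 ≤ 16 * n ^ 2 := by nlinarith
    have h2 : (8 * n + 1 : ℝ) ^ 2 ≤ 81 * n ^ 2 := by nlinarith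
    have h3 : (R : ℝ) ≤ 3889 * n ^ 2 * Real.log n := by
      have h4 : 48 * (8 * n + 1 : ℝ) ^ 2 * Real.log n ≤ 48 * (81 * n ^ 2) * Real.log n := by
        gcongr
      have h5 : (1 : ℝ) ≤ n ^ 2 * Real.log n := by nlinarith
      linarith
    have h6 : 2 * (m : ℝ) ^ 2 * R ≤ 2 * (16 * n ^ 2) * (3889 * n ^ 2 * Real.log n) := by gcongr
    have h7 : (1 : ℝ) ≤ n ^ 4 * Real.log n :=
      one_le_mul_of_one_le_of_one_le (one_le_pow₀ (by linarith)) hlog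
    push_cast
    linarith
  · rw [hardModel_eq]
    refine oneStrategyDefeats_hard (by omega) hmn sched hC hsched (mul_pow_le_of_large hn) ?_ ?_ ?_
    · have h1 : (90 * (8 * n + 1) : ℝ) ≤ 48 * (8 * n + 1 : ℝ) ^ 2 * Real.log n := by
        have h2 : 48 * (8 * n + 1 : ℝ) ^ 2 * 1 ≤ 48 * (8 * n + 1 : ℝ) ^ 2 * Real.log n := by gcongr
        nlinarith
      exact_mod_cast h1.trans hR
    · have h1 : -(1 / (4 * (8 * n + 1 : ℝ))) ^ 2 * R ≤ -(3 * Real.log n) := by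
        have h2 := mul_le_mul_of_nonneg_left hR (by positivity :
          (0 : ℝ) ≤ (1 / (4 * (8 * n + 1 : ℝ))) ^ 2)
        have h3 : (1 / (4 * (8 * n + 1 : ℝ))) ^ 2 * (48 * (8 * n + 1 : ℝ) ^ 2 * Real.log n)
            = 3 * Real.log n := by
          field_simp
          norm_num
        linarith
      have h4 : Real.exp (-(3 * Real.log n)) = 1 / (n : ℝ) ^ 3 := by
        rw [Real.exp_neg, mul_comm, Real.exp_mul, Real.exp_log (by linarith), one_div]
        norm_cast
      have h5 : 2 * (m : ℝ) ^ 2 ≤ 32 * n ^ 2 := by nlinarith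
      calc _ ≤ 32 * (n : ℝ) ^ 2 * (1 / (n : ℝ) ^ 3) :=
            mul_le_mul h5 ((Real.exp_le_exp.2 h1).trans_eq h4) (Real.exp_pos _).le (by positivity)
        _ = 32 / n := by field_simp
        _ ≤ 1 / 100 := by
          rw [div_le_div_iff₀ (by linarith) (by norm_num)]
          linarith
    · rw [dataLaw_ofCode_pos n (Ambiguous C), one_div_pow, div_mul_eq_mul_div, one_mul,
        div_le_div_iff₀ (by positivity) (by positivity), one_mul, mul_comm]
      linarith

end Model

end BayesADA

end

/-! ### Counting ambiguous tuples for a fixed good code -/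

noncomputable section

namespace BayesADA

/-- Some nonzero codeword vanishes at the given positions. -/
def Degenerate {m n : ℕ} (C : Submodule (ZMod 2) (Fin m → ZMod 2)) (p : Fin n → Fin m) : Prop :=
  ∃ v ∈ C, v ≠ 0 ∧ ∀ l, v (p l) = 0

open Classical in
/-- The number of degenerate tuples of positions. -/
def degenerateCount {m : ℕ} (C : Submodule (ZMod 2) (Fin m → ZMod 2)) (n : ℕ) : ℕ :=
  (Finset.univ.filter fun p : Fin n → Fin m => Degenerate C p).card

open Classical in
/-- The number of ambiguous tuples of positions. -/
def ambiguousCount {m : ℕ} (C : Submodule (ZMod 2) (Fin m → ZMod 2)) (n : ℕ) : ℕ :=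
  (Finset.univ.filter fun p : Fin n → Fin m => Ambiguous C p).card

section

variable {m n : ℕ} {C : Submodule (ZMod 2) (Fin m → ZMod 2)}

/-- Evaluation at `j` is injective on the codewords vanishing at `p`, so these form a space of
dimension at most one over the field of two elements. Degeneracy of `p` makes it exactly one. -/
theorem ambiguous_of_degenerate_cons {p : Fin n → Fin m} (hp : Degenerate C p) {j : Fin m}
    (hj : ¬ Degenerate C (Fin.cons j p : Fin (n + 1) → Fin m)) : Ambiguous C p := by
  have key : ∀ v ∈ C, (∀ l, v (p l) = 0) → v j = 0 → v = 0 := fun v hv hvp hvj => by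
    by_contra h0
    exact hj ⟨v, hv, h0, Fin.cases hvj hvp⟩
  obtain ⟨w, hw, hw0, hwp⟩ := hp
  refine ⟨w, hw, hw0, hwp, fun v hv hvp => ?_⟩
  by_contra! h
  have h1 : ∀ {u : Fin m → ZMod 2}, u ∈ C → u ≠ 0 → (∀ l, u (p l) = 0) → u j = 1 :=
    fun {u} hu hu0 hup => by
      have : u j ≠ 0 := fun h => hu0 (key u hu hup h)
      generalize u j = a at this
      revert a
      decide
  refine h.2 (sub_eq_zero.1 (key (v - w) (C.sub_mem hv hw) (fun l => ?_) ?_))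
  · rw [Pi.sub_apply, hvp, hwp, sub_zero]
  · rw [Pi.sub_apply, h1 hv h.1 hvp, h1 hw hw0 hwp, sub_self]

/-- A tuple which becomes nondegenerate by a further position is ambiguous. -/
theorem mul_degenerateCount_le :
    m * degenerateCount C n ≤ degenerateCount C (n + 1) + m * ambiguousCount C n := by
  classical
  have h1 : m * degenerateCount C n = ((Finset.univ : Finset (Fin m)) ×ˢ
      (Finset.univ.filter fun p : Fin n → Fin m => Degenerate C p)).card := by
    rw [Finset.card_product, Finset.card_univ, Fintype.card_fin, degenerateCount]
  have h2 : m * ambiguousCount C n = ((Finset.univ : Finset (Fin m)) ×ˢ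
      (Finset.univ.filter fun p : Fin n → Fin m => Ambiguous C p)).card := by
    rw [Finset.card_product, Finset.card_univ, Fintype.card_fin, ambiguousCount]
  rw [h1, h2, ← Finset.card_filter_add_card_filter_not
    (fun x : Fin m × (Fin n → Fin m) => Degenerate C (Fin.cons x.1 x.2 : Fin (n + 1) → Fin m))]
  refine add_le_add ?_ ?_
  · refine Finset.card_le_card_of_injOn (fun x => (Fin.cons x.1 x.2 : Fin (n + 1) → Fin m))
      (fun x hx => ?_) fun x _ x' _ h => ?_
    · simp only [Finset.coe_filter, Finset.mem_univ, true_and, Set.mem_ofPred_eq]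
      exact (Finset.mem_filter.1 hx).2
    · exact Prod.ext (Fin.cons_inj.1 h).1 (Fin.cons_inj.1 h).2
  · refine Finset.card_le_card fun x hx => ?_
    obtain ⟨hx1, hx2⟩ := Finset.mem_filter.1 hx
    simp only [Finset.mem_product, Finset.mem_univ, true_and, Finset.mem_filter] at hx1 ⊢
    exact ambiguous_of_degenerate_cons hx1 hx2

theorem card_vanishing (c : Fin m → ZMod 2) (n : ℕ) :
    (Finset.univ.filter fun p : Fin n → Fin m => ∀ l, c (p l) = 0).card
      = (m - hammingNorm c) ^ n := by
  have h1 : (Finset.univ.filter fun p : Fin n → Fin m => ∀ l, c (p l) = 0)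
      = Fintype.piFinset fun _ => Finset.univ.filter fun j => c j = 0 := by
    ext p
    simp [Fintype.mem_piFinset]
  have h2 : (Finset.univ.filter fun j => c j = 0).card + hammingNorm c = m := by
    have := Finset.card_filter_add_card_filter_not (s := (Finset.univ : Finset (Fin m)))
      (fun j => c j = 0)
    rwa [Finset.card_univ, Fintype.card_fin] at this
  rw [h1, Fintype.card_piFinset, Finset.prod_const, Finset.card_univ, Fintype.card_fin]
  congr 1
  omega

open Classical in
-- A union bound over the nonzero codeword that vanishes.
theorem degenerateCount_le_sum :
    degenerateCount C n ≤ ∑ c : Fin m → ZMod 2 with c ∈ C ∧ c ≠ 0, (m - hammingNorm c) ^ n := by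
  have h : (Finset.univ.filter fun p : Fin n → Fin m => Degenerate C p)
      ⊆ (Finset.univ.filter fun c : Fin m → ZMod 2 => c ∈ C ∧ c ≠ 0).biUnion fun c =>
        Finset.univ.filter fun p : Fin n → Fin m => ∀ l, c (p l) = 0 := by
    intro p hp
    obtain ⟨v, hv, hv0, hvp⟩ := (Finset.mem_filter.1 hp).2
    simp only [Finset.mem_biUnion, Finset.mem_filter, Finset.mem_univ, true_and]
    exact ⟨v, ⟨hv, hv0⟩, hvp⟩
  refine (Finset.card_le_card h).trans (Finset.card_biUnion_le.trans_eq ?_)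
  exact Finset.sum_congr rfl fun c _ => card_vanishing c n

/-- If there are fewer distinct positions than dimensions, the tuple is degenerate. -/
theorem degenerate_of_card_lt {p : Fin n → Fin m}
    (h : (Finset.univ.image p).card < Module.finrank (ZMod 2) C) : Degenerate C p := by
  let f : C →ₗ[ZMod 2] (Finset.univ.image p → ZMod 2) :=
    (LinearMap.funLeft (ZMod 2) (ZMod 2) Subtype.val).comp C.subtype
  have hk : LinearMap.ker f ≠ ⊥ := LinearMap.ker_ne_bot_of_finrank_lt (by
    rwa [Module.finrank_fintype_fun_eq_card, Fintype.card_coe])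
  obtain ⟨v, hv, hv0⟩ := Submodule.exists_mem_ne_zero_of_ne_bot hk
  refine ⟨v, v.2, fun h => hv0 (Subtype.ext h), fun l => ?_⟩
  exact congrFun (LinearMap.mem_ker.1 hv) ⟨p l, Finset.mem_image_of_mem p (Finset.mem_univ l)⟩

theorem degenerateCount_of_lt_finrank (h : n < Module.finrank (ZMod 2) C) :
    degenerateCount C n = m ^ n := by
  classical
  rw [degenerateCount, Finset.filter_true_of_mem]
  · simp
  · intro p _
    refine degenerate_of_card_lt (Finset.card_image_le.trans_lt ?_)
    simpa using h

/-- A tuple with a repeated position imposes fewer conditions than the dimension, so nondegenerate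
tuples are injective. -/
theorem pow_le_degenerateCount_add (h : n ≤ Module.finrank (ZMod 2) C) :
    m ^ n ≤ degenerateCount C n + m.descFactorial n := by
  classical
  have h1 := Finset.card_filter_add_card_filter_not (s := (Finset.univ : Finset (Fin n → Fin m)))
    (fun p => Degenerate C p)
  have h2 : (Finset.univ.filter fun p : Fin n → Fin m => ¬ Degenerate C p)
      ⊆ Finset.univ.filter fun p : Fin n → Fin m => Function.Injective p := by
    intro p hp
    simp only [Finset.mem_filter, Finset.mem_univ, true_and] at hp ⊢
    by_contra hinj
    refine hp (degenerate_of_card_lt (lt_of_lt_of_le ?_ h))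
    refine lt_of_le_of_ne (Finset.card_image_le.trans_eq (by simp)) fun he => hinj ?_
    exact Set.injOn_univ.1 (by simpa using Finset.card_image_iff.1 (he.trans (Finset.card_fin n).symm))
  have h3 : (Finset.univ.filter fun p : Fin n → Fin m => Function.Injective p).card
      = m.descFactorial n := by
    rw [← Fintype.card_subtype, Fintype.card_congr (Equiv.subtypeInjectiveEquivEmbedding _ _),
      Fintype.card_embedding_eq, Fintype.card_fin, Fintype.card_fin]
  have h4 : Fintype.card (Fin n → Fin m) = m ^ n := by simp
  rw [Finset.card_univ, h4] at h1
  rw [← h1, ← h3]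
  exact Nat.add_le_add_left (Finset.card_le_card h2) _

/-- A birthday bound. The last half of the `⌈m/4⌉` factors are each at most `m * exp (-1/10)`, and
there are at least `m / 10` of them. -/
theorem descFactorial_le {m : ℕ} (hm : 12800 ≤ m) :
    4 * m.descFactorial ((m + 3) / 4) ≤ m ^ ((m + 3) / 4) := by
  set n := (m + 3) / 4 with hn
  set k := n / 2 with hk
  have h1 : m.descFactorial n = (m - k).descFactorial (n - k) * m.descFactorial k :=
    (Nat.descFactorial_mul_descFactorial (by omega)).symm
  have h2 : m.descFactorial n ≤ (m - k) ^ (n - k) * m ^ k := by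
    rw [h1]
    exact Nat.mul_le_mul (Nat.descFactorial_le_pow _ _) (Nat.descFactorial_le_pow _ _)
  have hm0 : (0 : ℝ) < m := by
    have : 0 < m := by omega
    exact_mod_cast this
  have hk1 : (m : ℝ) ≤ 10 * k := by
    have : m ≤ 10 * k := by omega
    exact_mod_cast this
  have hk2 : (m : ℝ) ≤ 10 * (n - k : ℕ) := by
    have : m ≤ 10 * (n - k) := by omega
    exact_mod_cast this
  have hm' : (12800 : ℝ) ≤ m := by exact_mod_cast hm
  have h3 : ((m - k : ℕ) : ℝ) ≤ m * Real.exp (-(1 / 10)) := by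
    rw [Nat.cast_sub (by omega)]
    have := Real.one_sub_le_exp_neg (1 / 10)
    nlinarith
  have h4 : ((m - k : ℕ) : ℝ) ^ (n - k) ≤ (m : ℝ) ^ (n - k) * (1 / 4) := by
    refine (pow_le_pow_left₀ (Nat.cast_nonneg _) h3 _).trans ?_
    rw [mul_pow, ← Real.exp_nat_mul]
    refine mul_le_mul_of_nonneg_left ?_ (by positivity)
    have h5 : ((n - k : ℕ) : ℝ) * -(1 / 10) ≤ -3 := by linarith
    refine (Real.exp_le_exp.2 h5).trans ?_
    rw [Real.exp_neg, inv_le_comm₀ (Real.exp_pos _) (by norm_num)]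
    exact le_trans (by norm_num) (Real.add_one_le_exp _)
  have h6 : (m.descFactorial n : ℝ) ≤ (m : ℝ) ^ n * (1 / 4) := by
    calc (m.descFactorial n : ℝ) ≤ ((m - k : ℕ) : ℝ) ^ (n - k) * (m : ℝ) ^ k := by
          exact_mod_cast h2
      _ ≤ ((m : ℝ) ^ (n - k) * (1 / 4)) * (m : ℝ) ^ k := by gcongr
      _ = (m : ℝ) ^ (n - k + k) * (1 / 4) := by ring
      _ = _ := by rw [Nat.sub_add_cancel (by omega)]
  have h7 : (4 * m.descFactorial n : ℝ) ≤ (m : ℝ) ^ n := by linarith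
  exact_mod_cast h7

theorem degenerateCount_le_pow (hC : ∀ c ∈ C, c ≠ 0 → m ≤ 10 * hammingNorm c) :
    (degenerateCount C n : ℝ) ≤ 2 ^ m * (9 / 10 * m) ^ n := by
  classical
  have h1 : (degenerateCount C n : ℝ)
      ≤ ∑ c : Fin m → ZMod 2 with c ∈ C ∧ c ≠ 0, ((m - hammingNorm c : ℕ) : ℝ) ^ n := by
    exact_mod_cast degenerateCount_le_sum
  refine h1.trans ((Finset.sum_le_card_nsmul _ _ ((9 / 10 * m : ℝ) ^ n) fun c hc => ?_).trans ?_)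
  · obtain ⟨hc1, hc0⟩ := (Finset.mem_filter.1 hc).2
    refine pow_le_pow_left₀ (Nat.cast_nonneg _) ?_ n
    have h2 := hC c hc1 hc0
    have h3 : hammingNorm c ≤ m := by
      have := hammingNorm_le_card_fintype (x := c)
      rwa [Fintype.card_fin] at this
    have h4 : (m : ℝ) ≤ 10 * hammingNorm c := by exact_mod_cast h2
    rw [Nat.cast_sub h3]
    linarith
  · rw [nsmul_eq_mul]
    refine mul_le_mul_of_nonneg_right ?_ (by positivity)
    have := Finset.card_le_univ (Finset.univ.filter fun c : Fin m → ZMod 2 => c ∈ C ∧ c ≠ 0)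
    rw [Fintype.card_fun, ZMod.card, Fintype.card_fin] at this
    exact_mod_cast this

/-- For a good code, ambiguous tuples of some length are frequent. -/
theorem exists_ambiguousCount_ge (hm : 12800 ≤ m)
    (hdim : m ≤ 4 * Module.finrank (ZMod 2) C)
    (hC : ∀ c ∈ C, c ≠ 0 → m ≤ 10 * hammingNorm c) :
    ∃ n, m ≤ 4 * n ∧ n ≤ 20 * m ∧ (m : ℝ) ^ n ≤ 40 * m * ambiguousCount C n := by
  by_contra! hcon
  have hm0 : (0 : ℝ) < m := by
    have : 0 < m := by omega
    exact_mod_cast this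
  set n₀ := (m + 3) / 4 with hn₀
  -- If ambiguity were always rarer than `1 / (40 m)`, the degenerate fraction would lose at most
  -- that much per added position and would still be at least 1/4 at length `20 m`.
  have key : ∀ k, n₀ + k ≤ 20 * m → (m : ℝ) ^ (n₀ + k) * (3 / 4 - k / (40 * m))
      ≤ degenerateCount C (n₀ + k) := by
    intro k
    induction k with
    | zero =>
      intro _
      have h1 := pow_le_degenerateCount_add (C := C) (n := n₀) (by omega)
      have h2 := descFactorial_le hm
      rw [← hn₀] at h2
      have h3 : 3 * m ^ n₀ ≤ 4 * degenerateCount C n₀ := by omega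
      have h4 : (3 * (m : ℝ) ^ n₀) ≤ 4 * degenerateCount C n₀ := by exact_mod_cast h3
      simp only [add_zero, Nat.cast_zero, zero_div, sub_zero]
      linarith
    | succ k ih =>
      intro hk
      have h1 := ih (by omega)
      have h2 := hcon (n₀ + k) (by omega) (by omega)
      have h3 : (m : ℝ) * degenerateCount C (n₀ + k)
          ≤ degenerateCount C (n₀ + k + 1) + m * ambiguousCount C (n₀ + k) := by
        exact_mod_cast mul_degenerateCount_le
      have h4 := mul_le_mul_of_nonneg_left h1 hm0.le
      rw [← add_assoc]
      have e : (m : ℝ) ^ (n₀ + k + 1) * (3 / 4 - (k + 1 : ℕ) / (40 * m))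
          = m * ((m : ℝ) ^ (n₀ + k) * (3 / 4 - k / (40 * m))) - (m : ℝ) ^ (n₀ + k) / 40 := by
        rw [pow_succ]
        push_cast
        field_simp
        ring
      rw [e]
      linarith
  have h1 := key (20 * m - n₀) (by omega)
  have e1 : n₀ + (20 * m - n₀) = 20 * m := by omega
  rw [e1] at h1
  have h2 := degenerateCount_le_pow (n := 20 * m) hC
  have h3 : ((20 * m - n₀ : ℕ) : ℝ) / (40 * m) ≤ 1 / 2 := by
    have : ((20 * m - n₀ : ℕ) : ℝ) ≤ 20 * m := by exact_mod_cast Nat.sub_le _ _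
    rw [div_le_div_iff₀ (by positivity) (by norm_num)]
    linarith
  have hp : (0 : ℝ) < (m : ℝ) ^ (20 * m) := by positivity
  have h4 : (2 : ℝ) ^ m * (9 / 10 * m) ^ (20 * m) = (2 * (9 / 10) ^ 20) ^ m * (m : ℝ) ^ (20 * m) := by
    rw [mul_pow, mul_pow, ← pow_mul, mul_assoc]
  -- At length `20 m` the union bound over at most `2 ^ m` codewords gives this. Already `2 *
  -- (9/10)^20 < 1/4`, which is the origin of the factor 20.
  have h5 : (2 * (9 / 10) ^ 20 : ℝ) ^ m < 1 / 4 := by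
    refine lt_of_le_of_lt (pow_le_of_le_one (by norm_num) (by norm_num) (by omega)) (by norm_num)
  have h6 : (m : ℝ) ^ (20 * m) * (1 / 4)
      ≤ (m : ℝ) ^ (20 * m) * (3 / 4 - ((20 * m - n₀ : ℕ) : ℝ) / (40 * m)) :=
    mul_le_mul_of_nonneg_left (by linarith) hp.le
  have h7 := mul_lt_mul_of_pos_right h5 hp
  linarith

end

end BayesADA

end

/-! ### Greedy extension of codes in the manner of Gilbert and Varshamov -/

noncomputable section

namespace BayesADA

variable {m n : ℕ} {C : Submodule (ZMod 2) (Fin m → ZMod 2)}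

open Classical in
/-- The sum of a function over the nonzero codewords. -/
def nonzeroSum (C : Submodule (ZMod 2) (Fin m → ZMod 2)) (φ : (Fin m → ZMod 2) → ℝ) : ℝ :=
  ∑ c with c ∈ C ∧ c ≠ 0, φ c

/-- The mean of a function over all words. -/
def wordMean (φ : (Fin m → ZMod 2) → ℝ) : ℝ := (∑ y, φ y) / 2 ^ m

theorem add_self_word (x : Fin m → ZMod 2) : x + x = 0 := by
  ext j
  exact CharTwo.add_self_eq_zero (x j)

theorem mem_sup_span_iff {x y : Fin m → ZMod 2} :
    y ∈ C ⊔ Submodule.span (ZMod 2) {x} ↔ y ∈ C ∨ x + y ∈ C := by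
  rw [Submodule.mem_sup]
  constructor
  · rintro ⟨c, hc, z, hz, rfl⟩
    obtain ⟨a, rfl⟩ := Submodule.mem_span_singleton.1 hz
    have h01 : ∀ a : ZMod 2, a = 0 ∨ a = 1 := by decide
    rcases h01 a with rfl | rfl
    · left
      simpa using hc
    · right
      rw [one_smul, add_left_comm, add_self_word, add_zero]
      exact hc
  · rintro (h | h)
    · exact ⟨y, h, 0, Submodule.zero_mem _, add_zero y⟩
    · refine ⟨x + y, h, x, Submodule.mem_span_singleton_self x, ?_⟩
      rw [add_right_comm, add_self_word, zero_add]

open Classical in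
theorem card_code : ((Finset.univ.filter fun c => c ∈ C).card : ℝ)
    = 2 ^ Module.finrank (ZMod 2) C := by
  have h := Module.card_eq_pow_finrank (K := ZMod 2) (V := C)
  rw [ZMod.card] at h
  have h2 : (Finset.univ.filter fun c => c ∈ C).card = Fintype.card C :=
    (Fintype.card_subtype fun c => c ∈ C).symm
  rw [h2, h]
  push_cast
  rfl

open Classical in
/-- Some coset has at most the average weight. -/
theorem exists_coset_sum_le (C : Submodule (ZMod 2) (Fin m → ZMod 2))
    (φ : (Fin m → ZMod 2) → ℝ) :
    ∃ x, ∑ c with c ∈ C, φ (x + c) ≤ 2 ^ Module.finrank (ZMod 2) C * wordMean φ := by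
  have h : ∑ x : Fin m → ZMod 2, ∑ c with c ∈ C, φ (x + c)
      = ∑ _x : Fin m → ZMod 2, 2 ^ Module.finrank (ZMod 2) C * wordMean φ := by
    have h1 : ∀ c, ∑ x : Fin m → ZMod 2, φ (x + c) = ∑ y, φ y := fun c =>
      Fintype.sum_equiv (Equiv.addRight c) _ _ fun _ => rfl
    rw [Finset.sum_comm]
    simp only [h1, Finset.sum_const, nsmul_eq_mul]
    rw [card_code, Finset.card_univ, Fintype.card_fun, ZMod.card, Fintype.card_fin, wordMean]
    push_cast
    field_simp
  obtain ⟨x, -, hx⟩ := Finset.exists_le_of_sum_le Finset.univ_nonempty h.le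
  exact ⟨x, hx⟩

/-- A code can be extended, with control of a potential that forbids light words. -/
theorem exists_extension (hm : 0 < m) {φ : (Fin m → ZMod 2) → ℝ} (h0 : ∀ y, 0 ≤ φ y)
    (hlight : ∀ y, 10 * hammingNorm y < m → 1 ≤ φ y)
    (hC : ∀ c ∈ C, c ≠ 0 → m ≤ 10 * hammingNorm c)
    (hsmall : 2 ^ Module.finrank (ZMod 2) C * wordMean φ < 1) :
    ∃ x ∉ C, (∀ c ∈ C ⊔ Submodule.span (ZMod 2) {x}, c ≠ 0 → m ≤ 10 * hammingNorm c) ∧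
      nonzeroSum (C ⊔ Submodule.span (ZMod 2) {x}) φ
        ≤ nonzeroSum C φ + 2 ^ Module.finrank (ZMod 2) C * wordMean φ := by
  classical
  obtain ⟨x, hx⟩ := exists_coset_sum_le C φ
  -- The potential of the chosen coset is below 1, while a single light word already costs at least
  -- 1. In particular the coset avoids zero, whence `x ∉ C`.
  have hcoset : ∀ c, x + c ∈ C → m ≤ 10 * hammingNorm c := fun c hc => by
    by_contra! hlt
    have h1 := Finset.single_le_sum (f := fun c => φ (x + c)) (fun c _ => h0 (x + c))
      (Finset.mem_filter.2 ⟨Finset.mem_univ (x + c), hc⟩ :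
        x + c ∈ Finset.univ.filter fun c => c ∈ C)
    rw [← add_assoc, add_self_word, zero_add] at h1
    linarith [hlight c hlt]
  refine ⟨x, fun hxC => ?_, fun c hc hc0 => ?_, ?_⟩
  · have := hcoset 0 (by rwa [add_zero])
    rw [hammingNorm_zero] at this
    omega
  · rcases mem_sup_span_iff.1 hc with h | h
    · exact hC c h hc0
    · exact hcoset c h
  · have hsub : (Finset.univ.filter fun c => c ∈ C ⊔ Submodule.span (ZMod 2) {x} ∧ c ≠ 0)
        ⊆ (Finset.univ.filter fun c => c ∈ C ∧ c ≠ 0)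
          ∪ (Finset.univ.filter fun c => c ∈ C).image fun c => x + c := by
      intro c hc
      obtain ⟨h1, h2⟩ := (Finset.mem_filter.1 hc).2
      rw [Finset.mem_union]
      rcases mem_sup_span_iff.1 h1 with h | h
      · exact .inl (Finset.mem_filter.2 ⟨Finset.mem_univ _, h, h2⟩)
      · refine .inr (Finset.mem_image.2 ⟨x + c, Finset.mem_filter.2 ⟨Finset.mem_univ _, h⟩, ?_⟩)
        rw [← add_assoc, add_self_word, zero_add]
    have h1 := Finset.sum_le_sum_of_subset_of_nonneg (f := φ) hsub fun c _ _ => h0 c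
    have h2 := Finset.sum_union_inter (f := φ) (s₁ := Finset.univ.filter fun c => c ∈ C ∧ c ≠ 0)
      (s₂ := (Finset.univ.filter fun c => c ∈ C).image fun c => x + c)
    have h3 := Finset.sum_nonneg (s := (Finset.univ.filter fun c => c ∈ C ∧ c ≠ 0)
      ∩ (Finset.univ.filter fun c => c ∈ C).image fun c => x + c) fun c _ => h0 c
    rw [Finset.sum_image fun a _ b _ h => add_left_cancel h] at h2
    unfold nonzeroSum
    linarith

theorem finrank_extension {x : Fin m → ZMod 2} (hx : x ∉ C) :
    Module.finrank (ZMod 2) ↥(C ⊔ Submodule.span (ZMod 2) {x})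
      = Module.finrank (ZMod 2) C + 1 :=
  Submodule.finrank_sup_span_singleton hx

/-- A greedily chosen code of small potential. -/
theorem exists_code (hm : 0 < m) {φ : (Fin m → ZMod 2) → ℝ} (h0 : ∀ y, 0 ≤ φ y)
    (hlight : ∀ y, 10 * hammingNorm y < m → 1 ≤ φ y) (k : ℕ) (hk : 2 ^ k * wordMean φ < 1) :
    ∃ C : Submodule (ZMod 2) (Fin m → ZMod 2), Module.finrank (ZMod 2) C = k ∧
      (∀ c ∈ C, c ≠ 0 → m ≤ 10 * hammingNorm c) ∧ nonzeroSum C φ ≤ 2 ^ k * wordMean φ := by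
  have hmean : 0 ≤ wordMean φ :=
    div_nonneg (Finset.sum_nonneg fun y _ => h0 y) (by positivity)
  induction k with
  | zero =>
    refine ⟨⊥, finrank_bot _ _, fun c hc hc0 => absurd ((Submodule.mem_bot _).1 hc) hc0, ?_⟩
    have : nonzeroSum (⊥ : Submodule (ZMod 2) (Fin m → ZMod 2)) φ = 0 := by
      classical
      unfold nonzeroSum
      refine Finset.sum_eq_zero fun c hc => ?_
      obtain ⟨h1, h2⟩ := (Finset.mem_filter.1 hc).2
      exact absurd ((Submodule.mem_bot _).1 h1) h2
    rw [this]
    positivity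
  | succ k ih =>
    have hk' : 2 ^ k * wordMean φ < 1 := lt_of_le_of_lt (mul_le_mul_of_nonneg_right
      (pow_le_pow_right₀ (by norm_num) (Nat.le_succ k)) hmean) hk
    obtain ⟨C, hdim, hC, hsum⟩ := ih hk'
    obtain ⟨x, hx, h1, h2⟩ := exists_extension hm h0 hlight hC (by rwa [hdim])
    refine ⟨C ⊔ Submodule.span (ZMod 2) {x}, by rw [finrank_extension hx, hdim], h1, ?_⟩
    rw [hdim] at h2
    rw [pow_succ]
    linarith

/-- A tuple which becomes degenerate in an extension by one dimension is ambiguous. -/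
theorem degenerateCount_extension_le (x : Fin m → ZMod 2) :
    degenerateCount (C ⊔ Submodule.span (ZMod 2) {x}) n
      ≤ degenerateCount C n + ambiguousCount (C ⊔ Submodule.span (ZMod 2) {x}) n := by
  classical
  refine (Finset.card_le_card fun p hp => ?_).trans (Finset.card_union_le _ _)
  have hp' := (Finset.mem_filter.1 hp).2
  simp only [Finset.mem_union, Finset.mem_filter, Finset.mem_univ, true_and]
  by_cases hd : Degenerate C p
  · exact .inl hd
  right
  have hC : ∀ v ∈ C, (∀ l, v (p l) = 0) → v = 0 := fun v hv hvp => by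
    by_contra h
    exact hd ⟨v, hv, h, hvp⟩
  obtain ⟨w, hw, hw0, hwp⟩ := hp'
  refine ⟨w, hw, hw0, hwp, fun v hv hvp => ?_⟩
  rcases mem_sup_span_iff.1 hv with h | h
  · exact .inl (hC v h hvp)
  rcases mem_sup_span_iff.1 hw with h' | h'
  · exact absurd (hC w h' hwp) hw0
  right
  -- Both words lie in the coset `x + C`, so their difference is a word of `C` vanishing at `p`,
  -- which is zero as `p` is nondegenerate for `C`.
  have h1 : v - w ∈ C := by
    have := C.sub_mem h h'
    rwa [add_sub_add_left_eq_sub] at this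
  exact sub_eq_zero.1 (hC _ h1 fun l => by rw [Pi.sub_apply, hvp, hwp, sub_zero])

/-- The weight enumerator of the full space. -/
theorem sum_pow_hammingNorm (a : ℝ) :
    ∑ y : Fin m → ZMod 2, a ^ hammingNorm y = (1 + a) ^ m := by
  have h1 : ∀ y : Fin m → ZMod 2, a ^ hammingNorm y = ∏ j, if y j = 0 then 1 else a := fun y => by
    rw [hammingNorm, Finset.prod_ite, Finset.prod_const_one, one_mul, Finset.prod_const]
  simp only [h1]
  have h2 := Fintype.prod_sum fun (_ : Fin m) (b : ZMod 2) => if b = 0 then (1 : ℝ) else a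
  rw [← h2, Finset.prod_const, Finset.card_univ, Fintype.card_fin]
  congr 1
  exact Fin.sum_univ_two (f := fun b : ZMod 2 => if b = 0 then (1 : ℝ) else a)

end BayesADA

end

/-! ### Good codes of length `2n` with frequent ambiguity -/

noncomputable section

namespace BayesADA

variable {m n : ℕ}

/-- The indicator of words of weight below `m / 10`. -/
def lightIndicator (y : Fin m → ZMod 2) : ℝ := if 10 * hammingNorm y < m then 1 else 0

theorem lightIndicator_nonneg (y : Fin m → ZMod 2) : 0 ≤ lightIndicator y := by
  unfold lightIndicator
  split_ifs <;> norm_num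

theorem one_le_lightIndicator (y : Fin m → ZMod 2) (h : 10 * hammingNorm y < m) :
    1 ≤ lightIndicator y := (if_pos h).ge

/-- A Chernoff bound with parameter 1/9. Because `1.246 ^ 10 ≥ 9`, the factor `1.246 ^ m`
compensates the weights below `m / 10`, and `1.246 * (10/9) / 2 ≤ 7/10`. -/
theorem wordMean_lightIndicator_le : wordMean (lightIndicator (m := m)) ≤ (7 / 10) ^ m := by
  have h1 : ∀ y : Fin m → ZMod 2,
      lightIndicator y ≤ (1.246 : ℝ) ^ m * (1 / 9 : ℝ) ^ hammingNorm y := fun y => by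
    unfold lightIndicator
    split_ifs with h
    · have h2 : (1.246 : ℝ) ^ (10 * hammingNorm y) ≤ (1.246 : ℝ) ^ m :=
        pow_le_pow_right₀ (by norm_num) h.le
      have h3 : (1 : ℝ) ≤ ((1.246 : ℝ) ^ 10 * (1 / 9)) ^ hammingNorm y :=
        one_le_pow₀ (by norm_num)
      rw [mul_pow, ← pow_mul] at h3
      exact h3.trans (mul_le_mul_of_nonneg_right h2 (by positivity))
    · positivity
  have h2 := Finset.sum_le_sum fun y (_ : y ∈ (Finset.univ : Finset (Fin m → ZMod 2))) => h1 y
  rw [← Finset.mul_sum, sum_pow_hammingNorm, ← mul_pow] at h2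
  rw [wordMean, div_le_iff₀ (by positivity), ← mul_pow]
  exact h2.trans (pow_le_pow_left₀ (by norm_num) (by norm_num) m)

/-- A potential which also controls the probability that a codeword vanishes. -/
def codePotential (y : Fin m → ZMod 2) : ℝ := (8 / 13) ^ hammingNorm y + lightIndicator y

theorem wordMean_codePotential_le :
    wordMean (codePotential (m := m)) ≤ (21 / 26) ^ m + (7 / 10) ^ m := by
  have h1 : wordMean (codePotential (m := m))
      = (1 + 8 / 13) ^ m / 2 ^ m + wordMean (lightIndicator (m := m)) := by
    unfold wordMean codePotential
    rw [Finset.sum_add_distrib, sum_pow_hammingNorm, add_div]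
  rw [h1, ← div_pow]
  refine add_le_add (le_of_eq ?_) wordMean_lightIndicator_le
  norm_num

/-- A word of weight `w` vanishes at `n` random positions out of `2n` with probability at most `exp
(-w/2)`, and `exp (-1/2) ≤ 8/13`. This explains the base in `codePotential`. -/
theorem one_sub_pow_le {w : ℕ} (hn : 0 < n) (hw : w ≤ 2 * n) :
    ((2 * n - w : ℕ) : ℝ) ^ n ≤ (2 * n : ℝ) ^ n * (8 / 13) ^ w := by
  have hn' : (0 : ℝ) < n := by exact_mod_cast hn
  have h1 : ((2 * n - w : ℕ) : ℝ) ≤ 2 * n * Real.exp (-(w / (2 * n))) := by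
    rw [Nat.cast_sub hw]
    have h2 := mul_le_mul_of_nonneg_left (Real.one_sub_le_exp_neg (w / (2 * n : ℝ)))
      (by positivity : (0 : ℝ) ≤ 2 * n)
    refine le_of_eq_of_le ?_ h2
    push_cast
    field_simp
  refine (pow_le_pow_left₀ (Nat.cast_nonneg _) h1 n).trans ?_
  rw [mul_pow]
  refine mul_le_mul_of_nonneg_left ?_ (by positivity)
  rw [← Real.exp_nat_mul]
  have h3 : (n : ℝ) * -(w / (2 * n)) = w * (-(1 / 2)) := by field_simp
  rw [h3, Real.exp_nat_mul]
  refine pow_le_pow_left₀ (Real.exp_pos _).le ?_ w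
  rw [Real.exp_neg, inv_le_comm₀ (Real.exp_pos _) (by norm_num)]
  exact le_trans (by norm_num) (Real.quadratic_le_exp_of_nonneg (by norm_num))

theorem degenerateCount_le_of_potential {C : Submodule (ZMod 2) (Fin (2 * n) → ZMod 2)}
    (hn : 0 < n) (hC : nonzeroSum C codePotential ≤ 1 / 2) :
    2 * degenerateCount C n ≤ (2 * n) ^ n := by
  classical
  have h1 : (degenerateCount C n : ℝ)
      ≤ ∑ c : Fin (2 * n) → ZMod 2 with c ∈ C ∧ c ≠ 0,
        ((2 * n - hammingNorm c : ℕ) : ℝ) ^ n := by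
    exact_mod_cast degenerateCount_le_sum
  have h2 : ∑ c : Fin (2 * n) → ZMod 2 with c ∈ C ∧ c ≠ 0,
        ((2 * n - hammingNorm c : ℕ) : ℝ) ^ n
      ≤ (2 * n : ℝ) ^ n * nonzeroSum C codePotential := by
    unfold nonzeroSum
    rw [Finset.mul_sum]
    refine le_of_le_of_eq (Finset.sum_le_sum fun c _ => ?_) (by congr!)
    have h3 : hammingNorm c ≤ 2 * n := by
      have := hammingNorm_le_card_fintype (x := c)
      rwa [Fintype.card_fin] at this
    refine (one_sub_pow_le hn h3).trans (mul_le_mul_of_nonneg_left ?_ (by positivity))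
    exact le_add_of_nonneg_right (lightIndicator_nonneg c)
  have h3 : (2 * n : ℝ) ^ n * nonzeroSum C codePotential ≤ (2 * n : ℝ) ^ n * (1 / 2) :=
    mul_le_mul_of_nonneg_left hC (by positivity)
  have h4 : (2 * degenerateCount C n : ℝ) ≤ (2 * n : ℝ) ^ n := by linarith
  exact_mod_cast h4

/-- There are good codes of every large length `2n` for which ambiguous tuples of length `n` are
frequent. -/
theorem exists_good_code (hn : 3200 ≤ n) :
    ∃ C : Submodule (ZMod 2) (Fin (2 * n) → ZMod 2), 2 * n ≤ 4 * Module.finrank (ZMod 2) C ∧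
      (∀ c ∈ C, c ≠ 0 → 2 * n ≤ 10 * hammingNorm c) ∧
      (2 * n) ^ n ≤ 40 * (2 * n) * ambiguousCount C n := by
  by_contra! hcon
  -- The least dimension that meets the requirement of a quarter of the length `2n`.
  set k := (n + 1) / 2 with hk
  have hmean0 : 0 ≤ wordMean (lightIndicator (m := 2 * n)) :=
    div_nonneg (Finset.sum_nonneg fun y _ => lightIndicator_nonneg y) (by positivity)
  have hsmall : ∀ {a : ℝ}, 0 ≤ a → a ≤ 979 / 1000 → a ^ n ≤ 1 / 8 := fun {a} h0 h1 => by
    calc a ^ n ≤ (979 / 1000 : ℝ) ^ n := pow_le_pow_left₀ h0 h1 n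
      _ ≤ (979 / 1000 : ℝ) ^ 100 := pow_le_pow_of_le_one (by norm_num) (by norm_num) (by omega)
      _ ≤ 1 / 8 := by norm_num
  -- A rational substitute for `√2 ≤ 3/2`. It is affordable because `3/2 * (21/26)² < 979/1000`.
  have h2k : (2 : ℝ) ^ k ≤ 2 * (3 / 2) ^ n := by
    calc (2 : ℝ) ^ k ≤ (9 / 4) ^ k := pow_le_pow_left₀ (by norm_num) (by norm_num) k
      _ = (3 / 2) ^ (2 * k) := by rw [pow_mul]; norm_num
      _ ≤ (3 / 2) ^ (n + 1) := pow_le_pow_right₀ (by norm_num) (by omega)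
      _ = (3 / 2) * (3 / 2) ^ n := by ring
      _ ≤ _ := mul_le_mul_of_nonneg_right (by norm_num) (by positivity)
  have hpot : (2 : ℝ) ^ k * wordMean (codePotential (m := 2 * n)) ≤ 1 / 2 := by
    have h1 := mul_le_mul h2k (wordMean_codePotential_le (m := 2 * n))
      (div_nonneg (Finset.sum_nonneg fun y _ => add_nonneg (by positivity)
        (lightIndicator_nonneg y)) (by positivity)) (by positivity)
    have e : 2 * (3 / 2 : ℝ) ^ n * ((21 / 26) ^ (2 * n) + (7 / 10) ^ (2 * n))
        = 2 * ((3 / 2 * (21 / 26) ^ 2) ^ n + (3 / 2 * (7 / 10) ^ 2) ^ n) := by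
      rw [mul_pow, mul_pow, pow_mul, pow_mul]
      ring
    rw [e] at h1
    have h2 := hsmall (a := 3 / 2 * (21 / 26) ^ 2) (by norm_num) (by norm_num)
    have h3 := hsmall (a := 3 / 2 * (7 / 10) ^ 2) (by norm_num) (by norm_num)
    linarith
  -- In units of `1 / (40 * 2n)`, the degenerate fraction starts at no more than 1/2 and, if
  -- ambiguity is always rare, gains at most one unit per dimension. The full potential is needed
  -- only for the start. Later extensions only avoid light words, which is possible up to dimension
  -- `n + 1` since `2 * (7/10)² < 1`.
  have key : ∀ j, k + j ≤ n + 1 → ∃ C : Submodule (ZMod 2) (Fin (2 * n) → ZMod 2),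
      Module.finrank (ZMod 2) C = k + j ∧ (∀ c ∈ C, c ≠ 0 → 2 * n ≤ 10 * hammingNorm c) ∧
      40 * (2 * n) * degenerateCount C n ≤ (20 * (2 * n) + j) * (2 * n) ^ n := by
    intro j
    induction j with
    | zero =>
      intro _
      obtain ⟨C, h1, h2, h3⟩ := exists_code (m := 2 * n) (by omega) (φ := codePotential)
        (fun y => add_nonneg (by positivity) (lightIndicator_nonneg y))
        (fun y hy => (one_le_lightIndicator y hy).trans
          (le_add_of_nonneg_left (by positivity))) k (hpot.trans_lt (by norm_num))
      refine ⟨C, h1, h2, ?_⟩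
      have h4 := degenerateCount_le_of_potential (by omega) (h3.trans hpot)
      calc 40 * (2 * n) * degenerateCount C n = 20 * (2 * n) * (2 * degenerateCount C n) := by ring
        _ ≤ 20 * (2 * n) * (2 * n) ^ n := Nat.mul_le_mul_left _ h4
    | succ j ih =>
      intro hj
      obtain ⟨C, h1, h2, h3⟩ := ih (by omega)
      have hlt : (2 : ℝ) ^ Module.finrank (ZMod 2) C * wordMean (lightIndicator (m := 2 * n))
          < 1 := by
        have h4 : (2 : ℝ) ^ Module.finrank (ZMod 2) C ≤ 2 ^ n :=
          pow_le_pow_right₀ (by norm_num) (by omega)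
        have h5 := mul_le_mul h4 (wordMean_lightIndicator_le (m := 2 * n)) hmean0 (by positivity)
        rw [pow_mul, ← mul_pow] at h5
        have h6 : (2 * (7 / 10) ^ 2 : ℝ) ^ n < 1 :=
          pow_lt_one₀ (by norm_num) (by norm_num) (by omega)
        exact h5.trans_lt h6
      obtain ⟨x, hx, h4, -⟩ := exists_extension (by omega) lightIndicator_nonneg
        one_le_lightIndicator h2 hlt
      have hdim := finrank_extension hx
      refine ⟨C ⊔ Submodule.span (ZMod 2) {x}, by omega, h4, ?_⟩
      have h5 := degenerateCount_extension_le (n := n) (C := C) x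
      have h6 := hcon (C ⊔ Submodule.span (ZMod 2) {x}) (by omega) h4
      have h7 := Nat.mul_le_mul_left (40 * (2 * n)) h5
      rw [mul_add] at h7
      have e : (20 * (2 * n) + (j + 1)) * (2 * n) ^ n
          = (20 * (2 * n) + j) * (2 * n) ^ n + (2 * n) ^ n := by ring
      rw [e]
      omega
  -- In dimension `n + 1` every tuple of length `n` is degenerate, but at most `n + 1` units have
  -- been gained, far fewer than the missing half.
  obtain ⟨C, h1, -, h3⟩ := key (n + 1 - k) (by omega)
  rw [degenerateCount_of_lt_finrank (by omega)] at h3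
  have h4 := Nat.le_of_mul_le_mul_right h3 (by positivity)
  omega

end BayesADA

end

/-! ### Conclusion -/

theorem BayesADA.isGoodCode_iff {m : ℕ} {C : Submodule (ZMod 2) (Fin m → ZMod 2)} :
    BayesADA.IsGoodCode C ↔ m ≤ 4 * Module.finrank (ZMod 2) C ∧
      ∀ c ∈ C, c ≠ 0 → m ≤ 10 * hammingNorm c := by
  refine and_congr_right fun _ => ⟨fun h c hc hc0 => ?_, fun h c hc c' hc' hne => ?_⟩
  · have := h c hc 0 C.zero_mem hc0
    rwa [hammingDist_zero_right] at this
  · rw [hammingDist_eq_hammingNorm]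
    exact h _ (C.add_mem (C.neg_mem hc) hc') fun h0 => hne (neg_add_eq_zero.1 h0)

theorem mainTheorem2 :
    ∃ (ε δ K : ℝ) (N₀ : ℕ), 0 < ε ∧ 0 < δ ∧ 0 < K ∧
      -- for every large `n` there is a code of length `m = Θ(n)` on which the attack works
      (∀ n : ℕ, N₀ ≤ n →
        ∃ (m : ℕ) (_ : NeZero m) (C : Submodule (ZMod 2) (Fin m → ZMod 2)) (q : ℕ),
          m ≤ 4 * n ∧ n ≤ 20 * m ∧ BayesADA.IsGoodCode C ∧
          (q : ℝ) ≤ K * (n : ℝ) ^ 4 * Real.log n ∧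
          BayesADA.OneStrategyDefeats (BayesADA.hardModel C q) n q ε δ) ∧
      -- the attack works on every good code of large length `m`, for some `n = Θ(m)`
      (∀ (m : ℕ) [NeZero m] (C : Submodule (ZMod 2) (Fin m → ZMod 2)), N₀ ≤ m →
        BayesADA.IsGoodCode C →
        ∃ n q : ℕ, m ≤ 4 * n ∧ n ≤ 20 * m ∧
          (q : ℝ) ≤ K * (n : ℝ) ^ 4 * Real.log n ∧
          BayesADA.OneStrategyDefeats (BayesADA.hardModel C q) n q ε δ) := by
  -- The threshold 12800 on `m` yields `n ≥ m / 4 ≥ 3200`, which the estimates in `n` require.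
  refine ⟨1 / 40, 1 / 200, 130000, 12800, by norm_num, by norm_num, by norm_num, ?_, ?_⟩
  · intro n hn
    obtain ⟨C, h1, h2, h3⟩ := BayesADA.exists_good_code (n := n) (by omega)
    have hm : NeZero (2 * n) := ⟨by omega⟩
    have hgood := BayesADA.isGoodCode_iff.2 ⟨h1, h2⟩
    obtain ⟨q, hq, hdef⟩ := BayesADA.Model.exists_oneStrategyDefeats (n := n) (m := 2 * n) (C := C)
      (by omega) (by omega) (by omega) hgood.2 (by exact_mod_cast h3)
    exact ⟨2 * n, hm, C, q, by omega, by omega, hgood, hq, hdef⟩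
  · intro m _ C hm hgood
    obtain ⟨h1, h2⟩ := BayesADA.isGoodCode_iff.1 hgood
    obtain ⟨n, hn1, hn2, hn3⟩ := BayesADA.exists_ambiguousCount_ge hm h1 h2
    obtain ⟨q, hq, hdef⟩ := BayesADA.Model.exists_oneStrategyDefeats (n := n) (m := m) (C := C)
      (by omega) hn1 hn2 hgood.2 hn3
    exact ⟨n, q, hn1, hn2, hq, hdef⟩
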